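/- **Setting.** Let $n\ge k$ and let $X=(X_1,\dots,X_n)\in\mathcal X^n$ and $Y=(Y_{i,j})_{1\le i<j\le n}\in\mathcal Y^{n(n-1)/2}$ be two families of i.i.d. random variables, independent of each other; put $Y_{j,i}=Y_{i,j}$. Write $[k]=\{1,\dots,k\}$ and $[k]_2=\{(i,j):1\le i<j\le k\}$. A measurable function $f:\mathcal X^k\times\mathcal Y^{k(k-1)/2}\to\mathbb R$ is called symmetric if, almost surely, $f(X_{i_1},\dots,X_{i_k};Y_{i_1,i_2},\dots,Y_{i_{k-1},i_k})$ does not change when the indices are permuted; the same definition applies to functions of the edge variables only. Let $$S_{n,k}(f)=\sum_{1\le\alpha(1)<\dots<\alpha(k)\le n} f(X_{\alpha(1)},\dots,X_{\alpha(k)};Y_{\alpha(1),\alpha(2)},\dots,Y_{\alpha(k-1),\alpha(k)}).$$ For $A\subset[k]$ and $B\subset[k]_2$ let $X_A=(X_i)_{i\in A}$, $Y_B=(Y_{i,j})_{(i,j)\in B}$, and let $$f_{A,B}(x_A;y_B)=\sum_{A'\subset A,\;B'\subset B}(-1)^{|A|+|B|-|A'|-|B'|}\,\mathbb E\{f(X_{[k]};Y_{[k]_2})\mid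 X_{A'}=x_{A'},\,Y_{B'}=y_{B'}\}$$ be the components of the Hoeffding decomposition of $f$, where the conditional expectation is computed by integrating out the other (independent) variables. Let $\sigma_{A,B}=\|f_{A,B}(X_A;Y_B)\|_2$. Let $G_{A,B}$ be the graph whose edges are the pairs in $B$ and whose nodes are the elements of $A$ and the endpoints of the edges in $B$, and let $v_{A,B}$ be its number of nodes. Let $f_{(\ell)}=\sum_{v_{A,B}=\ell}f_{A,B}(X_A;Y_B)$. The principal degree of $f$ is $d=\min\{\ell>0: f_{(\ell)}\text{ is not almost surely }0\}$, and the principal support graphs are the elements of $\mathcal G_{f,d}=\{G_{A,B}:\sigma_{A,B}\ne0,\ v_{A,B}=d\}$. A graph is called strongly connected if deleting any one of its nodes, together with the edges at that node, leaves a graph that is connected or has no nodes. **Theorem.** Suppose that $f$ is symmetric with principal degree $d$, where $2\le d\le k$, that $\tau:=\|f(X_{[k]};Y_{[k]_2})\|_4<\infty$, and let $\sigma_{\min}=\min\{\sigma_{A,B}:G_{A,B}\in\mathcal G_{f,d}\}$. Suppose that $f(X_{[k]};Y_{[k]_2})=g(Y_{[k]_2})$ almost surely for some symmetric measurable $g:\mathcal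 Y^{k(k-1)/2}\to\mathbb R$, and that all graphs in $\mathcal G_{f,d}$ are connected and strongly connected. Then $$\sup_{z\in\mathbb R}\left|\mathbb P\left[\frac{S_{n,k}(g)-\mathbb E\{S_{n,k}(g)\}}{\sqrt{\operatorname{Var}\{S_{n,k}(g)\}}}\le z\right]-\Phi(z)\right|\le C\,n^{-1},$$ where $\Phi$ is the standard normal distribution function and $C>0$ is a constant depending only on $k$, $d$, $\sigma_{\min}$ and $\tau$. -/

import Mathlib

open MeasureTheory ProbabilityTheory

universe u v w

namespace GenUStat

noncomputable section

/-- Unordered pairs of distinct elements of `{1, …, n}`: the indices of the edge variables.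
Using unordered pairs builds in the convention `Y_{j,i} = Y_{i,j}`. -/
abbrev Pairs (n : ℕ) : Type := {e : Sym2 (Fin n) // ¬ e.IsDiag}

/-- The pair `{i, j}` is sent to `{α i, α j}`. -/
def Pairs.map {k n : ℕ} (α : Fin k ↪ Fin n) (e : Pairs k) : Pairs n :=
  ⟨Sym2.map α e.1, fun h => e.2 ((Sym2.isDiag_map α.injective).1 h)⟩

/-- Vertex variables `x_1, …, x_n` together with edge variables `y_{i,j}`, `i < j`. -/
abbrev Vars (𝒳 𝒴 : Type*) (n : ℕ) : Type _ := (Fin n → 𝒳) × (Pairs n → 𝒴)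

section Defs

variable {𝒳 𝒴 : Type*}

/-- The arguments `(x_{α(1)}, …, x_{α(k)}; y_{α(1),α(2)}, …, y_{α(k-1),α(k)})`. -/
def select {k n : ℕ} (α : Fin k ↪ Fin n) (p : Vars 𝒳 𝒴 n) : Vars 𝒳 𝒴 k :=
  (fun i => p.1 (α i), fun e => p.2 (e.map α))

/-- The generalized `U`-statistic: the sum of `f` over all
`1 ≤ α(1) < ⋯ < α(k) ≤ n`. -/
def uStat {k : ℕ} (f : Vars 𝒳 𝒴 k → ℝ) (n : ℕ) (p : Vars 𝒳 𝒴 n) : ℝ :=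
  ∑ α : Fin k ↪o Fin n, f (select α.toEmbedding p)

variable [MeasurableSpace 𝒳] [MeasurableSpace 𝒴]

/-- The joint law of `(X_1, …, X_k; Y_{1,2}, …, Y_{k-1,k})`, where all variables are independent,
the `X_i` have law `μ` and the `Y_{i,j}` have law `ν`. -/
def law (μ : Measure 𝒳) (ν : Measure 𝒴) (k : ℕ) : Measure (Vars 𝒳 𝒴 k) :=
  (Measure.pi fun _ => μ).prod (Measure.pi fun _ => ν)

/-- `f(X_{π(1)}, …; Y_{π(1),π(2)}, …) = f(X_1, …; Y_{1,2}, …)` almost surely for each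
permutation `π` of the indices. -/
def IsSymm (μ : Measure 𝒳) (ν : Measure 𝒴) {k : ℕ} (f : Vars 𝒳 𝒴 k → ℝ) : Prop :=
  ∀ π : Equiv.Perm (Fin k), ∀ᵐ p ∂(law μ ν k), f (select π.toEmbedding p) = f p

/-- `E{f(X; Y) | X_A = x_A, Y_B = y_B}`: by independence, the variables outside `A` and `B` are
integrated out. -/
def condMean (μ : Measure 𝒳) (ν : Measure 𝒴) {k : ℕ} (f : Vars 𝒳 𝒴 k → ℝ)
    (A : Finset (Fin k)) (B : Finset (Pairs k)) (p : Vars 𝒳 𝒴 k) : ℝ :=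
  ∫ q, f (A.piecewise p.1 q.1, B.piecewise p.2 q.2) ∂(law μ ν k)

/-- The component `f_{A,B}` of the Hoeffding decomposition of `f`, as a function of all variables
that depends only on `x_A` and `y_B`. -/
def comp (μ : Measure 𝒳) (ν : Measure 𝒴) {k : ℕ} (f : Vars 𝒳 𝒴 k → ℝ)
    (A : Finset (Fin k)) (B : Finset (Pairs k)) (p : Vars 𝒳 𝒴 k) : ℝ :=
  ∑ A' ∈ A.powerset, ∑ B' ∈ B.powerset,
    (-1 : ℝ) ^ ((A.card - A'.card) + (B.card - B'.card)) * condMean μ ν f A' B' p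

/-- `σ_{A,B}`, the `L²`-norm of `f_{A,B}(X_A; Y_B)`. -/
def sigma (μ : Measure 𝒳) (ν : Measure 𝒴) {k : ℕ} (f : Vars 𝒳 𝒴 k → ℝ)
    (A : Finset (Fin k)) (B : Finset (Pairs k)) : ℝ :=
  (eLpNorm (comp μ ν f A B) 2 (law μ ν k)).toReal

/-- The graph `G_{A,B}`: its edges are the pairs in `B`, its nodes are the elements of `A` and the
endpoints of the edges. -/
def graph {k : ℕ} (A : Finset (Fin k)) (B : Finset (Pairs k)) :
    (⊤ : SimpleGraph (Fin k)).Subgraph where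
  verts := {v | v ∈ A ∨ ∃ e ∈ B, v ∈ e.1}
  Adj u v := ∃ e ∈ B, e.1 = s(u, v)
  adj_sub := by
    rintro u v ⟨e, -, he⟩
    have h := e.2
    rw [he, Sym2.mk_isDiag_iff] at h
    exact h
  edge_vert := by
    rintro u v ⟨e, heB, he⟩
    exact Or.inr ⟨e, heB, he ▸ Sym2.mem_mk_left u v⟩
  symm := ⟨fun u v ⟨e, heB, he⟩ => ⟨e, heB, he.trans Sym2.eq_swap⟩⟩

/-- `v_{A,B}`, the number of nodes of `G_{A,B}`. -/
def numNodes {k : ℕ} (A : Finset (Fin k)) (B : Finset (Pairs k)) : ℕ :=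
  (graph A B).verts.ncard

/-- Deleting any one node (and its edges) leaves a graph that is connected or has no nodes. -/
def StronglyConnected {V : Type*} {H : SimpleGraph V} (G : H.Subgraph) : Prop :=
  ∀ r ∈ G.verts, (G.deleteVerts {r}).Connected ∨ (G.deleteVerts {r}).verts = ∅

open Classical in
/-- `f_{(ℓ)}`, the sum of the `f_{A,B}` over all `(A, B)` with `v_{A,B} = ℓ`. -/
def levelPart (μ : Measure 𝒳) (ν : Measure 𝒴) {k : ℕ} (f : Vars 𝒳 𝒴 k → ℝ) (ℓ : ℕ)
    (p : Vars 𝒳 𝒴 k) : ℝ :=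
  ∑ AB : Finset (Fin k) × Finset (Pairs k) with numNodes AB.1 AB.2 = ℓ, comp μ ν f AB.1 AB.2 p

/-- `d` is the principal degree of `f`: the least `ℓ > 0` such that `f_{(ℓ)}` is not almost
surely zero. -/
def IsPrincipalDegree (μ : Measure 𝒳) (ν : Measure 𝒴) {k : ℕ} (f : Vars 𝒳 𝒴 k → ℝ)
    (d : ℕ) : Prop :=
  IsLeast {ℓ : ℕ | 0 < ℓ ∧ ¬ (levelPart μ ν f ℓ =ᵐ[law μ ν k] 0)} d

/-- The index pairs `(A, B)` of the graphs `G_{A,B}` in `𝒢_{f,d}`: `σ_{A,B} ≠ 0` and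
`v_{A,B} = d`. -/
def supportPairs (μ : Measure 𝒳) (ν : Measure 𝒴) {k : ℕ} (f : Vars 𝒳 𝒴 k → ℝ) (d : ℕ) :
    Set (Finset (Fin k) × Finset (Pairs k)) :=
  {AB | sigma μ ν f AB.1 AB.2 ≠ 0 ∧ numNodes AB.1 AB.2 = d}

end Defs

end

end GenUStat

namespace GenUStat

set_option linter.unusedSectionVars false

open Filter Topology Set

/-! Since `f` is almost surely a function of the edge variables, the components with vertex
variables vanish, and the centered statistic is almost surely a sum of Hoeffding components of `g`,
each placed on a copy of its edge set in `{1, …, n}` (`copySum_ae_eq`). Such a component has mean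
zero as soon as one of its edges is integrated out.

Double every edge variable. Swapping the two entries at an edge `e` resamples this edge and turns
the normalized sum `W` into an exchangeable pair `(W, W_e)`. Let `F_e` be the change `W - W_e` with
the contribution of a component on `b` edges weighted by `1 / b`. Degeneracy gives `E φ(W) W = ∑ E
φ(W) F_e`, and Stein's method (`berry_esseen_of_exchangeable`) bounds the Kolmogorov distance by
twice `E|1 - (1/2) ∑ F_e (W - W_e)|` plus twice `E|∑ |F_e| (W - W_e)|`. The derivative of the Stein
solution is an increasing plus a decreasing bounded function. Hence its Taylor remainder is at most
a product of increments, which exchangeability converts into the second error; no concentration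
inequality is needed, and the sum over edges stays inside the absolute value.

The second moments of both errors expand into quadruples of placed components. An expectation
vanishes unless every edge is covered at least twice by the quadruple. The variance is at least of
order `n ^ (2k - d)`, so the rate `1 / n` requires a saving of `n ^ (2d + 2)` against all `n ^ (4k)`
placements. For the first error the contributing quadruples are linked. Double covering of the nodes
saves `2d` and the last 2 comes from strong connectivity: a component on exactly `d` nodes has two
nodes in at least three of the four node sets, or its nodes all lie in one other set
(`two_le_card_or_subset`, `card_nodes_le_of_linked`). For the second error the summands are
antisymmetric, so two edges interact only through components that contain both
(`integral_sum_abs_mul_sq_le`, `pairCount_copies_le`); this needs no connectivity. -/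

/-! ### The Stein equation for the indicator of a half-line -/

/-- The standard normal density. -/
noncomputable def npdf (x : ℝ) : ℝ := gaussianPDFReal 0 1 x

/-- The standard normal distribution function. -/
noncomputable def ncdf (x : ℝ) : ℝ := cdf (gaussianReal 0 1) x

lemma npdf_pos (x : ℝ) : 0 < npdf x := gaussianPDFReal_pos 0 1 x one_ne_zero

lemma npdf_eq : npdf = fun x => (Real.sqrt (2 * Real.pi))⁻¹ * Real.exp (-x ^ 2 / 2) := by
  funext x
  simp [npdf, gaussianPDFReal]

lemma hasDerivAt_npdf (x : ℝ) : HasDerivAt npdf (-x * npdf x) x := by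
  rw [npdf_eq]
  have h : HasDerivAt (fun x : ℝ => -x ^ 2 / 2) (-x) x := by
    have := ((hasDerivAt_pow 2 x).neg).div_const 2
    exact this.congr_deriv (by simp; ring)
  exact ((h.exp).const_mul (Real.sqrt (2 * Real.pi))⁻¹).congr_deriv (by ring)

lemma continuous_npdf : Continuous npdf :=
  continuous_iff_continuousAt.2 fun x => (hasDerivAt_npdf x).continuousAt

lemma npdf_neg (x : ℝ) : npdf (-x) = npdf x := by simp [npdf_eq]

lemma ncdf_eq_integral (x : ℝ) : ncdf x = ∫ t in Iic x, npdf t := by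
  rw [ncdf, cdf_eq_real, measureReal_def, gaussianReal_apply_eq_integral 0 one_ne_zero,
    ENNReal.toReal_ofReal]
  · rfl
  · exact setIntegral_nonneg measurableSet_Iic fun t _ => (npdf_pos t).le

lemma hasDerivAt_ncdf (x : ℝ) : HasDerivAt ncdf (npdf x) x := by
  have hi : Integrable npdf := integrable_gaussianPDFReal 0 1
  have h : ncdf = fun y => ncdf 0 + ∫ t in (0 : ℝ)..y, npdf t := by
    funext y
    rw [ncdf_eq_integral, ncdf_eq_integral,
      ← intervalIntegral.integral_Iic_sub_Iic hi.integrableOn hi.integrableOn]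
    ring
  rw [h]
  exact (intervalIntegral.integral_hasDerivAt_right (hi.intervalIntegrable)
    (continuous_npdf.stronglyMeasurableAtFilter _ _) continuous_npdf.continuousAt).const_add _

lemma ncdf_nonneg (x : ℝ) : 0 ≤ ncdf x := cdf_nonneg _ x
lemma ncdf_le_one (x : ℝ) : ncdf x ≤ 1 := cdf_le_one _ x

/-- The density is even, so `ncdf y + ncdf (-y)` has derivative zero; its limit at infinity
identifies the constant. -/
lemma ncdf_neg (x : ℝ) : ncdf (-x) = 1 - ncdf x := by
  have hc : ∀ y, ncdf y + ncdf (-y) = ncdf 0 + ncdf (-0) := by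
    intro y
    refine is_const_of_deriv_eq_zero (f := fun y => ncdf y + ncdf (-y)) ?_ ?_ y 0
    · intro y
      exact ((hasDerivAt_ncdf y).add ((hasDerivAt_ncdf (-y)).comp y
        (hasDerivAt_neg y))).differentiableAt
    · intro y
      have := ((hasDerivAt_ncdf y).add ((hasDerivAt_ncdf (-y)).comp y
        (hasDerivAt_neg y))).deriv
      refine Eq.trans this ?_
      rw [npdf_neg]; ring
  have h1 : Tendsto (fun y => ncdf y + ncdf (-y)) atTop (𝓝 (1 + 0)) :=
    (tendsto_cdf_atTop _).add ((tendsto_cdf_atBot _).comp tendsto_neg_atTop_atBot)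
  have h2 : Tendsto (fun y => ncdf y + ncdf (-y)) atTop (𝓝 (ncdf 0 + ncdf (-0))) := by
    simp only [hc]; exact tendsto_const_nhds
  have := tendsto_nhds_unique h1 h2
  linarith [hc x]

lemma tendsto_npdf_atBot : Tendsto npdf atBot (𝓝 0) := by
  rw [npdf_eq]
  have h : Tendsto (fun x : ℝ => -x ^ 2 / 2) atBot atBot := by
    have h1 : Tendsto (fun x : ℝ => x ^ 2) atBot atTop := by
      have := (tendsto_pow_atTop (α := ℝ) (two_ne_zero)).comp tendsto_neg_atBot_atTop
      refine this.congr fun x => by simp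
    have h2 : Tendsto (fun x : ℝ => (1 / 2 : ℝ) * x ^ 2) atBot atTop :=
      h1.const_mul_atTop (by norm_num)
    refine (tendsto_neg_atTop_atBot.comp h2).congr fun x => by simp; ring
  simpa using (Real.tendsto_exp_atBot.comp h).const_mul (Real.sqrt (2 * Real.pi))⁻¹

/-- Lower Mills bound. -/
lemma mills_lower (w : ℝ) : 0 ≤ (1 + w ^ 2) * ncdf w + w * npdf w := by
  -- `K` has the nonnegative derivative `2 * npdf w / (1 + w ^ 2) ^ 2` and limit 0 at `-∞`, so `K ≥
  -- 0`; the claim concerns `(1 + w ^ 2) * K w`.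
  set K : ℝ → ℝ := fun w => ncdf w + w * npdf w / (1 + w ^ 2) with hK
  have hpos : ∀ w : ℝ, 0 < 1 + w ^ 2 := fun w => by positivity
  have hd : ∀ w, HasDerivAt K (2 * npdf w / (1 + w ^ 2) ^ 2) w := by
    intro w
    have h1 : HasDerivAt (fun w : ℝ => 1 + w ^ 2) (2 * w) w := by
      simpa using (hasDerivAt_pow 2 w).const_add 1
    have := (hasDerivAt_ncdf w).add ((((hasDerivAt_id w).mul (hasDerivAt_npdf w)).div h1
      (hpos w).ne'))
    refine this.congr_deriv ?_
    have := (hpos w).ne'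
    simp only [id, Pi.mul_apply]
    field_simp
    ring
  have hm : Monotone K := monotone_of_hasDerivAt_nonneg hd fun w =>
    div_nonneg (mul_nonneg zero_le_two (npdf_pos w).le) (by positivity)
  have hl : Tendsto K atBot (𝓝 (0 + 0)) := by
    refine (tendsto_cdf_atBot _).add ?_
    refine squeeze_zero_norm (fun w => ?_) tendsto_npdf_atBot
    rw [Real.norm_eq_abs, abs_div, abs_mul, abs_of_pos (npdf_pos w), abs_of_pos (hpos w),
      div_le_iff₀ (hpos w)]
    have : |w| ≤ 1 + w ^ 2 := by nlinarith [abs_nonneg w, sq_abs w, sq_nonneg (|w| - 1)]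
    nlinarith [npdf_pos w]
  have h0 : 0 ≤ K w := by simpa using hm.le_of_tendsto hl w
  have : (1 + w ^ 2) * ncdf w + w * npdf w = (1 + w ^ 2) * K w := by
    have := (hpos w).ne'
    simp only [hK]; field_simp
  rw [this]; exact mul_nonneg (hpos w).le h0

/-- Upper Mills bound. -/
lemma mills_upper (w : ℝ) : 0 ≤ npdf w + w * ncdf w := by
  rcases le_or_gt 0 w with hw | hw
  · have := npdf_pos w; have := ncdf_nonneg w; positivity
  -- On the negative half-line `K` decreases from its limit 0 at `-∞`, so `K ≤ 0`; the claim
  -- concerns `w * K w` with `w < 0`.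
  set K : ℝ → ℝ := fun w => ncdf w + npdf w / w with hK
  have hd : ∀ w ∈ Iio (0 : ℝ), HasDerivAt K (-(npdf w / w ^ 2)) w := by
    intro w hw
    have hw0 : w ≠ 0 := (ne_of_lt hw)
    have := (hasDerivAt_ncdf w).add ((hasDerivAt_npdf w).div (hasDerivAt_id w) hw0)
    refine this.congr_deriv ?_
    simp only [id]
    field_simp
    ring
  have hm : AntitoneOn K (Iio 0) := by
    refine antitoneOn_of_deriv_nonpos (convex_Iio 0)
      (fun w hw => (hd w hw).continuousAt.continuousWithinAt)
      (fun w hw => (hd w (by simpa using hw)).differentiableAt.differentiableWithinAt)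
      fun w hw => ?_
    rw [(hd w (by simpa using hw)).deriv]
    have := npdf_pos w
    simp only [Left.neg_nonpos_iff]; positivity
  have hl : Tendsto K atBot (𝓝 (0 + 0)) := by
    refine (tendsto_cdf_atBot _).add ?_
    simpa [div_eq_mul_inv] using tendsto_npdf_atBot.mul tendsto_inv_atBot_zero
  have h0 : K w ≤ 0 := by
    rw [add_zero] at hl
    refine ge_of_tendsto hl ?_
    filter_upwards [eventually_le_atBot w] with y hy
    exact hm (lt_of_le_of_lt hy hw) hw hy
  have : npdf w + w * ncdf w = w * K w := by
    have := hw.ne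
    simp only [hK]; field_simp; ring
  rw [this]; exact mul_nonneg_of_nonpos_of_nonpos hw.le h0

/-- The quotient of the distribution function and the density. -/
noncomputable def mills (w : ℝ) : ℝ := ncdf w / npdf w

lemma mills_nonneg (w : ℝ) : 0 ≤ mills w := div_nonneg (ncdf_nonneg w) (npdf_pos w).le

lemma hasDerivAt_mills (w : ℝ) : HasDerivAt mills (1 + w * mills w) w := by
  have h0 := (npdf_pos w).ne'
  refine ((hasDerivAt_ncdf w).div (hasDerivAt_npdf w) h0).congr_deriv ?_
  simp only [mills]; field_simp; ring

/-- The derivative is the quantity of `mills_lower` divided by the density. This is what makes `w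
f_z(w)` increasing. -/
lemma monotone_mul_mills : Monotone fun w => w * mills w := by
  refine monotone_of_hasDerivAt_nonneg
    (fun w => (hasDerivAt_id w).mul (hasDerivAt_mills w)) fun w => ?_
  have h0 := npdf_pos w
  have : 1 * mills w + id w * (1 + w * mills w)
      = ((1 + w ^ 2) * ncdf w + w * npdf w) / npdf w := by
    simp only [mills, id]; field_simp; ring
  simp only [Pi.zero_apply]
  rw [this]
  exact div_nonneg (mills_lower w) h0.le

lemma monotone_mills : Monotone mills := by
  refine monotone_of_hasDerivAt_nonneg hasDerivAt_mills fun w => ?_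
  have h0 := npdf_pos w
  have : 1 + w * mills w = (npdf w + w * ncdf w) / npdf w := by
    simp only [mills]; field_simp
  simp only [Pi.zero_apply]
  rw [this]; exact div_nonneg (mills_upper w) h0.le

lemma neg_one_le_mul_mills (w : ℝ) : -1 ≤ w * mills w := by
  have h0 := npdf_pos w
  have : w * mills w + 1 = (npdf w + w * ncdf w) / npdf w := by
    simp only [mills]; field_simp; ring
  have := div_nonneg (mills_upper w) h0.le
  linarith

/-- At `z`, the two branches of the Stein solution agree. -/
lemma mills_mul_ncdf_neg (z : ℝ) : mills z * ncdf (-z) = mills (-z) * ncdf z := by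
  simp only [mills, npdf_neg]; ring

/-- The solution of the Stein equation for the indicator of `Iic z`. -/
noncomputable def steinSol (z w : ℝ) : ℝ :=
  if w ≤ z then mills w * ncdf (-z) else mills (-w) * ncdf z

/-- `w f_z(w)`. -/
noncomputable def steinMul (z w : ℝ) : ℝ := w * steinSol z w

/-- The indicator of `Iic z`. -/
noncomputable def indLE (z w : ℝ) : ℝ := if w ≤ z then 1 else 0

lemma indLE_antitone (z : ℝ) : Antitone (indLE z) := by
  intro a b hab
  unfold indLE
  split_ifs <;> linarith

lemma indLE_abs_le (z w : ℝ) : |indLE z w| ≤ 1 := by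
  unfold indLE; split_ifs <;> simp

lemma measurable_indLE (z : ℝ) : Measurable (indLE z) := (indLE_antitone z).measurable

lemma steinSol_of_ge {z w : ℝ} (h : z ≤ w) : steinSol z w = mills (-w) * ncdf z := by
  unfold steinSol
  split_ifs with h1
  · obtain rfl : w = z := le_antisymm h1 h
    exact mills_mul_ncdf_neg w
  · rfl

lemma steinMul_mono (z : ℝ) : Monotone (steinMul z) := by
  have hL : ∀ a b, a ≤ b → b ≤ z → steinMul z a ≤ steinMul z b := by
    intro a b hab hb
    simp only [steinMul, steinSol, if_pos hb, if_pos (hab.trans hb), ← mul_assoc]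
    exact mul_le_mul_of_nonneg_right (monotone_mul_mills hab) (ncdf_nonneg _)
  have hR : ∀ a b, a ≤ b → z ≤ a → steinMul z a ≤ steinMul z b := by
    intro a b hab ha
    simp only [steinMul, steinSol_of_ge ha, steinSol_of_ge (ha.trans hab), ← mul_assoc]
    refine mul_le_mul_of_nonneg_right ?_ (ncdf_nonneg _)
    have := monotone_mul_mills (neg_le_neg hab)
    simp only at this
    linarith
  intro a b hab
  rcases le_total b z with hb | hb
  · exact hL a b hab hb
  rcases le_total z a with ha | ha
  · exact hR a b hab ha
  · exact (hL a z ha le_rfl).trans (hR z b hb le_rfl)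

/-- On either side of `z`, one bound follows from the value at `z` by monotonicity and the other
from `neg_one_le_mul_mills`. At `z` both branches agree, so the upper bound can use the right branch
and the lower bound the left one. -/
lemma steinMul_abs_le (z w : ℝ) : |steinMul z w| ≤ 1 := by
  have hz1 : steinMul z z ≤ 1 := by
    rw [steinMul, steinSol_of_ge le_rfl, ← mul_assoc]
    have h1 := neg_one_le_mul_mills (-z)
    nlinarith [ncdf_nonneg z, ncdf_le_one z]
  have hz2 : -1 ≤ steinMul z z := by
    simp only [steinMul, steinSol, le_refl, if_true, ← mul_assoc]
    have h1 := neg_one_le_mul_mills z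
    nlinarith [ncdf_nonneg (-z), ncdf_le_one (-z)]
  rw [abs_le]
  rcases le_total w z with h | h
  · refine ⟨?_, (steinMul_mono z h).trans hz1⟩
    simp only [steinMul, steinSol, if_pos h, ← mul_assoc]
    have h1 := neg_one_le_mul_mills w
    nlinarith [ncdf_nonneg (-z), ncdf_le_one (-z)]
  · refine ⟨hz2.trans (steinMul_mono z h), ?_⟩
    rw [steinMul, steinSol_of_ge h, ← mul_assoc]
    have h1 := neg_one_le_mul_mills (-w)
    nlinarith [ncdf_nonneg z, ncdf_le_one z]

lemma measurable_mills : Measurable mills := monotone_mills.measurable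

lemma measurable_steinSol (z : ℝ) : Measurable (steinSol z) :=
  Measurable.ite measurableSet_Iic (measurable_mills.mul_const _)
    ((measurable_mills.comp measurable_neg).mul_const _)

lemma measurable_steinMul (z : ℝ) : Measurable (steinMul z) := (steinMul_mono z).measurable

lemma steinSol_nonneg (z w : ℝ) : 0 ≤ steinSol z w := by
  unfold steinSol
  split_ifs
  · exact mul_nonneg (mills_nonneg _) (ncdf_nonneg _)
  · exact mul_nonneg (mills_nonneg _) (ncdf_nonneg _)

/-- The bound depends on `z`; it only serves integrability and does not enter the rate. -/
lemma steinSol_abs_le (z w : ℝ) : |steinSol z w| ≤ mills z + mills (-z) := by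
  rw [abs_of_nonneg (steinSol_nonneg z w)]
  have h1 := mills_nonneg z
  have h2 := mills_nonneg (-z)
  unfold steinSol
  split_ifs with h
  · have := monotone_mills h
    nlinarith [ncdf_le_one (-z), ncdf_nonneg (-z), mills_nonneg w]
  · have : mills (-w) ≤ mills (-z) := monotone_mills (by linarith)
    nlinarith [ncdf_le_one z, ncdf_nonneg z, mills_nonneg (-w)]

/-- Off `z` the derivative is `steinMul z + indLE z - ncdf z`, an increasing plus a decreasing
function. The mean value theorem on each side of `z`, with each part taken at its extremal endpoint,
gives both bounds. -/
lemma steinSol_slope {z a b : ℝ} (hab : b ≤ a) :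
    (a - b) * (steinMul z b + indLE z a - ncdf z) ≤ steinSol z a - steinSol z b ∧
      steinSol z a - steinSol z b ≤ (a - b) * (steinMul z a + indLE z b - ncdf z) := by
  have hL : ∀ a b, b ≤ a → a ≤ z → 
      (a - b) * (steinMul z b + 1 - ncdf z) ≤ steinSol z a - steinSol z b ∧
      steinSol z a - steinSol z b ≤ (a - b) * (steinMul z a + 1 - ncdf z) := by
    intro a b hab ha
    rcases hab.eq_or_lt with rfl | hlt
    · simp
    obtain ⟨c, hc, hs⟩ := exists_hasDerivAt_eq_slope (fun w => mills w * ncdf (-z))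
      (fun w => (1 + w * mills w) * ncdf (-z)) hlt
      (fun w _ => ((hasDerivAt_mills w).mul_const _).continuousAt.continuousWithinAt)
      (fun w _ => (hasDerivAt_mills w).mul_const _)
    rw [eq_div_iff (by linarith)] at hs
    have e1 : steinSol z a - steinSol z b = (a - b) * (steinMul z c + 1 - ncdf z) := by
      simp only [steinMul, steinSol, if_pos ha, if_pos (hab.trans ha),
        if_pos (hc.2.le.trans ha)]
      rw [← hs, ncdf_neg]; ring
    rw [e1]
    have m1 := steinMul_mono z hc.1.le
    have m2 := steinMul_mono z hc.2.le
    constructor <;> refine mul_le_mul_of_nonneg_left ?_ (by linarith) <;> linarith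
  have hR : ∀ a b, b ≤ a → z ≤ b → 
      (a - b) * (steinMul z b - ncdf z) ≤ steinSol z a - steinSol z b ∧
      steinSol z a - steinSol z b ≤ (a - b) * (steinMul z a - ncdf z) := by
    intro a b hab hb
    rcases hab.eq_or_lt with rfl | hlt
    · simp
    have hd : ∀ w, HasDerivAt (fun w => mills (-w) * ncdf z)
        ((1 + -w * mills (-w)) * (-1) * ncdf z) w := fun w =>
      ((hasDerivAt_mills (-w)).comp w (hasDerivAt_neg w)).mul_const _
    obtain ⟨c, hc, hs⟩ := exists_hasDerivAt_eq_slope _ _ hlt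
      (fun w _ => (hd w).continuousAt.continuousWithinAt)
      (fun w _ => hd w)
    rw [eq_div_iff (by linarith)] at hs
    have e1 : steinSol z a - steinSol z b = (a - b) * (steinMul z c - ncdf z) := by
      simp only [steinMul, steinSol_of_ge hb, steinSol_of_ge (hb.trans hab),
        steinSol_of_ge (hb.trans hc.1.le)]
      rw [← hs]; ring
    rw [e1]
    have m1 := steinMul_mono z hc.1.le
    have m2 := steinMul_mono z hc.2.le
    constructor <;> refine mul_le_mul_of_nonneg_left ?_ (by linarith) <;> linarith
  rcases le_or_gt a z with ha | ha
  · have := hL a b hab ha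
    simpa only [indLE, if_pos ha, if_pos (hab.trans ha)] using this
  rcases le_or_gt b z with hb | hb
  -- Here `z` separates `b` from `a`; the increments over the two pieces are added.
  · obtain ⟨l1, u1⟩ := hL z b hb le_rfl
    obtain ⟨l2, u2⟩ := hR a z ha.le le_rfl
    simp only [indLE, if_neg (not_le.2 ha), if_pos hb]
    have m1 := steinMul_mono z hb
    have m2 := steinMul_mono z ha.le
    constructor <;> nlinarith
  · have := hR a b hab hb.le
    simpa only [indLE, if_neg (not_le.2 ha), if_neg (not_le.2 hb), add_zero] using this

/-- The Taylor remainder of the Stein solution is controlled by monotone functions. -/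
lemma steinSol_remainder (z a b : ℝ) :
    |steinSol z a - steinSol z b - (steinMul z a + indLE z a - ncdf z) * (a - b)| ≤
      (a - b) * (steinMul z a - steinMul z b) + (a - b) * (indLE z b - indLE z a) := by
  rw [abs_le]
  rcases le_total b a with h | h
  · obtain ⟨l, u⟩ := steinSol_slope (z := z) h
    have m1 := mul_nonneg (sub_nonneg.2 h) (sub_nonneg.2 (steinMul_mono z h))
    have m2 := mul_nonneg (sub_nonneg.2 h) (sub_nonneg.2 (indLE_antitone z h))
    constructor <;> nlinarith
  · obtain ⟨l, u⟩ := steinSol_slope (z := z) h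
    have m1 := mul_nonneg (sub_nonneg.2 h) (sub_nonneg.2 (steinMul_mono z h))
    have m2 := mul_nonneg (sub_nonneg.2 h) (sub_nonneg.2 (indLE_antitone z h))
    constructor <;> nlinarith

/-! ### A Berry–Esseen bound for families of exchangeable pairs -/

section BerryEsseen

variable {Ω ι : Type*} [MeasurableSpace Ω] {P : Measure Ω} [IsProbabilityMeasure P] [Fintype ι]

lemma memLp_comp_of_bounded {φ : ℝ → ℝ} (hφ : Measurable φ) {C : ℝ} (hC : ∀ x, |φ x| ≤ C)
    {W : Ω → ℝ} (hW : Measurable W) (p : ENNReal) : MemLp (fun x => φ (W x)) p P :=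
  MemLp.of_bound (hφ.comp hW).aestronglyMeasurable C (Filter.Eventually.of_forall fun _ => hC _)

lemma integral_abs_le_of_sq_le {X : Ω → ℝ} (hX : AEStronglyMeasurable X P)
    (hX2 : Integrable (fun x => X x ^ 2) P) {a : ℝ} (ha : 0 < a)
    (h : ∫ x, X x ^ 2 ∂P ≤ a ^ 2) : ∫ x, |X x| ∂P ≤ a := by
  have hX1 : Integrable X P := ((memLp_two_iff_integrable_sq hX).2 hX2).integrable one_le_two
  have h1 : ∫ x, 2 * a * |X x| ∂P ≤ ∫ x, (X x ^ 2 + a ^ 2) ∂P := by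
    refine integral_mono (hX1.abs.const_mul _) (hX2.add (integrable_const _)) fun x => ?_
    simp only
    nlinarith [sq_nonneg (|X x| - a), sq_abs (X x)]
  rw [integral_const_mul, integral_add hX2 (integrable_const _)] at h1
  simp at h1
  nlinarith

/-- By antisymmetry `E f(W) F_e` is half of `E (f(W) - f(W_e)) F_e`. Replacing the increment by
`G(W) (W - W_e)`, where `G` is the derivative of the Stein solution, gives the first error. The
remainder is at most `(W - W_e) (H(W) - H(W_e))` with `H` increasing and bounded by 2, and gives the
second error. -/
theorem berry_esseen_of_exchangeable {W : Ω → ℝ} {F : ι → Ω → ℝ} {θ : ι → Ω → Ω}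
    (hWm : Measurable W) (hW : MemLp W 2 P) (hF : ∀ e, MemLp (F e) 2 P)
    (hθ : ∀ e, MeasurePreserving (θ e) P P) (hinv : ∀ e x, W (θ e (θ e x)) = W x)
    (hanti : ∀ e x, F e (θ e x) = -F e x)
    (hlin : ∀ φ : ℝ → ℝ, Measurable φ → MemLp (fun x => φ (W x)) 2 P →
      ∫ x, φ (W x) * W x ∂P = ∑ e, ∫ x, φ (W x) * F e x ∂P) (z : ℝ) :
    |P.real {x | W x ≤ z} - ncdf z| ≤
      2 * ∫ x, |1 - (1 / 2) * ∑ e, F e x * (W x - W (θ e x))| ∂P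
      + 2 * ∫ x, |∑ e, |F e x| * (W x - W (θ e x))| ∂P := by
  set f := steinSol z with hf
  set H : ℝ → ℝ := fun w => steinMul z w - indLE z w with hH
  set G : ℝ → ℝ := fun w => steinMul z w + indLE z w - ncdf z with hG
  have hfm : Measurable f := measurable_steinSol z
  have hHm : Measurable H := (measurable_steinMul z).sub (measurable_indLE z)
  have hGm : Measurable G := ((measurable_steinMul z).add (measurable_indLE z)).sub_const _
  have hHb : ∀ w, |H w| ≤ 2 := fun w => by
    have h1 := abs_le.1 (steinMul_abs_le z w); have h2 := abs_le.1 (indLE_abs_le z w)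
    exact abs_le.2 ⟨by simp only [hH]; linarith, by simp only [hH]; linarith⟩
  have hGb : ∀ w, |G w| ≤ 2 := fun w => by
    have h1 := abs_le.1 (steinMul_abs_le z w)
    have h3 := ncdf_nonneg z; have h4 := ncdf_le_one z
    have h2 : 0 ≤ indLE z w ∧ indLE z w ≤ 1 := by unfold indLE; split_ifs <;> simp
    exact abs_le.2 ⟨by simp only [hG]; linarith, by simp only [hG]; linarith⟩
  have hW' : ∀ e, MemLp (fun x => W (θ e x)) 2 P := fun e => hW.comp_measurePreserving (hθ e)
  have hWm' : ∀ e, Measurable (fun x => W (θ e x)) := fun e => hWm.comp (hθ e).measurable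
  have hD : ∀ e, MemLp (fun x => W x - W (θ e x)) 2 P := fun e => hW.sub (hW' e)
  have hFD : ∀ e, Integrable (fun x => F e x * (W x - W (θ e x))) P :=
    fun e => (hF e).integrable_mul (hD e)
  have hFD' : ∀ e, Integrable (fun x => |F e x| * (W x - W (θ e x))) P :=
    fun e => (hF e).abs.integrable_mul (hD e)
  have bdd : ∀ {φ : ℝ → ℝ} {C : ℝ} {W' Y : Ω → ℝ}, Measurable φ → (∀ w, |φ w| ≤ C) →
      Measurable W' → Integrable Y P → Integrable (fun x => φ (W' x) * Y x) P := by
    intro φ C W' Y h1 h2 h3 h4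
    exact h4.bdd_mul (c := C) (h1.comp h3).aestronglyMeasurable
      (Filter.Eventually.of_forall fun x => h2 _)
  have swapInt : ∀ e (Y : Ω → ℝ), ∫ x, Y (θ e x) ∂P = ∫ x, Y x ∂P ∨ ¬ AEStronglyMeasurable Y P := by
    intro e Y
    by_cases hY : AEStronglyMeasurable Y P
    · left
      have := integral_map (hθ e).measurable.aemeasurable (f := Y)
        (by rw [(hθ e).map_eq]; exact hY)
      rw [(hθ e).map_eq] at this
      exact this.symm
    · exact Or.inr hY
  have swap : ∀ e (Y : Ω → ℝ), Integrable Y P → ∫ x, Y (θ e x) ∂P = ∫ x, Y x ∂P :=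
    fun e Y hY => (swapInt e Y).resolve_right (not_not.2 hY.aestronglyMeasurable)
  have hFi : ∀ e, Integrable (F e) P := fun e => (hF e).integrable one_le_two
  -- the first-order identity
  have e1 : ∀ e, ∫ x, f (W x) * F e x ∂P
      = (1 / 2) * ∫ x, (f (W x) - f (W (θ e x))) * F e x ∂P := by
    intro e
    have i1 := bdd hfm (steinSol_abs_le z) hWm (hFi e)
    have i2 := bdd hfm (steinSol_abs_le z) (hWm' e) (hFi e)
    have h1 : ∫ x, f (W (θ e x)) * F e x ∂P = - ∫ x, f (W x) * F e x ∂P := by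
      rw [← swap e _ i2, ← integral_neg]
      congr 1; funext x
      rw [hinv, hanti]; ring
    simp only [sub_mul]
    rw [integral_sub i1 i2, h1]; ring
  -- The factor `|F e| * (W - W ∘ θ e)` changes sign under `θ e`, so both terms of the difference
  -- contribute equally.
  have e2 : ∀ e, ∫ x, |F e x| * (W x - W (θ e x)) * (H (W x) - H (W (θ e x))) ∂P
      = 2 * ∫ x, H (W x) * (|F e x| * (W x - W (θ e x))) ∂P := by
    intro e
    have i1 := bdd hHm hHb hWm (hFD' e)
    have i2 := bdd hHm hHb (hWm' e) (hFD' e)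
    have h1 : ∫ x, H (W (θ e x)) * (|F e x| * (W x - W (θ e x))) ∂P
        = - ∫ x, H (W x) * (|F e x| * (W x - W (θ e x))) ∂P := by
      rw [← swap e _ i2, ← integral_neg]
      congr 1; funext x
      rw [hinv, hanti, abs_neg]; ring
    have : ∀ x, |F e x| * (W x - W (θ e x)) * (H (W x) - H (W (θ e x)))
        = H (W x) * (|F e x| * (W x - W (θ e x)))
          - H (W (θ e x)) * (|F e x| * (W x - W (θ e x))) := fun x => by ring
    simp only [this]
    rw [integral_sub i1 i2, h1]; ring
  have iR : ∀ e, Integrable (fun x => F e x * (f (W x) - f (W (θ e x))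
      - G (W x) * (W x - W (θ e x)))) P := by
    intro e
    have i1 := bdd hfm (steinSol_abs_le z) hWm (hFi e)
    have i2 := bdd hfm (steinSol_abs_le z) (hWm' e) (hFi e)
    have i3 := bdd hGm hGb hWm (hFD e)
    refine ((i1.sub i2).sub i3).congr (Filter.Eventually.of_forall fun x => ?_)
    simp only [Pi.sub_apply]; ring
  have iS : Integrable (fun x => ∑ e, F e x * (W x - W (θ e x))) P :=
    integrable_finsetSum _ fun e _ => hFD e
  have iS' : Integrable (fun x => ∑ e, |F e x| * (W x - W (θ e x))) P :=
    integrable_finsetSum _ fun e _ => hFD' e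
  have iT : Integrable (fun x => 1 - (1 / 2) * ∑ e, F e x * (W x - W (θ e x))) P :=
    (integrable_const _).sub (iS.const_mul _)
  have iGT := bdd hGm hGb hWm iT
  have hmul := memLp_comp_of_bounded (P := P) hfm (steinSol_abs_le z) hWm 2
  have iM : Integrable (fun x => steinMul z (W x)) P :=
    (memLp_comp_of_bounded (P := P) (measurable_steinMul z) (steinMul_abs_le z) hWm 1).integrable
      le_rfl
  have iG : Integrable (fun x => G (W x)) P :=
    (memLp_comp_of_bounded (P := P) hGm hGb hWm 1).integrable le_rfl
  have main : P.real {x | W x ≤ z} - ncdf z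
      = ∫ x, G (W x) * (1 - (1 / 2) * ∑ e, F e x * (W x - W (θ e x))) ∂P
        - (1 / 2) * ∑ e, ∫ x, F e x * (f (W x) - f (W (θ e x))
          - G (W x) * (W x - W (θ e x))) ∂P := by
    have h1 : P.real {x | W x ≤ z} = ∫ x, indLE z (W x) ∂P := by
      have hs : MeasurableSet {x | W x ≤ z} := measurableSet_le hWm measurable_const
      rw [← integral_indicator_one hs]
      congr 1
    have iI : Integrable (fun x => indLE z (W x)) P :=
      (memLp_comp_of_bounded (P := P) (measurable_indLE z) (indLE_abs_le z) hWm 1).integrable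
        le_rfl
    have h2 : P.real {x | W x ≤ z} - ncdf z
        = ∫ x, G (W x) ∂P - ∫ x, f (W x) * W x ∂P := by
      have h3 : ∫ x, f (W x) * W x ∂P = ∫ x, steinMul z (W x) ∂P := by
        congr 1; funext x; simp only [steinMul]; ring
      rw [h3, ← integral_sub iG iM, h1]
      have : ∀ x, G (W x) - steinMul z (W x) = indLE z (W x) - ncdf z := fun x => by
        simp only [hG]; ring
      simp only [this]
      rw [integral_sub iI (integrable_const _)]
      simp
    rw [h2, hlin f hfm hmul]
    simp only [e1, ← Finset.mul_sum]
    have h4 : ∀ e, ∫ x, F e x * (f (W x) - f (W (θ e x)) - G (W x) * (W x - W (θ e x))) ∂P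
        = ∫ x, (f (W x) - f (W (θ e x))) * F e x ∂P
          - ∫ x, G (W x) * (F e x * (W x - W (θ e x))) ∂P := by
      intro e
      have i1 := bdd hfm (steinSol_abs_le z) hWm (hFi e)
      have i2 := bdd hfm (steinSol_abs_le z) (hWm' e) (hFi e)
      have i3 := bdd hGm hGb hWm (hFD e)
      rw [← integral_sub _ i3]
      · congr 1; funext x; ring
      · refine (i1.sub i2).congr (Filter.Eventually.of_forall fun x => ?_)
        simp only [Pi.sub_apply]; ring
    have h5 : ∫ x, G (W x) * (1 - (1 / 2) * ∑ e, F e x * (W x - W (θ e x))) ∂P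
        = ∫ x, G (W x) ∂P
          - (1 / 2) * ∑ e, ∫ x, G (W x) * (F e x * (W x - W (θ e x))) ∂P := by
      rw [← integral_finsetSum _ fun e _ => bdd hGm hGb hWm (hFD e), ← integral_const_mul,
        ← integral_sub iG ((integrable_finsetSum _
          fun e _ => bdd hGm hGb hWm (hFD e)).const_mul _)]
      congr 1; funext x
      rw [← Finset.mul_sum]; ring
    rw [h5]
    simp only [h4, Finset.sum_sub_distrib]
    ring
  rw [main]
  refine (abs_sub _ _).trans (add_le_add ?_ ?_)
  · refine (abs_integral_le_integral_abs).trans ?_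
    rw [← integral_const_mul]
    refine integral_mono iGT.abs (iT.abs.const_mul _) fun x => ?_
    simp only [abs_mul]
    exact mul_le_mul_of_nonneg_right (hGb _) (abs_nonneg _)
  · have h6 : |∑ e, ∫ x, F e x * (f (W x) - f (W (θ e x)) - G (W x) * (W x - W (θ e x))) ∂P|
        ≤ ∑ e, 2 * ∫ x, H (W x) * (|F e x| * (W x - W (θ e x))) ∂P := by
      refine (Finset.abs_sum_le_sum_abs _ _).trans (Finset.sum_le_sum fun e _ => ?_)
      rw [← e2]
      refine (abs_integral_le_integral_abs).trans (integral_mono (iR e).abs ?_ fun x => ?_)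
      · have i1 := bdd hHm hHb hWm (hFD' e)
        have i2 := bdd hHm hHb (hWm' e) (hFD' e)
        refine (i1.sub i2).congr (Filter.Eventually.of_forall fun x => ?_)
        simp only [Pi.sub_apply]; ring
      · simp only [abs_mul, mul_assoc]
        refine mul_le_mul_of_nonneg_left ((steinSol_remainder z _ _).trans (le_of_eq ?_))
          (abs_nonneg _)
        simp only [hH]; ring
    -- `H (W x)` does not depend on `e`, so the sum over `e` can be formed before absolute values
    -- are taken.
    have h7 : ∑ e, 2 * ∫ x, H (W x) * (|F e x| * (W x - W (θ e x))) ∂P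
        ≤ 4 * ∫ x, |∑ e, |F e x| * (W x - W (θ e x))| ∂P := by
      rw [← Finset.mul_sum, ← integral_finsetSum _ fun e _ => bdd hHm hHb hWm (hFD' e)]
      have : ∫ x, ∑ e, H (W x) * (|F e x| * (W x - W (θ e x))) ∂P
          ≤ ∫ x, 2 * |∑ e, |F e x| * (W x - W (θ e x))| ∂P := by
        refine integral_mono (integrable_finsetSum _ fun e _ => bdd hHm hHb hWm (hFD' e))
          (iS'.abs.const_mul _) fun x => ?_
        simp only
        rw [← Finset.mul_sum]
        refine (le_abs_self _).trans ?_
        rw [abs_mul]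
        exact mul_le_mul_of_nonneg_right (hHb _) (abs_nonneg _)
      rw [integral_const_mul] at this
      linarith
    rw [abs_mul, abs_of_pos (by norm_num : (0 : ℝ) < 1 / 2)]
    linarith

end BerryEsseen

/-! ### Functions on finite product spaces -/

lemma integral_comp_of_measurePreserving {α β : Type*} [MeasurableSpace α] [MeasurableSpace β]
    {μa : Measure α} {μb : Measure β} {r : α → β} (hr : MeasurePreserving r μa μb) {φ : β → ℝ}
    (hφ : AEStronglyMeasurable φ μb) : ∫ x, φ (r x) ∂μa = ∫ y, φ y ∂μb := by
  have h := integral_map hr.measurable.aemeasurable (f := φ) (by rw [hr.map_eq]; exact hφ)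
  rw [hr.map_eq] at h
  exact h.symm

section Product

variable {ι 𝒲 : Type*} [Fintype ι] [DecidableEq ι] [MeasurableSpace 𝒲]
  {m : Measure 𝒲} [IsProbabilityMeasure m]

/-- Mixing the coordinates of two independent copies reproduces the product law. This carries both
the factorization over disjoint sets of coordinates and the analysis of conditional means. -/
lemma measurePreserving_piecewise (B : Finset ι) :
    MeasurePreserving (fun p : (ι → 𝒲) × (ι → 𝒲) => B.piecewise p.1 p.2)
      ((Measure.pi fun _ => m).prod (Measure.pi fun _ => m)) (Measure.pi fun _ => m) := by
  have hm : Measurable (fun p : (ι → 𝒲) × (ι → 𝒲) => B.piecewise p.1 p.2) := by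
    refine measurable_pi_lambda _ fun i => ?_
    by_cases h : i ∈ B
    · simp only [Finset.piecewise_eq_of_mem _ _ _ h]; fun_prop
    · simp only [Finset.piecewise_eq_of_notMem _ _ _ h]; fun_prop
  refine ⟨hm, ?_⟩
  symm
  refine Measure.pi_eq fun s hs => ?_
  rw [Measure.map_apply hm (MeasurableSet.univ_pi hs)]
  have : (fun p : (ι → 𝒲) × (ι → 𝒲) => B.piecewise p.1 p.2) ⁻¹' (Set.univ.pi s)
      = (Set.univ.pi fun i => if i ∈ B then s i else Set.univ) ×ˢ
        (Set.univ.pi fun i => if i ∈ B then Set.univ else s i) := by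
    ext p
    simp only [Set.mem_preimage, Set.mem_pi, Set.mem_univ, true_imp_iff, Set.mem_prod,
      ← forall_and]
    refine forall_congr' fun i => ?_
    by_cases h : i ∈ B <;> simp [h]
  rw [this, Measure.prod_prod, Measure.pi_pi, Measure.pi_pi, ← Finset.prod_mul_distrib]
  refine Finset.prod_congr rfl fun i _ => ?_
  by_cases h : i ∈ B <;> simp [h]

lemma measurePreserving_update (b : ι) :
    MeasurePreserving (fun p : (ι → 𝒲) × 𝒲 => Function.update p.1 b p.2)
      ((Measure.pi fun _ => m).prod m) (Measure.pi fun _ => m) := by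
  have hm : Measurable (fun p : (ι → 𝒲) × 𝒲 => Function.update p.1 b p.2) := by
    refine measurable_pi_lambda _ fun i => ?_
    by_cases h : i = b
    · subst h; simp only [Function.update_self]; fun_prop
    · simp only [Function.update_of_ne h]; fun_prop
  refine ⟨hm, ?_⟩
  symm
  refine Measure.pi_eq fun s hs => ?_
  rw [Measure.map_apply hm (MeasurableSet.univ_pi hs)]
  have : (fun p : (ι → 𝒲) × 𝒲 => Function.update p.1 b p.2) ⁻¹' (Set.univ.pi s)
      = (Set.univ.pi fun i => if i = b then Set.univ else s i) ×ˢ s b := by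
    ext p
    simp only [Set.mem_preimage, Set.mem_pi, Set.mem_univ, true_imp_iff, Set.mem_prod]
    constructor
    · intro h
      refine ⟨fun i => ?_, by simpa using h b⟩
      by_cases hi : i = b
      · simp [hi]
      · simpa [hi] using h i
    · rintro ⟨h1, h2⟩ i
      by_cases hi : i = b
      · subst hi; simpa using h2
      · simpa [hi] using h1 i
  rw [this, Measure.prod_prod, Measure.pi_pi, ← Finset.prod_erase_mul _ _ (Finset.mem_univ b),
    ← Finset.prod_erase_mul (a := b) _ (fun i => m (s i)) (Finset.mem_univ b)]
  simp only [if_true, measure_univ, mul_one]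
  congr 1
  refine Finset.prod_congr rfl fun i hi => ?_
  simp [Finset.ne_of_mem_erase hi]

lemma measurePreserving_comp_injective {κ : Type*} [Fintype κ] {r : κ → ι}
    (hr : Function.Injective r) :
    MeasurePreserving (fun (y : ι → 𝒲) (j : κ) => y (r j))
      (Measure.pi fun _ => m) (Measure.pi fun _ => m) := by
  have hm : Measurable (fun (y : ι → 𝒲) (j : κ) => y (r j)) := by fun_prop
  refine ⟨hm, ?_⟩
  have h1 : iIndepFun (fun i (y : ι → 𝒲) => y i) (Measure.pi fun _ => m) :=
    iIndepFun_pi (X := fun _ => id) fun _ => aemeasurable_id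
  have h2 := (h1.precomp hr).map_fun_eq_pi_map fun j => (measurable_pi_apply _).aemeasurable
  rw [h2]
  congr 1; funext j
  exact (measurePreserving_eval (fun _ => m) (r j)).map_eq

/-- `φ` has mean zero when the coordinate `b` is integrated out. -/
def Centered (m : Measure 𝒲) (φ : (ι → 𝒲) → ℝ) (b : ι) : Prop :=
  ∀ᵐ y ∂(Measure.pi fun _ => m), ∫ t, φ (Function.update y b t) ∂m = 0

lemma integral_update {φ : (ι → 𝒲) → ℝ} (hφ : Integrable φ (Measure.pi fun _ => m)) (b : ι) :
    ∫ y, φ y ∂(Measure.pi fun _ => m)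
      = ∫ y, ∫ t, φ (Function.update y b t) ∂m ∂(Measure.pi fun _ => m) := by
  have hp := measurePreserving_update (m := m) b
  have h1 : Integrable (fun p : (ι → 𝒲) × 𝒲 => φ (Function.update p.1 b p.2))
      ((Measure.pi fun _ => m).prod m) := hp.integrable_comp_of_integrable hφ
  rw [← integral_prod _ h1]
  exact (integral_comp_of_measurePreserving hp hφ.aestronglyMeasurable).symm

lemma update_eq_of_dependsOn {ψ : (ι → 𝒲) → ℝ} {S : Set ι} (h : DependsOn ψ S) {b : ι}
    (hb : b ∉ S) (y : ι → 𝒲) (t : 𝒲) : ψ (Function.update y b t) = ψ y :=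
  h fun i hi => Function.update_of_ne (by rintro rfl; exact hb hi) _ _

/-- Integrate the coordinate `b` first: `ψ` is constant in it and `φ` averages to zero. This is the
orthogonality behind the vanishing moments of uncovered products. -/
lemma Centered.integral_mul_eq_zero {φ ψ : (ι → 𝒲) → ℝ} {b : ι} (hφ : Centered m φ b)
    {S : Set ι} (hψ : DependsOn ψ S) (hb : b ∉ S)
    (hi : Integrable (fun y => φ y * ψ y) (Measure.pi fun _ => m)) :
    ∫ y, φ y * ψ y ∂(Measure.pi fun _ => m) = 0 := by
  rw [integral_update hi b]
  have : (fun y => ∫ t, φ (Function.update y b t) * ψ (Function.update y b t) ∂m)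
      =ᵐ[Measure.pi fun _ => m] 0 := by
    filter_upwards [hφ] with y hy
    simp only [update_eq_of_dependsOn hψ hb, integral_mul_const, hy, zero_mul, Pi.zero_apply]
  rw [integral_congr_ae this]
  simp

lemma integral_mul_of_dependsOn {φ ψ : (ι → 𝒲) → ℝ} {A B : Finset ι} (hφm : Measurable φ)
    (hψm : Measurable ψ) (hφ : DependsOn φ (A : Set ι)) (hψ : DependsOn ψ (B : Set ι))
    (hAB : Disjoint A B) :
    ∫ y, φ y * ψ y ∂(Measure.pi fun _ => m)
      = (∫ y, φ y ∂(Measure.pi fun _ => m)) * ∫ y, ψ y ∂(Measure.pi fun _ => m) := by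
  have hp := measurePreserving_piecewise (m := m) A
  rw [← integral_comp_of_measurePreserving hp (φ := fun y => φ y * ψ y)
    (hφm.mul hψm).aestronglyMeasurable, ← integral_prod_mul]
  congr 1; funext p
  congr 1
  · exact hφ fun i hi => Finset.piecewise_eq_of_mem _ _ _ hi
  · exact hψ fun i hi => Finset.piecewise_eq_of_notMem _ _ _
      fun h => Finset.disjoint_left.1 hAB h hi

lemma Centered.sub {φ ψ : (ι → 𝒲) → ℝ} {b : ι} (hφ : Centered m φ b) (hψ : Centered m ψ b)
    (hφi : Integrable φ (Measure.pi fun _ => m)) (hψi : Integrable ψ (Measure.pi fun _ => m)) :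
    Centered m (fun y => φ y - ψ y) b := by
  have hp := measurePreserving_update (m := m) b
  have h1 := ((hp.integrable_comp_of_integrable hφi)).prod_right_ae
  have h2 := ((hp.integrable_comp_of_integrable hψi)).prod_right_ae
  filter_upwards [hφ, hψ, h1, h2] with y e1 e2 i1 i2
  have := integral_sub i1 i2
  simp only [Function.comp_apply] at this
  rw [this, e1, e2, sub_zero]

lemma Centered.comp_injective {κ : Type*} [Fintype κ] [DecidableEq κ] {r : κ → ι}
    (hr : Function.Injective r) {φ : (κ → 𝒲) → ℝ} {b : κ} (hφ : Centered m φ b) :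
    Centered m (fun y : ι → 𝒲 => φ fun j => y (r j)) (r b) := by
  have h := (measurePreserving_comp_injective (m := m) hr).quasiMeasurePreserving.ae hφ
  filter_upwards [h] with y hy
  rw [← hy]
  congr 1; funext t; congr 1; funext j
  by_cases h : j = b
  · subst h; simp
  · simp [h, hr.ne h]

lemma dependsOn_comp_injective {κ : Type*} {r : κ → ι}
    {φ : (κ → 𝒲) → ℝ} {B : Finset κ} (hφ : DependsOn φ (B : Set κ)) :
    DependsOn (fun y : ι → 𝒲 => φ fun j => y (r j)) ((B.image r : Finset ι) : Set ι) := by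
  intro x y h
  exact hφ fun j hj => h (r j) (by simpa using ⟨j, hj, rfl⟩)

lemma Centered.comp_coordinatewise {𝒲' : Type*} [MeasurableSpace 𝒲'] {m' : Measure 𝒲'}
    [IsProbabilityMeasure m'] {p : ι → 𝒲' → 𝒲} (hp : ∀ i, MeasurePreserving (p i) m' m)
    {φ : (ι → 𝒲) → ℝ} (hφm : Measurable φ) {b : ι} (hφ : Centered m φ b) :
    Centered m' (fun x : ι → 𝒲' => φ fun j => p j (x j)) b := by
  have h := (measurePreserving_pi (fun _ => m') (fun _ => m) hp).quasiMeasurePreserving.ae hφ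
  filter_upwards [h] with y hy
  rw [← hy]
  have e : ∀ s, (fun j => p j (Function.update y b s j))
      = Function.update (fun j => p j (y j)) b (p b s) := by
    intro s; funext j
    by_cases h : j = b
    · subst h; simp
    · simp [h]
  simp only [e]
  exact integral_comp_of_measurePreserving (hp b)
    (φ := fun t => φ (Function.update (fun j => p j (y j)) b t))
    (hφm.comp (measurable_update _)).aestronglyMeasurable

lemma dependsOn_comp_coordinatewise {𝒲' : Type*} {p : ι → 𝒲' → 𝒲} {φ : (ι → 𝒲) → ℝ}
    {S : Set ι} (hφ : DependsOn φ S) : DependsOn (fun x : ι → 𝒲' => φ fun j => p j (x j)) S :=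
  fun _ _ h => hφ fun j hj => congrArg (p j) (h j hj)

end Product

/-! ### Resampling one coordinate on the doubled product space. -/

section Doubled

variable {ι 𝒴 : Type*} [Fintype ι] [DecidableEq ι] [MeasurableSpace 𝒴]
  {ν : Measure 𝒴} [IsProbabilityMeasure ν]

/-- Exchange of the two entries of the coordinate `e`. -/
def swapAt (e : ι) (x : ι → 𝒴 × 𝒴) : ι → 𝒴 × 𝒴 :=
  fun j => (if j = e then Prod.swap else id) (x j)

lemma swapAt_swapAt (e : ι) (x : ι → 𝒴 × 𝒴) : swapAt e (swapAt e x) = x := by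
  funext j
  unfold swapAt
  split_ifs <;> simp

lemma measurePreserving_swapAt (e : ι) :
    MeasurePreserving (swapAt (𝒴 := 𝒴) e) (Measure.pi fun _ => ν.prod ν)
      (Measure.pi fun _ => ν.prod ν) := by
  refine measurePreserving_pi _ _ fun j => ?_
  split_ifs
  · exact Measure.measurePreserving_swap
  · exact MeasurePreserving.id _

lemma swapAt_eq_of_dependsOn {ψ : (ι → 𝒴 × 𝒴) → ℝ} {S : Set ι} (h : DependsOn ψ S) {e : ι}
    (he : e ∉ S) (x : ι → 𝒴 × 𝒴) : ψ (swapAt e x) = ψ x :=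
  h fun i hi => by
    have : i ≠ e := fun hie => he (hie ▸ hi)
    simp [swapAt, this]

/-- The first entries of all coordinates. -/
def firsts (x : ι → 𝒴 × 𝒴) : ι → 𝒴 := fun j => (x j).1

lemma measurePreserving_firsts :
    MeasurePreserving (firsts (ι := ι) (𝒴 := 𝒴)) (Measure.pi fun _ => ν.prod ν)
      (Measure.pi fun _ => ν) :=
  measurePreserving_pi _ _ fun _ => measurePreserving_fst

/-- Given the other coordinates, `ψ` sees the first entry at `e` and `φ` the second; these are
independent and `φ` averages to zero. -/
lemma integral_mul_swapAt_eq_zero {φ ψ : (ι → 𝒴) → ℝ} {e : ι} (hφ : Centered ν φ e)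
    (hi : Integrable (fun x => ψ (firsts x) * φ (firsts (swapAt e x)))
      (Measure.pi fun _ => ν.prod ν)) :
    ∫ x, ψ (firsts x) * φ (firsts (swapAt e x)) ∂(Measure.pi fun _ => ν.prod ν) = 0 := by
  rw [integral_update hi e]
  have h := (measurePreserving_firsts (ι := ι) (ν := ν)).quasiMeasurePreserving.ae hφ
  have : (fun x => ∫ s, ψ (firsts (Function.update x e s))
      * φ (firsts (swapAt e (Function.update x e s))) ∂(ν.prod ν))
      =ᵐ[Measure.pi fun _ => ν.prod ν] 0 := by
    filter_upwards [h] with x hx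
    have e1 : ∀ s : 𝒴 × 𝒴, firsts (Function.update x e s)
        = Function.update (firsts x) e s.1 := by
      intro s; funext j
      by_cases h : j = e
      · subst h; simp [firsts]
      · simp [firsts, h]
    have e2 : ∀ s : 𝒴 × 𝒴, firsts (swapAt e (Function.update x e s))
        = Function.update (firsts x) e s.2 := by
      intro s; funext j
      by_cases h : j = e
      · subst h; simp [firsts, swapAt]
      · simp [firsts, swapAt, h]
    simp only [e1, e2, Pi.zero_apply]
    rw [integral_prod_mul (fun t => ψ (Function.update (firsts x) e t))
      (fun t => φ (Function.update (firsts x) e t)), hx, mul_zero]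
  rw [integral_congr_ae this]
  simp

end Doubled

/-! ### The Hoeffding decomposition on a finite product space -/

section Mobius

variable {κ : Type*} [DecidableEq κ]

/-- Möbius inversion over the subsets of a finite set. -/
def mobius (c : Finset κ → ℝ) (B : Finset κ) : ℝ :=
  ∑ B' ∈ B.powerset, (-1 : ℝ) ^ (B.card - B'.card) * c B'

/-- Pairing the subsets with and without `b` makes Möbius inversion a discrete derivative in the
direction `b`. -/
lemma mobius_insert (c : Finset κ → ℝ) {b : κ} {B : Finset κ} (hb : b ∉ B) :
    mobius c (insert b B) = mobius (fun B' => c (insert b B') - c B') B := by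
  unfold mobius
  rw [Finset.sum_powerset_insert hb, ← Finset.sum_add_distrib]
  refine Finset.sum_congr rfl fun B' hB' => ?_
  have hB := Finset.mem_powerset.1 hB'
  have hb' : b ∉ B' := fun h => hb (hB h)
  have hc := Finset.card_le_card hB
  rw [Finset.card_insert_of_notMem hb, Finset.card_insert_of_notMem hb', Nat.add_sub_add_right,
    Nat.sub_add_comm hc, pow_succ]
  ring

lemma mobius_sub (c c' : Finset κ → ℝ) (B : Finset κ) :
    mobius (fun B' => c B' - c' B') B = mobius c B - mobius c' B := by
  simp only [mobius, mul_sub, Finset.sum_sub_distrib]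

lemma sum_mobius (c : Finset κ → ℝ) (C : Finset κ) :
    ∑ B ∈ C.powerset, mobius c B = c C := by
  induction C using Finset.induction_on generalizing c with
  | empty => simp [mobius]
  | insert a C ha ih =>
    rw [Finset.sum_powerset_insert ha]
    have : ∀ B ∈ C.powerset, mobius c (insert a B)
        = mobius (fun B' => c (insert a B')) B - mobius c B := fun B hB => by
      rw [mobius_insert c fun h => ha (Finset.mem_powerset.1 hB h), mobius_sub]
    rw [Finset.sum_congr rfl this, Finset.sum_sub_distrib, ih, ih]
    ring

lemma mobius_image {κ' : Type*} [DecidableEq κ'] {r : κ → κ'} (hr : Function.Injective r)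
    (c : Finset κ' → ℝ) (B : Finset κ) :
    mobius c (B.image r) = mobius (fun B' => c (B'.image r)) B := by
  unfold mobius
  rw [Finset.powerset_image, Finset.sum_image (Finset.image_injective hr).injOn]
  simp only [Finset.card_image_of_injective _ hr]

end Mobius

section Hoeffding

variable {κ 𝒴 : Type*} [Fintype κ] [DecidableEq κ] [MeasurableSpace 𝒴]

/-- The conditional mean of `g` given the coordinates in `B`. -/
noncomputable def condE (ν : Measure 𝒴) (g : (κ → 𝒴) → ℝ) (B : Finset κ) (y : κ → 𝒴) : ℝ :=
  ∫ q, g (B.piecewise y q) ∂(Measure.pi fun _ => ν)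

/-- The component of the Hoeffding decomposition of `g` that belongs to `B`. -/
noncomputable def hoef (ν : Measure 𝒴) (g : (κ → 𝒴) → ℝ) (B : Finset κ) (y : κ → 𝒴) : ℝ :=
  mobius (fun B' => condE ν g B' y) B

variable {ν : Measure 𝒴} [IsProbabilityMeasure ν] {g : (κ → 𝒴) → ℝ}

lemma dependsOn_condE (B : Finset κ) : DependsOn (condE ν g B) (B : Set κ) := by
  intro x y h
  unfold condE
  congr 1; funext q; congr 1; funext i
  by_cases hi : i ∈ B
  · simp [hi, h i hi]
  · simp [hi]

lemma dependsOn_hoef (B : Finset κ) : DependsOn (hoef ν g B) (B : Set κ) := by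
  intro x y h
  refine Finset.sum_congr rfl fun B' hB' => ?_
  congr 1
  exact dependsOn_condE B' fun i hi => h i (Finset.mem_powerset.1 hB' hi)

lemma measurable_condE (hg : Measurable g) (B : Finset κ) : Measurable (condE ν g B) := by
  have h : Measurable (fun p : (κ → 𝒴) × (κ → 𝒴) => g (B.piecewise p.1 p.2)) :=
    hg.comp (measurePreserving_piecewise (m := ν) B).measurable
  exact (h.stronglyMeasurable.integral_prod_right (ν := Measure.pi fun _ => ν)).measurable

lemma measurable_hoef (hg : Measurable g) (B : Finset κ) : Measurable (hoef ν g B) :=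
  Finset.measurable_sum _ fun B' _ => (measurable_condE hg B').const_mul _

/-- Jensen on each fibre (the `L¹`-norm is at most the `L⁴`-norm), then integration over the
conditioning coordinates. -/
lemma eLpNorm_condE_le (hg : Measurable g) (B : Finset κ) :
    eLpNorm (condE ν g B) 4 (Measure.pi fun _ => ν) ≤ eLpNorm g 4 (Measure.pi fun _ => ν) := by
  have hp := measurePreserving_piecewise (m := ν) B
  have h4 : ((4 : ENNReal)).toReal = 4 := by norm_num
  rw [eLpNorm_eq_lintegral_rpow_enorm_toReal (by norm_num) (by norm_num),
    eLpNorm_eq_lintegral_rpow_enorm_toReal (by norm_num) (by norm_num)]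
  refine ENNReal.rpow_le_rpow ?_ (by positivity)
  rw [h4]
  have hm : Measurable (fun y => ‖g y‖ₑ ^ (4 : ℝ)) := (hg.enorm).pow_const _
  have hm' := (hm.comp hp.measurable).aemeasurable
    (μ := (Measure.pi fun _ => ν).prod (Measure.pi fun _ => ν))
  simp only [Function.comp_def] at hm'
  rw [← hp.lintegral_comp hm, lintegral_prod _ hm']
  refine lintegral_mono fun y => ?_
  have hy : Measurable (fun q => g (B.piecewise y q)) :=
    hg.comp (hp.measurable.comp measurable_prodMk_left)
  have h1 : ‖condE ν g B y‖ₑ ≤ eLpNorm (fun q => g (B.piecewise y q)) 4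
      (Measure.pi fun _ => ν) := by
    refine (enorm_integral_le_lintegral_enorm _).trans ?_
    rw [← eLpNorm_one_eq_lintegral_enorm]
    exact eLpNorm_le_eLpNorm_of_exponent_le (by norm_num) hy.aestronglyMeasurable
  calc ‖condE ν g B y‖ₑ ^ (4 : ℝ)
      ≤ (eLpNorm (fun q => g (B.piecewise y q)) 4 (Measure.pi fun _ => ν)) ^ (4 : ℝ) :=
        ENNReal.rpow_le_rpow h1 (by norm_num)
    _ = _ := by
        rw [eLpNorm_eq_lintegral_rpow_enorm_toReal (by norm_num) (by norm_num), h4,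
          ← ENNReal.rpow_mul]
        norm_num

lemma memLp_condE (hg : Measurable g) (hg4 : MemLp g 4 (Measure.pi fun _ => ν)) (B : Finset κ) :
    MemLp (condE ν g B) 4 (Measure.pi fun _ => ν) :=
  ⟨(measurable_condE hg B).aestronglyMeasurable, (eLpNorm_condE_le hg B).trans_lt hg4.2⟩

lemma memLp_hoef (hg : Measurable g) (hg4 : MemLp g 4 (Measure.pi fun _ => ν)) (B : Finset κ) :
    MemLp (hoef ν g B) 4 (Measure.pi fun _ => ν) := by
  unfold hoef mobius
  exact memLp_finsetSum _ fun B' _ => (memLp_condE hg hg4 B').const_mul _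

lemma eLpNorm_hoef_le (hg : Measurable g) (B : Finset κ) :
    eLpNorm (hoef ν g B) 4 (Measure.pi fun _ => ν)
      ≤ 2 ^ Fintype.card κ * eLpNorm g 4 (Measure.pi fun _ => ν) := by
  have h1 : hoef ν g B = ∑ B' ∈ B.powerset,
      (fun y => (-1 : ℝ) ^ (B.card - B'.card) * condE ν g B' y) := by
    funext y; simp [hoef, mobius]
  rw [h1]
  refine (eLpNorm_sum_le (fun B' _ =>
    ((measurable_condE hg B').const_mul _).aestronglyMeasurable) (by norm_num)).trans ?_
  have h2 : ∀ B' ∈ B.powerset,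
      eLpNorm (fun y => (-1 : ℝ) ^ (B.card - B'.card) * condE ν g B' y) 4
        (Measure.pi fun _ => ν) ≤ eLpNorm g 4 (Measure.pi fun _ => ν) := by
    intro B' _
    refine le_trans (le_of_eq ?_) (eLpNorm_condE_le hg B')
    refine eLpNorm_congr_norm_ae (Filter.Eventually.of_forall fun y => ?_)
    simp
  refine (Finset.sum_le_sum h2).trans ?_
  rw [Finset.sum_const, Finset.card_powerset, nsmul_eq_mul]
  gcongr
  push_cast
  exact pow_le_pow_right₀ (by norm_num) (Finset.card_le_univ _)

lemma integral_pow_four_eq {Ω : Type*} [MeasurableSpace Ω] {P : Measure Ω} {φ : Ω → ℝ}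
    (h : MemLp φ 4 P) : ∫ x, φ x ^ 4 ∂P = (eLpNorm φ 4 P).toReal ^ 4 := by
  rw [h.eLpNorm_eq_integral_rpow_norm (by norm_num) (by norm_num), ENNReal.toReal_ofReal
    (by positivity), ← Real.rpow_natCast, ← Real.rpow_mul (by positivity)]
  norm_num
  congr 1; funext x
  exact ((Even.pow_abs (by decide) (φ x))).symm

lemma integral_hoef_pow_four_le (hg : Measurable g) (hg4 : MemLp g 4 (Measure.pi fun _ => ν))
    (B : Finset κ) :
    ∫ y, hoef ν g B y ^ 4 ∂(Measure.pi fun _ => ν)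
      ≤ (2 ^ Fintype.card κ * (eLpNorm g 4 (Measure.pi fun _ => ν)).toReal) ^ 4 := by
  rw [integral_pow_four_eq (memLp_hoef hg hg4 B)]
  refine pow_le_pow_left₀ ENNReal.toReal_nonneg ?_ 4
  have h := ENNReal.toReal_mono (ENNReal.mul_ne_top (by simp) hg4.2.ne)
    (eLpNorm_hoef_le hg B)
  simpa [ENNReal.toReal_mul, ENNReal.toReal_pow] using h

lemma sum_hoef (y : κ → 𝒴) : ∑ B : Finset κ, hoef ν g B y = g y := by
  have := sum_mobius (fun B' => condE ν g B' y) (Finset.univ : Finset κ)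
  rw [Finset.powerset_univ] at this
  unfold hoef
  rw [this, condE]
  simp

lemma Centered.sum {s : Finset (Finset κ)} {φ : Finset κ → (κ → 𝒴) → ℝ} {b : κ}
    (c : Finset κ → ℝ) (h : ∀ i ∈ s, Centered ν (φ i) b)
    (hi : ∀ i ∈ s, Integrable (φ i) (Measure.pi fun _ => ν)) :
    Centered ν (fun y => ∑ i ∈ s, c i * φ i y) b := by
  have hp := measurePreserving_update (m := ν) b
  have h1 : ∀ᵐ y ∂(Measure.pi fun _ => ν), ∀ i ∈ s,
      Integrable (fun t => φ i (Function.update y b t)) ν :=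
    (ae_ball_iff s.countable_toSet).2 fun i his =>
      (hp.integrable_comp_of_integrable (hi i his)).prod_right_ae
  have h2 : ∀ᵐ y ∂(Measure.pi fun _ => ν), ∀ i ∈ s,
      ∫ t, φ i (Function.update y b t) ∂ν = 0 :=
    (ae_ball_iff s.countable_toSet).2 fun i his => h i his
  filter_upwards [h1, h2] with y i1 e1
  rw [integral_finsetSum _ fun i his => (i1 i his).const_mul _]
  refine Finset.sum_eq_zero fun i his => ?_
  rw [integral_const_mul, e1 i his, mul_zero]

/-- Tower property: averaging the conditional mean given `insert b B` over `b` yields the one given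
`B`, which is constant in `b`. -/
lemma centered_condE_insert_sub (hg : Measurable g) (hg4 : MemLp g 4 (Measure.pi fun _ => ν))
    {b : κ} {B : Finset κ} (hb : b ∉ B) :
    Centered ν (fun y => condE ν g (insert b B) y - condE ν g B y) b := by
  have hgi : Integrable g (Measure.pi fun _ => ν) := hg4.integrable (by norm_num)
  have h1 := ((measurePreserving_piecewise (m := ν) B).integrable_comp_of_integrable
    hgi).prod_right_ae
  have h2 := ((measurePreserving_update (m := ν) b).integrable_comp_of_integrable
    ((memLp_condE hg hg4 (insert b B)).integrable (by norm_num))).prod_right_ae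
  filter_upwards [h1, h2] with y i1 i2
  simp only [Function.comp_apply] at i1 i2
  have e1 : ∀ t, condE ν g B (Function.update y b t) = condE ν g B y := fun t =>
    update_eq_of_dependsOn (dependsOn_condE B) (by simpa using hb) y t
  simp only [e1]
  rw [integral_sub i2 (integrable_const _), integral_const]
  simp only [probReal_univ, one_smul]
  rw [sub_eq_zero]
  have e2 : ∀ t, condE ν g (insert b B) (Function.update y b t)
      = ∫ q, g (B.piecewise y (Function.update q b t)) ∂(Measure.pi fun _ => ν) := by
    intro t
    unfold condE
    congr 1; funext q; congr 1; funext i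
    by_cases hib : i = b
    · subst hib; simp [hb]
    · by_cases hi : i ∈ B <;> simp [hi, hib]
  simp only [e2]
  rw [integral_integral_swap, condE, integral_update i1 b]
  have h3 := (measurePreserving_update (m := ν) b).integrable_comp_of_integrable i1
  exact h3.swap

/-- By `mobius_insert` the component is a signed sum of the differences in
`centered_condE_insert_sub`. -/
lemma centered_hoef (hg : Measurable g) (hg4 : MemLp g 4 (Measure.pi fun _ => ν))
    {b : κ} {B : Finset κ} (hb : b ∈ B) : Centered ν (hoef ν g B) b := by
  obtain ⟨B, hbB, rfl⟩ : ∃ B', b ∉ B' ∧ insert b B' = B :=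
    ⟨B.erase b, Finset.notMem_erase b B, Finset.insert_erase hb⟩
  have : hoef ν g (insert b B) = fun y => ∑ B' ∈ B.powerset, (-1 : ℝ) ^ (B.card - B'.card)
      * (condE ν g (insert b B') y - condE ν g B' y) := by
    funext y
    exact mobius_insert _ hbB
  rw [this]
  refine Centered.sum (φ := fun B' y => condE ν g (insert b B') y - condE ν g B' y) _
    (fun B' hB' => centered_condE_insert_sub hg hg4
      fun h => hbB (Finset.mem_powerset.1 hB' h)) fun B' _ => ?_
  exact ((memLp_condE hg hg4 _).sub (memLp_condE hg hg4 _)).integrable (by norm_num)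

lemma hoef_comp_perm (hg : Measurable g) (r : Equiv.Perm κ)
    (hr : ∀ᵐ y ∂(Measure.pi fun _ => ν), g (fun j => y (r j)) = g y) (B : Finset κ) :
    ∀ᵐ y ∂(Measure.pi fun _ => ν), hoef ν g B (fun j => y (r j)) = hoef ν g (B.image r) y := by
  have hc : ∀ B : Finset κ, ∀ᵐ y ∂(Measure.pi fun _ => ν),
      condE ν g B (fun j => y (r j)) = condE ν g (B.image r) y := by
    intro B
    have h1 := Measure.ae_ae_of_ae_prod
      ((measurePreserving_piecewise (m := ν) (B.image r)).quasiMeasurePreserving.ae hr)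
    filter_upwards [h1] with y hy
    unfold condE
    rw [← integral_congr_ae hy, ← integral_comp_of_measurePreserving
      (measurePreserving_comp_injective (m := ν) r.injective)]
    · congr 1; funext q; congr 1; funext j
      by_cases h : j ∈ B <;> simp [h, r.injective.eq_iff]
    · refine (hg.comp ?_).aestronglyMeasurable
      exact (measurePreserving_piecewise (m := ν) B).measurable.comp measurable_prodMk_left
  have := ae_all_iff.2 hc
  filter_upwards [this] with y hy
  unfold hoef
  rw [mobius_image r.injective]
  simp only [hy]

lemma integral_hoef_mul_hoef (hg : Measurable g) (hg4 : MemLp g 4 (Measure.pi fun _ => ν))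
    {B B' : Finset κ} (h : B ≠ B') :
    ∫ y, hoef ν g B y * hoef ν g B' y ∂(Measure.pi fun _ => ν) = 0 := by
  have key : ∀ B B' : Finset κ, (∃ b ∈ B, b ∉ B') →
      ∫ y, hoef ν g B y * hoef ν g B' y ∂(Measure.pi fun _ => ν) = 0 := by
    rintro B B' ⟨b, hb, hb'⟩
    refine (centered_hoef hg hg4 hb).integral_mul_eq_zero (dependsOn_hoef B') (by simpa) ?_
    exact MemLp.integrable_mul ((memLp_hoef hg hg4 B).mono_exponent (p := 2) (by norm_num))
      ((memLp_hoef hg hg4 B').mono_exponent (p := 2) (by norm_num))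
  by_cases h1 : B ⊆ B'
  · have : ¬ B' ⊆ B := fun h2 => h (h1.antisymm h2)
    obtain ⟨b, hb, hb'⟩ := Finset.not_subset.1 this
    simp only [mul_comm (hoef ν g B _)]
    exact key B' B ⟨b, hb, hb'⟩
  · obtain ⟨b, hb, hb'⟩ := Finset.not_subset.1 h1
    exact key B B' ⟨b, hb, hb'⟩

end Hoeffding

/-! ### Four edge sets that cover every edge at least twice -/

/-- Inclusion–exclusion over the Venn diagram of four sets without simply covered points:
`aij` counts the points in exactly the sets `i`, `j`, `ti` those in all sets but `i`, and `q`
those in all four. -/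
lemma venn_card_bound {d a01 a02 a03 a12 a13 a23 t0 t1 t2 t3 q : ℕ}
    (h01 : 2 ≤ a01 + t2 + t3 + q) (h23 : 2 ≤ a23 + t0 + t1 + q) (h12 : 2 ≤ a12 + t0 + t3 + q)
    (d0 : d ≤ a01 + a02 + a03 + t1 + t2 + t3 + q)
    (d1 : d ≤ a01 + a12 + a13 + t0 + t2 + t3 + q)
    (d2 : d ≤ a02 + a12 + a23 + t0 + t1 + t3 + q)
    (d3 : d ≤ a03 + a13 + a23 + t0 + t1 + t2 + q)
    (k0 : a01 + a02 + a03 + t1 + t2 + t3 + q = d → 2 ≤ t1 + t2 + t3 + q ∨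
      a02 + a03 + t1 = 0 ∨ a01 + a03 + t2 = 0 ∨ a01 + a02 + t3 = 0)
    (k1 : a01 + a12 + a13 + t0 + t2 + t3 + q = d → 2 ≤ t0 + t2 + t3 + q ∨
      a12 + a13 + t0 = 0 ∨ a01 + a13 + t2 = 0 ∨ a01 + a12 + t3 = 0)
    (k2 : a02 + a12 + a23 + t0 + t1 + t3 + q = d → 2 ≤ t0 + t1 + t3 + q ∨
      a12 + a23 + t0 = 0 ∨ a02 + a23 + t1 = 0 ∨ a02 + a12 + t3 = 0)
    (k3 : a03 + a13 + a23 + t0 + t1 + t2 + q = d → 2 ≤ t0 + t1 + t2 + q ∨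
      a13 + a23 + t0 = 0 ∨ a03 + a23 + t1 = 0 ∨ a03 + a13 + t2 = 0) :
    2 * d + 2 ≤ a01 + a02 + a03 + a12 + a13 + a23 + 2 * (t0 + t1 + t2 + t3) + 3 * q := by
  by_contra hlt
  have hq : q ≤ 1 := by omega
  -- Twice the right-hand side of the goal is the sum of the four cardinalities plus `t0 + t1 + t2 +
  -- t3 + 2 * q`. If the bound fails, this last quantity and the excesses of the cardinalities over
  -- `d` add up to at most 2, so few configurations remain.
  rcases (show t0 + t1 + t2 + t3 + 2 * q = 0 ∨ t0 + t1 + t2 + t3 + 2 * q = 1 ∨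
    t0 + t1 + t2 + t3 + 2 * q = 2 by omega) with h | h | h <;> omega

section Venn

variable {β : Type*} [DecidableEq β] (V : Fin 4 → Finset β)

/-- The number of the sets `V j` that contain `v`. -/
def multiplicity (v : β) : ℕ := (Finset.univ.filter fun j => v ∈ V j).card

/-- The membership pattern of `v` in the four sets. -/
def vennPattern (v : β) : Bool × Bool × Bool × Bool :=
  (decide (v ∈ V 0), decide (v ∈ V 1), decide (v ∈ V 2), decide (v ∈ V 3))

/-- The number of points with a given membership pattern. -/
def vennCard (s : Bool × Bool × Bool × Bool) : ℕ :=
  ((Finset.univ.biUnion V).filter fun v => vennPattern V v = s).card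

variable {V}

lemma card_filter_vennPattern (p : Bool × Bool × Bool × Bool → Bool) :
    ((Finset.univ.biUnion V).filter fun v => p (vennPattern V v) = true).card
      = ∑ s, if p s = true then vennCard V s else 0 := by
  rw [Finset.card_eq_sum_card_fiberwise (f := vennPattern V) (t := Finset.univ)
    (fun _ _ => Finset.mem_univ _)]
  refine Finset.sum_congr rfl fun s _ => ?_
  rw [Finset.filter_filter]
  split_ifs with h
  · unfold vennCard
    congr 1
    ext v
    simp only [Finset.mem_filter, and_congr_right_iff]
    rintro -
    constructor
    · exact fun h => h.2
    · rintro rfl; exact ⟨h, rfl⟩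
  · rw [Finset.card_eq_zero, Finset.filter_eq_empty_iff]
    rintro v - ⟨h1, rfl⟩
    exact h h1

/-- Membership in the `i`-th set, read off from a pattern. -/
def vennBit (i : Fin 4) (s : Bool × Bool × Bool × Bool) : Bool :=
  ![s.1, s.2.1, s.2.2.1, s.2.2.2] i

lemma vennBit_vennPattern (i : Fin 4) (v : β) :
    vennBit i (vennPattern V v) = decide (v ∈ V i) := by
  fin_cases i <;> rfl

lemma card_eq_of_vennPattern {S : Finset β} (p : Bool × Bool × Bool × Bool → Bool)
    (hSV : S ⊆ Finset.univ.biUnion V) (hS : ∀ v, v ∈ S ↔ p (vennPattern V v) = true) :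
    S.card = ∑ s, if p s = true then vennCard V s else 0 := by
  rw [← card_filter_vennPattern]
  congr 1
  ext v
  simp only [Finset.mem_filter, ← hS]
  exact ⟨fun h => ⟨hSV h, h⟩, fun h => h.2⟩

lemma multiplicity_eq (v : β) : multiplicity V v
    = (if v ∈ V 0 then 1 else 0) + (if v ∈ V 1 then 1 else 0) + (if v ∈ V 2 then 1 else 0)
      + (if v ∈ V 3 then 1 else 0) := by
  rw [multiplicity, Finset.card_filter, Fin.sum_univ_four]

lemma vennCard_eq_zero {s : Bool × Bool × Bool × Bool}
    (h : ∀ v, (∃ j, v ∈ V j) → vennPattern V v ≠ s) : vennCard V s = 0 := by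
  rw [vennCard, Finset.card_eq_zero, Finset.filter_eq_empty_iff]
  intro v hv
  exact h v (by simpa using hv)

/-- All cardinalities are sums over the sixteen membership patterns, so the statement becomes the
linear arithmetic of `venn_card_bound`. -/
theorem card_biUnion_four_le {d : ℕ} (h2 : ∀ i, ∀ v ∈ V i, ∃ j ≠ i, v ∈ V j)
    (hd : ∀ i, d ≤ (V i).card)
    (hk : ∀ i, (V i).card = d → 2 ≤ ((V i).filter fun v => 3 ≤ multiplicity V v).card ∨
      ∃ j ≠ i, V i ⊆ V j)
    (h01 : 2 ≤ (V 0 ∩ V 1).card) (h23 : 2 ≤ (V 2 ∩ V 3).card)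
    (hx : ∃ p q, (p = 0 ∨ p = 1) ∧ (q = 2 ∨ q = 3) ∧ 2 ≤ (V p ∩ V q).card) :
    (Finset.univ.biUnion V).card + 2 * d + 2 ≤ ∑ i, (V i).card := by
  have sV : ∀ i, V i ⊆ Finset.univ.biUnion V :=
    fun i => Finset.subset_biUnion_of_mem V (Finset.mem_univ i)
  have cU : (Finset.univ.biUnion V).card
      = ∑ s, if (vennBit 0 s || vennBit 1 s || vennBit 2 s || vennBit 3 s) = true
        then vennCard V s else 0 := by
    refine card_eq_of_vennPattern (fun s => vennBit 0 s || vennBit 1 s || vennBit 2 s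
      || vennBit 3 s) subset_rfl fun v => ?_
    simp [vennBit_vennPattern, Fin.exists_fin_succ]
    tauto
  have cV : ∀ i, (V i).card = ∑ s, if vennBit i s = true then vennCard V s else 0 := fun i =>
    card_eq_of_vennPattern _ (sV i) fun v => by simp [vennBit_vennPattern]
  have cI : ∀ i j, (V i ∩ V j).card
      = ∑ s, if (vennBit i s && vennBit j s) = true then vennCard V s else 0 := fun i j =>
    card_eq_of_vennPattern (fun s => vennBit i s && vennBit j s)
      (Finset.inter_subset_left.trans (sV i)) fun v => by simp [vennBit_vennPattern]
  have cD : ∀ i j, (V i \ V j).card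
      = ∑ s, if (vennBit i s && !(vennBit j s)) = true then vennCard V s else 0 := fun i j =>
    card_eq_of_vennPattern (fun s => vennBit i s && !(vennBit j s))
      (Finset.sdiff_subset.trans (sV i)) fun v => by simp [vennBit_vennPattern]
  have cM : ∀ i, ((V i).filter fun v => 3 ≤ multiplicity V v).card
      = ∑ s, if (vennBit i s && decide (3 ≤ (vennBit 0 s).toNat + (vennBit 1 s).toNat
        + (vennBit 2 s).toNat + (vennBit 3 s).toNat)) = true then vennCard V s else 0 := fun i =>
    card_eq_of_vennPattern (fun s => vennBit i s && decide (3 ≤ (vennBit 0 s).toNat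
      + (vennBit 1 s).toNat + (vennBit 2 s).toNat + (vennBit 3 s).toNat))
      ((Finset.filter_subset _ _).trans (sV i)) fun v => by
        simp [vennBit_vennPattern, multiplicity_eq, Bool.toNat, Bool.cond_eq_ite]
  -- No point lies in exactly one set, so four of the patterns are empty.
  have single : ∀ i : Fin 4, vennCard V
      (decide ((0 : Fin 4) = i), decide ((1 : Fin 4) = i), decide ((2 : Fin 4) = i),
        decide ((3 : Fin 4) = i)) = 0 := by
    intro i
    refine vennCard_eq_zero fun v _ hv => ?_
    have hm : ∀ j, v ∈ V j ↔ j = i := by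
      intro j
      simp only [vennPattern, Prod.mk.injEq, decide_eq_decide] at hv
      obtain ⟨e0, e1, e2, e3⟩ := hv
      fin_cases j <;> assumption
    obtain ⟨j, hj, hvj⟩ := h2 i v ((hm i).2 rfl)
    exact hj ((hm j).1 hvj)
  have s0 := single 0; have s1 := single 1; have s2 := single 2; have s3 := single 3
  have hsub : ∀ i j, V i ⊆ V j → (V i \ V j).card = 0 := fun i j h => by
    rw [Finset.sdiff_eq_empty_iff_subset.2 h, Finset.card_empty]
  have hk' : ∀ i, (V i).card = d → 2 ≤ ((V i).filter fun v => 3 ≤ multiplicity V v).card ∨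
      ∃ j ≠ i, (V i \ V j).card = 0 := fun i hi =>
    (hk i hi).imp id fun ⟨j, hj, hs⟩ => ⟨j, hj, hsub i j hs⟩
  have z : vennCard V (false, false, false, false) = 0 := by
    refine vennCard_eq_zero fun v ⟨j, hj⟩ hv => ?_
    simp only [vennPattern, Prod.mk.injEq, decide_eq_false_iff_not] at hv
    obtain ⟨e0, e1, e2, e3⟩ := hv
    fin_cases j <;> contradiction
  have k0 := hk' 0; have k1 := hk' 1; have k2 := hk' 2; have k3 := hk' 3
  have d0 := hd 0; have d1 := hd 1; have d2 := hd 2; have d3 := hd 3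
  have hx' : 2 ≤ (V 0 ∩ V 2).card ∨ 2 ≤ (V 0 ∩ V 3).card ∨ 2 ≤ (V 1 ∩ V 2).card ∨
      2 ≤ (V 1 ∩ V 3).card := by
    obtain ⟨p, q, rfl | rfl, rfl | rfl, h⟩ := hx <;> simp [h]
  clear hx hk hk' hd h2 single hsub
  simp only [Fin.exists_fin_succ, Fin.sum_univ_four, cU, cI, cD, cM, cV,
    Fintype.sum_prod_type, Fintype.sum_bool, vennBit] at *
  clear cU cV cI cD cM
  simp at *
  simp only [s0, s1, s2, s3, add_zero] at *
  generalize vennCard V (true, true, false, false) = a01 at *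
  generalize vennCard V (true, false, true, false) = a02 at *
  generalize vennCard V (true, false, false, true) = a03 at *
  generalize vennCard V (false, true, true, false) = a12 at *
  generalize vennCard V (false, true, false, true) = a13 at *
  generalize vennCard V (false, false, true, true) = a23 at *
  generalize vennCard V (false, true, true, true) = t0 at *
  generalize vennCard V (true, false, true, true) = t1 at *
  generalize vennCard V (true, true, false, true) = t2 at *
  generalize vennCard V (true, true, true, false) = t3 at *
  generalize vennCard V (true, true, true, true) = q at *
  -- `venn_card_bound` has its middle link between the sets 1 and 2; exchanging 0 with 1 and 2 with
  -- 3 as needed brings every case to this form.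
  rcases hx' with hx | hx | hx | hx
  · have := venn_card_bound (d := d) (a01 := a01) (a02 := a12) (a03 := a13) (a12 := a02) (a13 := a03) (a23 := a23) (t0 := t1) (t1 := t0) (t2 := t2) (t3 := t3)
      (q := q) (by omega) (by omega) (by omega) (by omega) (by omega) (by omega) (by omega)
      (by omega) (by omega) (by omega) (by omega)
    omega
  · have := venn_card_bound (d := d) (a01 := a01) (a02 := a13) (a03 := a12) (a12 := a03) (a13 := a02) (a23 := a23) (t0 := t1) (t1 := t0) (t2 := t3) (t3 := t2)
      (q := q) (by omega) (by omega) (by omega) (by omega) (by omega) (by omega) (by omega)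
      (by omega) (by omega) (by omega) (by omega)
    omega
  · have := venn_card_bound (d := d) (a01 := a01) (a02 := a02) (a03 := a03) (a12 := a12) (a13 := a13) (a23 := a23) (t0 := t0) (t1 := t1) (t2 := t2) (t3 := t3)
      (q := q) (by omega) (by omega) (by omega) (by omega) (by omega) (by omega) (by omega)
      (by omega) (by omega) (by omega) (by omega)
    omega
  · have := venn_card_bound (d := d) (a01 := a01) (a02 := a03) (a03 := a02) (a12 := a13) (a13 := a12) (a23 := a23) (t0 := t0) (t1 := t1) (t2 := t3) (t3 := t2)
      (q := q) (by omega) (by omega) (by omega) (by omega) (by omega) (by omega) (by omega)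
      (by omega) (by omega) (by omega) (by omega)
    omega

end Venn

/-! ### Edge sets, their nodes, and the use of strong connectivity. -/

section Nodes

/-- The endpoints of the edges in `E`. -/
def nodes {n : ℕ} (E : Finset (Pairs n)) : Finset (Fin n) := E.biUnion fun e => e.1.toFinset

lemma mem_nodes {n : ℕ} {E : Finset (Pairs n)} {v : Fin n} :
    v ∈ nodes E ↔ ∃ e ∈ E, v ∈ e.1 := by
  simp [nodes, Sym2.mem_toFinset]

lemma Pairs.mem_map {k n : ℕ} {α : Fin k ↪ Fin n} {e : Pairs k} {v : Fin n} :
    v ∈ (e.map α).1 ↔ ∃ u ∈ e.1, α u = v := Sym2.mem_map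

lemma Pairs.map_injective {k n : ℕ} (α : Fin k ↪ Fin n) : Function.Injective (Pairs.map α) :=
  fun _ _ h => Subtype.ext (Sym2.map.injective α.injective (congrArg Subtype.val h))

lemma nodes_image {k n : ℕ} (α : Fin k ↪ Fin n) (B : Finset (Pairs k)) :
    nodes (B.image (Pairs.map α)) = (nodes B).image α := by
  ext v
  simp only [mem_nodes, Finset.mem_image]
  constructor
  · rintro ⟨_, ⟨e, he, rfl⟩, hv⟩
    obtain ⟨u, hu, rfl⟩ := Pairs.mem_map.1 hv
    exact ⟨u, ⟨e, he, hu⟩, rfl⟩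
  · rintro ⟨u, ⟨e, he, hu⟩, rfl⟩
    exact ⟨_, ⟨e, he, rfl⟩, Pairs.mem_map.2 ⟨u, hu, rfl⟩⟩

lemma Pairs.exists_ne {n : ℕ} (e : Pairs n) (v : Fin n) : ∃ u ∈ e.1, u ≠ v := by
  obtain ⟨e, he⟩ := e
  induction e using Sym2.ind with
  | _ a b =>
    have hab : a ≠ b := by simpa using he
    by_cases h : a = v
    · exact ⟨b, Sym2.mem_mk_right a b, fun hb => hab (h.trans hb.symm)⟩
    · exact ⟨a, Sym2.mem_mk_left a b, h⟩

lemma Pairs.two_le_card {n : ℕ} (e : Pairs n) : 2 ≤ e.1.toFinset.card := by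
  obtain ⟨e, he⟩ := e
  induction e using Sym2.ind with
  | _ a b =>
    have hab : a ≠ b := by simpa using he
    simp [Sym2.toFinset_mk_eq, Finset.card_pair hab]

lemma verts_graph_empty {k : ℕ} (B : Finset (Pairs k)) :
    (graph ∅ B).verts = (nodes B : Set (Fin k)) := by
  ext v; simp [graph, mem_nodes]

lemma numNodes_empty {k : ℕ} (B : Finset (Pairs k)) : numNodes ∅ B = (nodes B).card := by
  rw [numNodes, verts_graph_empty, Set.ncard_coe_finset]

/-- The edge set `E` stays connected when at most one node is deleted. -/
def Biconnected {n : ℕ} (E : Finset (Pairs n)) : Prop :=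
  ∀ R : Finset (Fin n), R.card ≤ 1 → ∀ p : Fin n → Prop,
    (∀ e ∈ E, ∀ u ∈ e.1, ∀ v ∈ e.1, u ∉ R → v ∉ R → p u → p v) →
    ∀ u ∈ nodes E, ∀ v ∈ nodes E, u ∉ R → v ∉ R → p u → p v

lemma propagate_of_connected {V : Type*} {G : SimpleGraph V} {H : G.Subgraph}
    (hH : H.Connected) {p : V → Prop} (hp : ∀ u v, H.Adj u v → p u → p v) {u v : V}
    (hu : u ∈ H.verts) (hv : v ∈ H.verts) (h : p u) : p v := by
  obtain ⟨w⟩ := hH.coe.preconnected ⟨u, hu⟩ ⟨v, hv⟩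
  have : ∀ (a b : H.verts), H.coe.Walk a b → p a → p b := by
    intro a b w
    induction w with
    | nil => exact id
    | cons hadj _ ih => exact fun ha => ih (hp _ _ hadj ha)
  exact this _ _ w h

/-- If `R` contains a node of the graph, strong connectivity applies to the graph without it;
otherwise `R` removes nothing and connectivity suffices. -/
lemma biconnected_of_stronglyConnected {k : ℕ} {B : Finset (Pairs k)}
    (hc : (graph ∅ B).Connected) (hs : StronglyConnected (graph ∅ B)) : Biconnected B := by
  intro R hR p hp u hu v hv huR hvR hpu
  have hu' : u ∈ (graph ∅ B).verts := by rw [verts_graph_empty]; exact hu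
  have hv' : v ∈ (graph ∅ B).verts := by rw [verts_graph_empty]; exact hv
  have hadj : ∀ a b, (graph ∅ B).Adj a b → a ∉ R → b ∉ R → p a → p b := by
    rintro a b ⟨e, he, hab⟩
    exact hp e he a (hab ▸ Sym2.mem_mk_left a b) b (hab ▸ Sym2.mem_mk_right a b)
  by_cases hr : ∃ r ∈ R, r ∈ (graph ∅ B).verts
  · obtain ⟨r, hrR, hrv⟩ := hr
    have hRr : ∀ x, x ∉ R → x ≠ r := by rintro x hx rfl; exact hx hrR
    have hrR' : ∀ x, x ≠ r → x ∉ R := fun x hx hxR => hx (Finset.card_le_one.1 hR _ hxR _ hrR)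
    rcases hs r hrv with h | h
    · refine propagate_of_connected h (p := p) (fun a b hab => ?_) ⟨hu', hRr u huR⟩
        ⟨hv', hRr v hvR⟩ hpu
      rw [SimpleGraph.Subgraph.deleteVerts_adj] at hab
      exact hadj a b hab.2.2.2.2 (hrR' a hab.2.1) (hrR' b hab.2.2.2.1)
    · have : u ∈ ((graph ∅ B).deleteVerts {r}).verts := ⟨hu', hRr u huR⟩
      rw [h] at this
      exact this.elim
  · push Not at hr
    have hV : ∀ x, x ∈ (graph ∅ B).verts → x ∉ R := fun x hx hxR => hr x hxR hx
    exact propagate_of_connected hc (p := p)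
      (fun a b hab => hadj a b hab (hV a hab.fst_mem) (hV b hab.snd_mem)) hu' hv' hpu

lemma Biconnected.image {k n : ℕ} {B : Finset (Pairs k)} (hB : Biconnected B)
    (α : Fin k ↪ Fin n) : Biconnected (B.image (Pairs.map α)) := by
  intro R hR p hp u hu v hv huR hvR hpu
  rw [nodes_image] at hu hv
  obtain ⟨u, hu₀, rfl⟩ := Finset.mem_image.1 hu
  obtain ⟨v, hv₀, rfl⟩ := Finset.mem_image.1 hv
  have hmem : ∀ x, x ∈ R.preimage α α.injective.injOn ↔ α x ∈ R := fun x => by simp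
  refine hB (R.preimage α α.injective.injOn) ?_ (fun x => p (α x)) ?_ u hu₀ v hv₀
    (by rwa [hmem]) (by rwa [hmem]) hpu
  · rw [Finset.card_le_one]
    intro a ha b hb
    exact α.injective (Finset.card_le_one.1 hR _ ((hmem a).1 ha) _ ((hmem b).1 hb))
  · intro e he a ha b hb haR hbR
    exact hp _ (Finset.mem_image_of_mem _ he) _ (Pairs.mem_map.2 ⟨a, ha, rfl⟩) _
      (Pairs.mem_map.2 ⟨b, hb, rfl⟩) (by rwa [← hmem]) (by rwa [← hmem])

/-- Suppose at most one node of `E i` lies in three or more of the node sets. Every other node of `E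
i` lies in at most one further node set. Each edge of `E i` belongs to another `E j`, so its
endpoints share this index; since `E i` stays connected without the exceptional node, one `j` serves
all nodes. -/
lemma two_le_card_or_subset {n : ℕ} {E : Fin 4 → Finset (Pairs n)} {i : Fin 4}
    (hi : Biconnected (E i)) (hne : (E i).Nonempty)
    (hcov : ∀ e ∈ E i, ∃ j ≠ i, e ∈ E j) :
    2 ≤ ((nodes (E i)).filter fun v => 3 ≤ multiplicity (fun j => nodes (E j)) v).card ∨
      ∃ j ≠ i, nodes (E i) ⊆ nodes (E j) := by
  by_contra hcon
  push Not at hcon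
  obtain ⟨hR, hno⟩ := hcon
  set R := (nodes (E i)).filter fun v => 3 ≤ multiplicity (fun j => nodes (E j)) v with hRdef
  have hR1 : R.card ≤ 1 := by omega
  have uniq : ∀ v ∈ nodes (E i), v ∉ R → ∀ j ≠ i, ∀ j' ≠ i, v ∈ nodes (E j) →
      v ∈ nodes (E j') → j = j' := by
    intro v hv hvR j hj j' hj' h h'
    by_contra hne
    refine hvR (Finset.mem_filter.2 ⟨hv, ?_⟩)
    have hsub : ({i, j, j'} : Finset (Fin 4)) ⊆ Finset.univ.filter fun l => v ∈ nodes (E l) := by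
      intro l hl
      simp only [Finset.mem_insert, Finset.mem_singleton] at hl
      rcases hl with rfl | rfl | rfl <;> simp [*]
    have h3 : ({i, j, j'} : Finset (Fin 4)).card = 3 :=
      Finset.card_eq_three.2 ⟨i, j, j', hj.symm, hj'.symm, hne, rfl⟩
    exact h3 ▸ Finset.card_le_card hsub
  have mem : ∀ {j : Fin 4} {e : Pairs n} {v : Fin n}, e ∈ E j → v ∈ e.1 → v ∈ nodes (E j) :=
    fun he hv => mem_nodes.2 ⟨_, he, hv⟩
  have other : ∀ e ∈ E i, ∀ r ∈ R, ∃ u ∈ e.1, u ∉ R := by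
    intro e _ r hr
    obtain ⟨u, hu, hne⟩ := Pairs.exists_ne e r
    exact ⟨u, hu, fun huR => hne (Finset.card_le_one.1 hR1 _ huR _ hr)⟩
  have other' : ∀ e ∈ E i, ∃ u ∈ e.1, u ∉ R := by
    intro e he
    -- The node to be avoided is irrelevant here; it only produces some endpoint of `e`.
    obtain ⟨v, hv, -⟩ := Pairs.exists_ne e (Quot.out e.1).1
    by_cases h : v ∈ R
    · exact other e he v h
    · exact ⟨v, hv, h⟩
  obtain ⟨e₀, he₀⟩ := hne
  obtain ⟨u₀, hu₀, hu₀R⟩ := other' e₀ he₀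
  obtain ⟨j, hj, hej⟩ := hcov e₀ he₀
  have all : ∀ v ∈ nodes (E i), v ∉ R → v ∈ nodes (E j) := by
    intro v hv hvR
    refine hi R hR1 (fun x => x ∈ nodes (E j)) ?_ u₀ (mem he₀ hu₀) v hv hu₀R hvR (mem hej hu₀)
    intro e he a ha b hb haR _ haj
    obtain ⟨j', hj', hej'⟩ := hcov e he
    obtain rfl := uniq a (mem he ha) haR j hj j' hj' haj (mem hej' ha)
    exact mem hej' hb
  -- An exceptional node lies on an edge whose other endpoint is outside of `R`; that endpoint
  -- forces the edge into `E j`.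
  refine hno j hj fun v hv => ?_
  by_cases hvR : v ∈ R
  · obtain ⟨e, he, hve⟩ := mem_nodes.1 hv
    obtain ⟨u, hu, huR⟩ := other e he v hvR
    obtain ⟨j', hj', hej'⟩ := hcov e he
    obtain rfl := uniq u (mem he hu) huR j hj j' hj' (all u (mem he hu) huR) (mem hej' hu)
    exact mem hej' hve
  · exact all v hv hvR

lemma two_le_card_nodes_inter {n : ℕ} {E E' : Finset (Pairs n)} (h : ¬ Disjoint E E') :
    2 ≤ (nodes E ∩ nodes E').card := by
  obtain ⟨e, he, he'⟩ := Finset.not_disjoint_iff.1 h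
  refine (Pairs.two_le_card e).trans (Finset.card_le_card fun v hv => ?_)
  rw [Sym2.mem_toFinset] at hv
  exact Finset.mem_inter.2 ⟨mem_nodes.2 ⟨e, he, hv⟩, mem_nodes.2 ⟨e, he', hv⟩⟩

/-- Four edge sets, each edge of which lies in at least two of them, that are linked in a chain
have many common nodes. -/
theorem card_nodes_le_of_linked {n d : ℕ} {E : Fin 4 → Finset (Pairs n)}
    (hne : ∀ i, (E i).Nonempty) (hcov : ∀ i, ∀ e ∈ E i, ∃ j ≠ i, e ∈ E j)
    (hd : ∀ i, d ≤ (nodes (E i)).card) (ht : ∀ i, (nodes (E i)).card = d → Biconnected (E i))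
    (h01 : ¬ Disjoint (E 0) (E 1)) (h23 : ¬ Disjoint (E 2) (E 3))
    (hx : ¬ Disjoint (E 0 ∪ E 1) (E 2 ∪ E 3)) :
    (Finset.univ.biUnion fun i => nodes (E i)).card + (2 * d + 2) ≤ ∑ i, (nodes (E i)).card := by
  have := card_biUnion_four_le (V := fun i => nodes (E i)) (d := d) ?_ hd
    (fun i hi => two_le_card_or_subset (ht i hi) (hne i) (hcov i))
    (two_le_card_nodes_inter h01) (two_le_card_nodes_inter h23) ?_
  · omega
  · intro i v hv
    obtain ⟨e, he, hve⟩ := mem_nodes.1 hv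
    obtain ⟨j, hj, hej⟩ := hcov i e he
    exact ⟨j, hj, mem_nodes.2 ⟨e, hej, hve⟩⟩
  · simp only [Finset.disjoint_union_left, Finset.disjoint_union_right] at hx
    by_contra hno
    have key : ∀ p q, (p = 0 ∨ p = 1) → (q = 2 ∨ q = 3) → Disjoint (E p) (E q) := by
      intro p q hp hq
      by_contra h
      exact hno ⟨p, q, hp, hq, two_le_card_nodes_inter h⟩
    exact hx ⟨⟨key 0 2 (by simp) (by simp), key 1 2 (by simp) (by simp)⟩,
      key 0 3 (by simp) (by simp), key 1 3 (by simp) (by simp)⟩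

/-- Every common node outside of `R` is covered twice. -/
theorem card_nodes_sdiff_le {n : ℕ} {E : Fin 4 → Finset (Pairs n)}
    (hcov : ∀ i, ∀ e ∈ E i, ∃ j ≠ i, e ∈ E j) {R : Finset (Fin n)}
    (hR : ∀ i, R ⊆ nodes (E i)) :
    2 * ((Finset.univ.biUnion fun i => nodes (E i)) \ R).card + 4 * R.card
      ≤ ∑ i, (nodes (E i)).card := by
  have h1 : ∀ i, (nodes (E i)).card = (nodes (E i) \ R).card + R.card := fun i =>
    (Finset.card_sdiff_add_card_eq_card (hR i)).symm
  simp only [h1, Finset.sum_add_distrib, Finset.sum_const, Finset.card_univ, Fintype.card_fin,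
    smul_eq_mul]
  refine Nat.add_le_add_right ?_ _
  have h2 : ∀ i, (nodes (E i) \ R).card = ∑ v ∈ (Finset.univ.biUnion fun i => nodes (E i)) \ R,
      if v ∈ nodes (E i) then 1 else 0 := by
    intro i
    rw [← Finset.card_filter]
    congr 1
    ext v
    simp only [Finset.mem_sdiff, Finset.mem_filter, Finset.mem_biUnion, Finset.mem_univ, true_and]
    exact ⟨fun h => ⟨⟨⟨i, h.1⟩, h.2⟩, h.1⟩, fun h => ⟨h.2, h.1.2⟩⟩
  simp only [h2]
  rw [Finset.sum_comm, mul_comm, ← smul_eq_mul, ← Finset.sum_const]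
  refine Finset.sum_le_sum fun v hv => ?_
  rw [← Finset.card_filter]
  obtain ⟨i, -, hi⟩ := Finset.mem_biUnion.1 (Finset.mem_sdiff.1 hv).1
  obtain ⟨e, he, hve⟩ := mem_nodes.1 hi
  obtain ⟨j, hj, hej⟩ := hcov i e he
  exact Finset.one_lt_card.2 ⟨i, by simpa using hi, j,
    by simpa using mem_nodes.2 ⟨e, hej, hve⟩, hj.symm⟩

end Nodes

/-! ### Counting embeddings by the size of their joint image -/

section Counting

lemma exists_subset_range {n u : ℕ} (hn : 0 < n) {S : Finset (Fin n)} (hS : S.card ≤ u) :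
    ∃ c : Fin u → Fin n, ∀ x ∈ S, ∃ i, c i = x := by
  refine ⟨fun i => if h : i.1 < S.card then S.equivFin.symm ⟨i.1, h⟩ else ⟨0, hn⟩,
    fun x hx => ⟨⟨(S.equivFin ⟨x, hx⟩).1, (S.equivFin ⟨x, hx⟩).2.trans_le hS⟩, ?_⟩⟩
  simp

/-- Such a map is encoded by a list of `u` values that exhausts its image outside of `R`, and by a
choice, for each argument, of a list position or an element of `R`. -/
lemma card_filter_image_sdiff_le {J : Type*} [Fintype J] [DecidableEq J] {n : ℕ} (hn : 0 < n)
    (R : Finset (Fin n)) (u : ℕ) :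
    (Finset.univ.filter fun a : J → Fin n => ((Finset.univ.image a) \ R).card ≤ u).card
      ≤ (u + R.card) ^ Fintype.card J * n ^ u := by
  classical
  let F : (Fin u → Fin n) × (J → Fin u ⊕ R) → J → Fin n :=
    fun x j => Sum.elim x.1 (fun r => r.1) (x.2 j)
  have hsub : (Finset.univ.filter fun a : J → Fin n => ((Finset.univ.image a) \ R).card ≤ u)
      ⊆ Finset.univ.image F := by
    intro a ha
    obtain ⟨c, hc⟩ := exists_subset_range hn (Finset.mem_filter.1 ha).2
    have hb : ∀ j, ∃ s : Fin u ⊕ R, Sum.elim c (fun r => r.1) s = a j := by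
      intro j
      by_cases hj : a j ∈ R
      · exact ⟨Sum.inr ⟨a j, hj⟩, rfl⟩
      · obtain ⟨i, hi⟩ := hc (a j) (Finset.mem_sdiff.2
          ⟨Finset.mem_image_of_mem _ (Finset.mem_univ j), hj⟩)
        exact ⟨Sum.inl i, hi⟩
    choose b hb using hb
    exact Finset.mem_image.2 ⟨(c, b), Finset.mem_univ _, funext hb⟩
  refine (Finset.card_le_card hsub).trans (Finset.card_image_le.trans ?_)
  rw [Finset.card_univ, Fintype.card_prod, Fintype.card_fun, Fintype.card_fun, Fintype.card_sum,
    Fintype.card_fin, Fintype.card_fin, Fintype.card_coe, mul_comm]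

/-- The values on the sets `N i` have at most `s - q` distinct points outside of `R`, where `s` is
the sum of the cardinalities; the remaining `4 * k - s` values are free. Together this leaves the
exponent `4 * k - q`. -/
lemma card_embeddings_le {k n : ℕ} (hn : 0 < n) (N : Fin 4 → Finset (Fin k))
    (R : Finset (Fin n)) (hR : R.card ≤ 4) (q : ℕ) :
    (Finset.univ.filter fun α : Fin 4 → (Fin k ↪o Fin n) =>
      ((Finset.univ.biUnion fun i => (N i).image (α i)) \ R).card + q ≤ ∑ i, (N i).card).card
      ≤ (4 * k + 4) ^ (4 * k) * n ^ (4 * k - q) := by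
  classical
  set s := ∑ i, (N i).card with hs
  have hs4 : s ≤ 4 * k := by
    calc s ≤ ∑ _i : Fin 4, k := Finset.sum_le_sum fun i _ => by
          simpa using Finset.card_le_univ (N i)
      _ = 4 * k := by simp
  -- No quadruple qualifies when `s < q`; afterwards the subtractions are not truncated.
  by_cases hq : s < q
  · rw [Finset.filter_false_of_mem fun α _ => by omega]
    simp
  push Not at hq
  let J := {x : Fin 4 × Fin k // x.2 ∈ N x.1}
  let J' := {x : Fin 4 × Fin k // ¬ x.2 ∈ N x.1}
  have hJ : Fintype.card J = s := by
    rw [Fintype.card_subtype, hs, Finset.card_filter, Fintype.sum_prod_type]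
    refine Finset.sum_congr rfl fun i _ => ?_
    simp
  have hJ' : Fintype.card J' = 4 * k - s := by
    rw [Fintype.card_subtype_compl, hJ]
    simp
  let G : (Fin 4 → (Fin k ↪o Fin n)) → (J → Fin n) × (J' → Fin n) :=
    fun α => (fun x => α x.1.1 x.1.2, fun x => α x.1.1 x.1.2)
  have hG : Function.Injective G := by
    intro α β h
    funext i
    ext x : 1
    by_cases hx : x ∈ N i
    · exact congrFun (congrArg Prod.fst h) (⟨(i, x), hx⟩ : J)
    · exact congrFun (congrArg Prod.snd h) (⟨(i, x), hx⟩ : J')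
  have hmaps : ∀ α ∈ Finset.univ.filter (fun α : Fin 4 → (Fin k ↪o Fin n) =>
      ((Finset.univ.biUnion fun i => (N i).image (α i)) \ R).card + q ≤ s),
      G α ∈ (Finset.univ.filter fun a : J → Fin n =>
        ((Finset.univ.image a) \ R).card ≤ s - q) ×ˢ (Finset.univ : Finset (J' → Fin n)) := by
    intro α hα
    refine Finset.mem_product.2 ⟨Finset.mem_filter.2 ⟨Finset.mem_univ _, ?_⟩, Finset.mem_univ _⟩
    have h1 := (Finset.mem_filter.1 hα).2
    have h2 : Finset.univ.image (G α).1 = Finset.univ.biUnion fun i => (N i).image (α i) := by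
      ext v
      simp only [Finset.mem_image, Finset.mem_univ, true_and, Finset.mem_biUnion]
      constructor
      · rintro ⟨⟨⟨i, x⟩, hx⟩, rfl⟩
        exact ⟨i, x, hx, rfl⟩
      · rintro ⟨i, x, hx, rfl⟩
        exact ⟨⟨(i, x), hx⟩, rfl⟩
    rw [h2]
    omega
  refine (Finset.card_le_card_of_injOn G hmaps hG.injOn).trans ?_
  rw [Finset.card_product, Finset.card_univ, Fintype.card_fun, Fintype.card_fin, hJ']
  refine (Nat.mul_le_mul_right _ (card_filter_image_sdiff_le hn R (s - q))).trans ?_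
  rw [hJ, mul_assoc, ← pow_add]
  have e : s - q + (4 * k - s) = 4 * k - q := by omega
  rw [e]
  refine Nat.mul_le_mul_right _ ?_
  calc (s - q + R.card) ^ s ≤ (4 * k + 4) ^ s := Nat.pow_le_pow_left (by omega) s
    _ ≤ (4 * k + 4) ^ (4 * k) := Nat.pow_le_pow_right (by omega) hs4

/-- The edges of the copy of `B` that is placed by `α`. -/
def copyEdges {k n : ℕ} (i : (Fin k ↪o Fin n) × Finset (Pairs k)) : Finset (Pairs n) :=
  i.2.image (Pairs.map i.1.toEmbedding)

lemma nodes_copyEdges {k n : ℕ} (i : (Fin k ↪o Fin n) × Finset (Pairs k)) :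
    nodes (copyEdges i) = (nodes i.2).image i.1 := nodes_image _ _

lemma card_nodes_copyEdges {k n : ℕ} (i : (Fin k ↪o Fin n) × Finset (Pairs k)) :
    (nodes (copyEdges i)).card = (nodes i.2).card := by
  rw [nodes_copyEdges, Finset.card_image_of_injective _ i.1.injective]

lemma card_copyEdges_le {k n : ℕ} (i : (Fin k ↪o Fin n) × Finset (Pairs k)) :
    (copyEdges i).card ≤ Fintype.card (Pairs k) :=
  Finset.card_image_le.trans (Finset.card_le_univ _)

/-- A constant for the number of quadruples of copies. -/
def quadConst (k : ℕ) : ℕ := (2 ^ Fintype.card (Pairs k)) ^ 4 * (4 * k + 4) ^ (4 * k)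

lemma card_quadruples_le {k n : ℕ} (hn : 0 < n) (R : Finset (Fin n)) (hR : R.card ≤ 4) (q : ℕ) :
    (Finset.univ.filter fun f : Fin 4 → (Fin k ↪o Fin n) × Finset (Pairs k) =>
      ((Finset.univ.biUnion fun i => nodes (copyEdges (f i))) \ R).card + q
        ≤ ∑ i, (nodes (copyEdges (f i))).card).card ≤ quadConst k * n ^ (4 * k - q) := by
  classical
  rw [Finset.card_eq_sum_card_fiberwise
    (f := fun (f : Fin 4 → (Fin k ↪o Fin n) × Finset (Pairs k)) i => (f i).2)
    (t := (Finset.univ : Finset (Fin 4 → Finset (Pairs k)))) fun _ _ => Finset.mem_univ _]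
  have h : ∀ B ∈ (Finset.univ : Finset (Fin 4 → Finset (Pairs k))),
      ((Finset.univ.filter fun f : Fin 4 → (Fin k ↪o Fin n) × Finset (Pairs k) =>
        ((Finset.univ.biUnion fun i => nodes (copyEdges (f i))) \ R).card + q
          ≤ ∑ i, (nodes (copyEdges (f i))).card).filter fun f => (fun i => (f i).2) = B).card
        ≤ (4 * k + 4) ^ (4 * k) * n ^ (4 * k - q) := by
    intro B _
    refine le_trans ?_ (card_embeddings_le hn (fun i => nodes (B i)) R hR q)
    refine Finset.card_le_card_of_injOn (fun f i => (f i).1) ?_ ?_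
    · intro f hf
      obtain ⟨hf₁, rfl⟩ := Finset.mem_filter.1 hf
      have := (Finset.mem_filter.1 hf₁).2
      refine Finset.mem_coe.2 (Finset.mem_filter.2 ⟨Finset.mem_univ _, ?_⟩)
      simp only [card_nodes_copyEdges] at this
      simp only [nodes_copyEdges] at this
      exact this
    · intro f hf f' hf' hff
      have h1 := (Finset.mem_filter.1 hf).2
      have h2 := (Finset.mem_filter.1 hf').2
      funext i
      exact Prod.ext (congrFun hff i) (congrFun (h1.trans h2.symm) i)
  refine (Finset.sum_le_sum h).trans (le_of_eq ?_)
  rw [Finset.sum_const, Finset.card_univ, Fintype.card_fun, Fintype.card_finset, Fintype.card_fin,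
    smul_eq_mul, quadConst, mul_assoc]

/-- The nodes of two edges. -/
def pairNodes {n : ℕ} (e e' : Pairs n) : Finset (Fin n) := e.1.toFinset ∪ e'.1.toFinset

lemma card_pairNodes_le {n : ℕ} (e e' : Pairs n) : (pairNodes e e').card ≤ 4 := by
  have h : ∀ e : Pairs n, e.1.toFinset.card ≤ 2 := fun e => by
    obtain ⟨e, he⟩ := e
    induction e using Sym2.ind with
    | _ a b => exact (congrArg _ (Sym2.toFinset_mk_eq)).trans_le Finset.card_le_two
  exact (Finset.card_union_le _ _).trans (Nat.add_le_add (h e) (h e'))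

lemma two_le_card_pairNodes {n : ℕ} (e e' : Pairs n) : 2 ≤ (pairNodes e e').card :=
  (Pairs.two_le_card e).trans (Finset.card_le_card Finset.subset_union_left)

/-- Two edges are recovered from a list of four endpoints that takes `r` distinct values. -/
lemma card_pairs_le {n : ℕ} (hn : 0 < n) (r : ℕ) :
    (Finset.univ.filter fun x : Pairs n × Pairs n => (pairNodes x.1 x.2).card = r).card
      ≤ r ^ 4 * n ^ r := by
  classical
  have h := card_filter_image_sdiff_le (J := Fin 4) hn (∅ : Finset (Fin n)) r
  simp only [Finset.sdiff_empty, Finset.card_empty, add_zero, Fintype.card_fin] at h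
  refine le_trans ?_ h
  have hout : ∀ e : Pairs n, ∃ a : Fin n × Fin n, s(a.1, a.2) = e.1 := fun e =>
    ⟨(Quot.out e.1), Quot.out_eq e.1⟩
  choose o ho using hout
  refine Finset.card_le_card_of_injOn
    (fun x => ![(o x.1).1, (o x.1).2, (o x.2).1, (o x.2).2]) ?_ ?_
  · intro x hx
    have hx := (Finset.mem_filter.1 hx).2
    refine Finset.mem_coe.2 (Finset.mem_filter.2 ⟨Finset.mem_univ _, ?_⟩)
    refine le_trans (Finset.card_le_card ?_) hx.le
    intro v hv
    obtain ⟨i, -, rfl⟩ := Finset.mem_image.1 hv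
    rw [pairNodes, ← ho x.1, ← ho x.2]
    fin_cases i <;> simp [Sym2.toFinset_mk_eq]
  · intro x _ y _ hxy
    have h0 := congrFun hxy 0; have h1 := congrFun hxy 1
    have h2 := congrFun hxy 2; have h3 := congrFun hxy 3
    simp at h0 h1 h2 h3
    refine Prod.ext (Subtype.ext ?_) (Subtype.ext ?_)
    · rw [← ho x.1, ← ho y.1, h0, h1]
    · rw [← ho x.2, ← ho y.2, h2, h3]

/-- For each number `r` of joint nodes, the count `r ^ 4 * n ^ r` cancels the weight. There are five
values of `r` to consider, each contributing at most `4 ^ 4`. -/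
lemma sum_pairs_inv_pow_le {n : ℕ} (hn : 0 < n) :
    ∑ e : Pairs n, ∑ e' : Pairs n, ((n : ℝ) ^ (pairNodes e e').card)⁻¹ ≤ 5 * 4 ^ 4 := by
  rw [← Fintype.sum_prod_type' (f := fun e e' : Pairs n => ((n : ℝ) ^ (pairNodes e e').card)⁻¹)]
  rw [← Finset.sum_fiberwise_of_maps_to (t := Finset.range 5)
    (g := fun x : Pairs n × Pairs n => (pairNodes x.1 x.2).card)
    fun x _ => Finset.mem_range.2 (Nat.lt_succ_of_le (card_pairNodes_le _ _))]
  have hn' : (0 : ℝ) < n := by exact_mod_cast hn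
  have h : ∀ r ∈ Finset.range 5, ∑ x : Pairs n × Pairs n with (pairNodes x.1 x.2).card = r,
      ((n : ℝ) ^ (pairNodes x.1 x.2).card)⁻¹ ≤ 4 ^ 4 := by
    intro r hr
    have h1 : ∑ x : Pairs n × Pairs n with (pairNodes x.1 x.2).card = r,
        ((n : ℝ) ^ (pairNodes x.1 x.2).card)⁻¹
        = ∑ x : Pairs n × Pairs n with (pairNodes x.1 x.2).card = r, ((n : ℝ) ^ r)⁻¹ :=
      Finset.sum_congr rfl fun x hx => by rw [(Finset.mem_filter.1 hx).2]
    rw [h1, Finset.sum_const, nsmul_eq_mul, ← div_eq_mul_inv, div_le_iff₀ (by positivity)]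
    calc _ ≤ ((r ^ 4 * n ^ r : ℕ) : ℝ) := by exact_mod_cast card_pairs_le hn r
      _ ≤ 4 ^ 4 * (n : ℝ) ^ r := by
        push_cast
        have : (r : ℝ) ≤ 4 := by
          have := Finset.mem_range.1 hr
          exact_mod_cast Nat.le_of_lt_succ this
        gcongr
  refine (Finset.sum_le_sum h).trans (le_of_eq ?_)
  simp

end Counting

/-! ### Fourth moments -/

section FourthMoments

variable {Ω : Type*} [MeasurableSpace Ω] {P : Measure Ω} [IsProbabilityMeasure P]

lemma integrable_pow_four {u : Ω → ℝ} (hu : MemLp u 4 P) : Integrable (fun x => u x ^ 4) P := by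
  have h := MemLp.integrable_norm_pow (p := 4) hu (by norm_num)
  refine h.congr (Filter.Eventually.of_forall fun x => ?_)
  simp only [Real.norm_eq_abs]
  exact Even.pow_abs (by decide) (u x)

lemma memLp_two_mul {u v : Ω → ℝ} (hu : MemLp u 4 P) (hv : MemLp v 4 P) :
    MemLp (fun x => u x * v x) 2 P := by
  have hm : AEStronglyMeasurable (fun x => u x * v x) P := hu.1.mul hv.1
  refine (memLp_two_iff_integrable_sq hm).2 ?_
  refine ((integrable_pow_four hu).add (integrable_pow_four hv)).mono' (hm.pow 2)
    (Filter.Eventually.of_forall fun x => ?_)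
  simp only [Pi.add_apply]
  rw [Real.norm_eq_abs, abs_of_nonneg (by positivity)]
  nlinarith [sq_nonneg (u x ^ 2 - v x ^ 2), sq_nonneg (u x ^ 2 + v x ^ 2)]

lemma abs_prod_four_le (a : Fin 4 → ℝ) : |∏ j, a j| ≤ (1 / 4) * ∑ j, a j ^ 4 := by
  rw [Fin.prod_univ_four, Fin.sum_univ_four, abs_le]
  have h1 := sq_nonneg (a 0 ^ 2 - a 1 ^ 2)
  have h2 := sq_nonneg (a 2 ^ 2 - a 3 ^ 2)
  have h3 := sq_nonneg (a 0 * a 1 - a 2 * a 3)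
  have h4 := sq_nonneg (a 0 * a 1 + a 2 * a 3)
  constructor <;> nlinarith

lemma integrable_prod_four {u : Fin 4 → Ω → ℝ} (hu : ∀ j, MemLp (u j) 4 P) :
    Integrable (fun x => ∏ j, u j x) P := by
  have h2 : Integrable (fun x => (1 / 4) * ∑ j, u j x ^ 4) P :=
    (integrable_finsetSum _ fun j _ => integrable_pow_four (hu j)).const_mul _
  refine h2.mono' ?_ (Filter.Eventually.of_forall fun x => abs_prod_four_le _)
  simp only [Fin.prod_univ_four]
  exact (((hu 0).1.mul (hu 1).1).mul (hu 2).1).mul (hu 3).1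

lemma abs_integral_prod_four_le {u : Fin 4 → Ω → ℝ} (hu : ∀ j, MemLp (u j) 4 P) {L : ℝ}
    (hL : ∀ j, ∫ x, u j x ^ 4 ∂P ≤ L) : |∫ x, ∏ j, u j x ∂P| ≤ L := by
  have h2 : Integrable (fun x => (1 / 4) * ∑ j, u j x ^ 4) P :=
    (integrable_finsetSum _ fun j _ => integrable_pow_four (hu j)).const_mul _
  calc |∫ x, ∏ j, u j x ∂P| ≤ ∫ x, |∏ j, u j x| ∂P := abs_integral_le_integral_abs
    _ ≤ ∫ x, (1 / 4) * ∑ j, u j x ^ 4 ∂P :=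
      integral_mono (integrable_prod_four hu).abs h2 fun x => abs_prod_four_le _
    _ = (1 / 4) * ∑ j, ∫ x, u j x ^ 4 ∂P := by
      rw [integral_const_mul, integral_finsetSum _ fun j _ => integrable_pow_four (hu j)]
    _ ≤ (1 / 4) * ∑ _j : Fin 4, L := by
      refine mul_le_mul_of_nonneg_left (Finset.sum_le_sum fun j _ => hL j) (by norm_num)
    _ = L := by simp

lemma sum_pow_four {I : Type*} [Fintype I] (a : I → ℝ) :
    (∑ i, a i) ^ 4 = ∑ f : Fin 4 → I, ∏ j, a (f j) := by
  have := Finset.prod_univ_sum (fun _ : Fin 4 => (Finset.univ : Finset I)) (fun _ i => a i)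
  rw [Finset.prod_const, Finset.card_univ, Fintype.card_fin] at this
  rw [this]
  simp

/-- The variance of a sum of square integrable functions. -/
lemma integral_sq_sum_sub {J : Type*} [Fintype J] {Z : J → Ω → ℝ} (hZ : ∀ q, MemLp (Z q) 2 P) :
    ∫ x, (∑ q, Z q x - ∫ y, ∑ q, Z q y ∂P) ^ 2 ∂P
      = ∑ q, ∑ q', (∫ x, Z q x * Z q' x ∂P - (∫ x, Z q x ∂P) * ∫ x, Z q' x ∂P) := by
  have hi : ∀ q, Integrable (Z q) P := fun q => (hZ q).integrable one_le_two
  rw [integral_finsetSum _ fun q _ => hi q]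
  have hc : ∀ q, MemLp (fun x => Z q x - ∫ y, Z q y ∂P) 2 P := fun q =>
    (hZ q).sub (memLp_const _)
  have h1 : ∀ x, (∑ q, Z q x - ∑ q, ∫ y, Z q y ∂P) ^ 2
      = ∑ q, ∑ q', (Z q x - ∫ y, Z q y ∂P) * (Z q' x - ∫ y, Z q' y ∂P) := by
    intro x
    rw [← Finset.sum_sub_distrib, sq, Finset.sum_mul_sum]
  simp only [h1]
  have hm : ∀ q q', Integrable (fun x => (Z q x - ∫ y, Z q y ∂P) * (Z q' x - ∫ y, Z q' y ∂P)) P :=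
    fun q q' => (hc q).integrable_mul (hc q')
  rw [integral_finsetSum _ fun q _ => integrable_finsetSum _ fun q' _ => hm q q']
  refine Finset.sum_congr rfl fun q _ => ?_
  rw [integral_finsetSum _ fun q' _ => hm q q']
  refine Finset.sum_congr rfl fun q' _ => ?_
  have e : ∀ x, (Z q x - ∫ y, Z q y ∂P) * (Z q' x - ∫ y, Z q' y ∂P)
      = (Z q x * Z q' x - (∫ y, Z q y ∂P) * Z q' x)
        - (Z q x * ∫ y, Z q' y ∂P - (∫ y, Z q y ∂P) * ∫ y, Z q' y ∂P) := fun x => by ring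
  simp only [e]
  have i1 : Integrable (fun x => Z q x * Z q' x) P := (hZ q).integrable_mul (hZ q')
  have i2 : Integrable (fun x => Z q x * Z q' x - (∫ y, Z q y ∂P) * Z q' x) P :=
    i1.sub ((hi q').const_mul _)
  have i3 : Integrable (fun x => Z q x * ∫ y, Z q' y ∂P
      - (∫ y, Z q y ∂P) * ∫ y, Z q' y ∂P) P := ((hi q).mul_const _).sub (integrable_const _)
  rw [integral_sub i2 i3, integral_sub i1 ((hi q').const_mul _), integral_sub ((hi q).mul_const _) (integrable_const _),
    integral_const_mul, integral_mul_const]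
  simp

end FourthMoments

/-! ### Families of degenerate functions -/

section Family

variable {ι I 𝒴 : Type*} [Fintype ι] [DecidableEq ι] [Fintype I] [MeasurableSpace 𝒴]
  {ν : Measure 𝒴} [IsProbabilityMeasure ν]

/-- A family of functions of independent variables, of which the `i`-th depends on the
coordinates in `E i`, vanishes when any one of these is integrated out, and has fourth moment at
most `K`. -/
structure IsDegenerateFamily (ν : Measure 𝒴) (φ : I → (ι → 𝒴) → ℝ) (E : I → Finset ι) (K : ℝ) :
    Prop where
  measurable : ∀ i, Measurable (φ i)
  memLp : ∀ i, MemLp (φ i) 4 (Measure.pi fun _ => ν)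
  integral_le : ∀ i, ∫ y, φ i y ^ 4 ∂(Measure.pi fun _ => ν) ≤ K
  dependsOn : ∀ i, DependsOn (φ i) (E i : Set ι)
  centered : ∀ i, ∀ b ∈ E i, Centered ν (φ i) b
  nonempty : ∀ i, (E i).Nonempty

/-- Every element of the four sets lies in at least two of them. -/
def Covered (E : I → Finset ι) (f : Fin 4 → I) : Prop :=
  ∀ i, ∀ e ∈ E (f i), ∃ j ≠ i, e ∈ E (f j)

/-- The change of `φ i` when the coordinate `e` is replaced by an independent copy. -/
def diffAt (φ : I → (ι → 𝒴) → ℝ) (i : I) (e : ι) (x : ι → 𝒴 × 𝒴) : ℝ :=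
  φ i (firsts x) - φ i (firsts (swapAt e x))

variable {φ : I → (ι → 𝒴) → ℝ} {E : I → Finset ι} {K : ℝ}

lemma diffAt_swapAt (i : I) (e : ι) (x : ι → 𝒴 × 𝒴) :
    diffAt φ i e (swapAt e x) = -diffAt φ i e x := by
  simp only [diffAt, swapAt_swapAt]; ring

lemma firsts_swapAt (e : ι) (x : ι → 𝒴 × 𝒴) :
    firsts (swapAt e x) = fun j => (if j = e then Prod.snd else Prod.fst) (x j) := by
  funext j
  unfold firsts swapAt
  split_ifs <;> simp

namespace IsDegenerateFamily

variable (h : IsDegenerateFamily ν φ E K)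
include h

lemma memLp_firsts (i : I) :
    MemLp (fun x => φ i (firsts x)) 4 (Measure.pi fun _ : ι => ν.prod ν) :=
  (h.memLp i).comp_measurePreserving measurePreserving_firsts

lemma memLp_firsts_swapAt (i : I) (e : ι) :
    MemLp (fun x => φ i (firsts (swapAt e x))) 4 (Measure.pi fun _ : ι => ν.prod ν) :=
  (h.memLp_firsts i).comp_measurePreserving (measurePreserving_swapAt e)

lemma memLp_diffAt (i : I) (e : ι) :
    MemLp (diffAt φ i e) 4 (Measure.pi fun _ : ι => ν.prod ν) :=
  (h.memLp_firsts i).sub (h.memLp_firsts_swapAt i e)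

lemma measurable_firsts (i : I) : Measurable (fun x : ι → 𝒴 × 𝒴 => φ i (firsts x)) :=
  (h.measurable i).comp (measurePreserving_firsts (ν := ν)).measurable

lemma measurable_diffAt (i : I) (e : ι) : Measurable (diffAt φ i e) :=
  (h.measurable_firsts i).sub
    ((h.measurable_firsts i).comp (measurePreserving_swapAt (ν := ν) e).measurable)

/-- From `(a - b) ^ 4 ≤ 8 * a ^ 4 + 8 * b ^ 4`, as resampling preserves the law. -/
lemma integral_diffAt_le (i : I) (e : ι) :
    ∫ x, diffAt φ i e x ^ 4 ∂(Measure.pi fun _ : ι => ν.prod ν) ≤ 16 * K := by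
  have i1 := integrable_pow_four (h.memLp_firsts i)
  have i2 := integrable_pow_four (h.memLp_firsts_swapAt i e)
  have e1 : ∫ x, φ i (firsts x) ^ 4 ∂(Measure.pi fun _ : ι => ν.prod ν) ≤ K :=
    (integral_comp_of_measurePreserving measurePreserving_firsts
      (φ := fun y => φ i y ^ 4) ((h.measurable i).pow_const 4).aestronglyMeasurable).trans_le
      (h.integral_le i)
  have e2 : ∫ x, φ i (firsts (swapAt e x)) ^ 4 ∂(Measure.pi fun _ : ι => ν.prod ν) ≤ K :=
    (integral_comp_of_measurePreserving (measurePreserving_swapAt e)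
      (φ := fun x => φ i (firsts x) ^ 4) i1.aestronglyMeasurable).trans_le e1
  have : ∫ x, diffAt φ i e x ^ 4 ∂(Measure.pi fun _ : ι => ν.prod ν)
      ≤ ∫ x, (8 * φ i (firsts x) ^ 4 + 8 * φ i (firsts (swapAt e x)) ^ 4)
        ∂(Measure.pi fun _ : ι => ν.prod ν) := by
    refine integral_mono (integrable_pow_four (h.memLp_diffAt i e))
      ((i1.const_mul _).add (i2.const_mul _)) fun x => ?_
    simp only [diffAt]
    generalize φ i (firsts x) = a
    generalize φ i (firsts (swapAt e x)) = b
    nlinarith [sq_nonneg (a + b), sq_nonneg (a ^ 2 - b ^ 2), sq_nonneg (a - b),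
      mul_nonneg (sq_nonneg (a + b)) (sq_nonneg (a + b)),
      mul_nonneg (sq_nonneg (a + b)) (sq_nonneg (a - b))]
  rw [integral_add (i1.const_mul _) (i2.const_mul _), integral_const_mul,
    integral_const_mul] at this
  linarith

lemma dependsOn_firsts (i : I) :
    DependsOn (fun x : ι → 𝒴 × 𝒴 => φ i (firsts x)) (E i : Set ι) :=
  dependsOn_comp_coordinatewise (p := fun _ => Prod.fst) (h.dependsOn i)

lemma dependsOn_diffAt (i : I) (e : ι) : DependsOn (diffAt φ i e) (E i : Set ι) := by
  intro x y hxy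
  have h1 := h.dependsOn_firsts i hxy
  have h2 := dependsOn_comp_coordinatewise
    (p := fun j => if j = e then (Prod.snd : 𝒴 × 𝒴 → 𝒴) else Prod.fst) (h.dependsOn i) hxy
  simp only [diffAt, firsts_swapAt] at h1 h2 ⊢
  rw [h1, h2]

lemma diffAt_eq_zero {i : I} {e : ι} (he : e ∉ E i) (x : ι → 𝒴 × 𝒴) : diffAt φ i e x = 0 :=
  sub_eq_zero.2 (swapAt_eq_of_dependsOn (h.dependsOn_firsts i) (by simpa using he) x).symm

lemma diffAt_swapAt_of_notMem {i : I} {e e' : ι} (he : e' ∉ E i) (x : ι → 𝒴 × 𝒴) :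
    diffAt φ i e (swapAt e' x) = diffAt φ i e x :=
  swapAt_eq_of_dependsOn (h.dependsOn_diffAt i e) (by simpa using he) x

lemma centered_diffAt (i : I) (e : ι) {b : ι} (hb : b ∈ E i) :
    Centered (ν.prod ν) (diffAt φ i e) b := by
  refine Centered.sub ?_ ?_ ((h.memLp_firsts i).integrable (by norm_num))
    ((h.memLp_firsts_swapAt i e).integrable (by norm_num))
  · exact Centered.comp_coordinatewise (p := fun _ => Prod.fst)
      (fun _ => measurePreserving_fst) (h.measurable i) (h.centered i b hb)
  · simp only [firsts_swapAt]
    refine Centered.comp_coordinatewise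
      (p := fun j => if j = e then (Prod.snd : 𝒴 × 𝒴 → 𝒴) else Prod.fst)
      (fun j => ?_) (h.measurable i) (h.centered i b hb)
    split_ifs
    · exact measurePreserving_snd
    · exact measurePreserving_fst

/-- Some coordinate belongs to a single one of the four sets: that factor is centered in it and the
other three do not depend on it. -/
lemma integral_prod_eq_zero {f : Fin 4 → I} (e : Fin 4 → ι) (hf : ¬ Covered E f) :
    ∫ x, ∏ j, diffAt φ (f j) (e j) x ∂(Measure.pi fun _ : ι => ν.prod ν) = 0 := by
  simp only [Covered, not_forall, not_exists, not_and] at hf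
  obtain ⟨i, b, hb, hno⟩ := hf
  have e1 : ∀ x, ∏ j, diffAt φ (f j) (e j) x
      = diffAt φ (f i) (e i) x * ∏ j ∈ Finset.univ.erase i, diffAt φ (f j) (e j) x := fun x =>
    (Finset.mul_prod_erase _ _ (Finset.mem_univ i)).symm
  have hi := integrable_prod_four (fun j => h.memLp_diffAt (f j) (e j))
  simp only [e1] at hi ⊢
  refine (h.centered_diffAt (f i) (e i) hb).integral_mul_eq_zero (S := {b}ᶜ) ?_ (by simp) hi
  intro x y hxy
  refine Finset.prod_congr rfl fun j hj => h.dependsOn_diffAt (f j) (e j) fun c hc => hxy c ?_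
  rintro rfl
  exact hno j (Finset.ne_of_mem_erase hj) hc

lemma integral_mul_eq_zero {i j : I} (e e' : ι) {b : ι} (hi : b ∈ E i) (hj : b ∉ E j) :
    ∫ x, diffAt φ i e x * diffAt φ j e' x ∂(Measure.pi fun _ : ι => ν.prod ν) = 0 :=
  (h.centered_diffAt i e hi).integral_mul_eq_zero (h.dependsOn_diffAt j e') (by simpa using hj)
    (((h.memLp_diffAt i e).mono_exponent (p := 2) (by norm_num)).integrable_mul
      ((h.memLp_diffAt j e').mono_exponent (p := 2) (by norm_num)))

open Classical in
-- Expand the fourth power into quadruples. Only the covered ones whose members all depend on `e`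
-- and have nonzero coefficients survive, and each contributes at most `16 * K`.
lemma integral_sum_pow_four_le {a : I → ℝ} (ha : ∀ i, |a i| ≤ 1) (e : ι) :
    ∫ x, (∑ i, a i * diffAt φ i e x) ^ 4 ∂(Measure.pi fun _ : ι => ν.prod ν)
      ≤ 16 * K * (Finset.univ.filter fun f : Fin 4 → I =>
        Covered E f ∧ ∀ j, a (f j) ≠ 0 ∧ e ∈ E (f j)).card := by
  have hint : ∀ f : Fin 4 → I, Integrable (fun x => ∏ j, (a (f j) * diffAt φ (f j) e x))
      (Measure.pi fun _ : ι => ν.prod ν) := fun f =>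
    integrable_prod_four fun j => (h.memLp_diffAt (f j) e).const_mul _
  simp only [sum_pow_four]
  rw [integral_finsetSum _ fun f _ => hint f, Finset.card_filter]
  push_cast
  rw [Finset.mul_sum]
  refine Finset.sum_le_sum fun f _ => ?_
  have e1 : ∀ x, ∏ j, (a (f j) * diffAt φ (f j) e x)
      = (∏ j, a (f j)) * ∏ j, diffAt φ (f j) e x := fun x => Finset.prod_mul_distrib
  simp only [e1]
  rw [integral_const_mul]
  split_ifs with hf
  · have h1 : |∏ j, a (f j)| ≤ 1 := by
      rw [Finset.abs_prod]
      exact Finset.prod_le_one (fun j _ => abs_nonneg _) fun j _ => ha _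
    have h2 := abs_integral_prod_four_le (fun j => h.memLp_diffAt (f j) e)
      (fun j => h.integral_diffAt_le (f j) e)
    rw [mul_one]
    refine (le_abs_self _).trans ?_
    rw [abs_mul]
    calc _ ≤ 1 * |∫ x, ∏ j, diffAt φ (f j) e x ∂(Measure.pi fun _ : ι => ν.prod ν)| :=
          mul_le_mul_of_nonneg_right h1 (abs_nonneg _)
      _ ≤ _ := by rw [one_mul]; exact h2
  · rw [mul_zero]
    refine le_of_eq ?_
    by_cases hc : Covered E f
    · simp only [hc, true_and, not_forall] at hf
      obtain ⟨j, hj⟩ := hf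
      by_cases haj : a (f j) = 0
      · rw [Finset.prod_eq_zero (Finset.mem_univ j) haj, zero_mul]
      · have hej : e ∉ E (f j) := fun he => hj ⟨haj, he⟩
        have : ∀ x, ∏ j, diffAt φ (f j) e x = 0 := fun x =>
          Finset.prod_eq_zero (Finset.mem_univ j) (h.diffAt_eq_zero hej x)
        simp [this]
    · rw [h.integral_prod_eq_zero (fun _ => e) hc, mul_zero]

end IsDegenerateFamily

end Family

/-! ### Second moments of the two Stein errors. -/

section Family

variable {ι I 𝒴 : Type*} [Fintype ι] [DecidableEq ι] [Fintype I] [MeasurableSpace 𝒴]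
  {ν : Measure 𝒴} [IsProbabilityMeasure ν]
  {φ : I → (ι → 𝒴) → ℝ} {E : I → Finset ι} {K : ℝ}

/-- A linear combination of the changes at the coordinate `e`. -/
noncomputable def lin (φ : I → (ι → 𝒴) → ℝ) (a : I → ℝ) (e : ι) (x : ι → 𝒴 × 𝒴) : ℝ :=
  ∑ i, a i * diffAt φ i e x

/-- The coefficients `a`, restricted to the members that do not depend on `e`. -/
def avoid (E : I → Finset ι) (e : ι) (a : I → ℝ) (i : I) : ℝ := if e ∈ E i then 0 else a i

/-- The linking condition that a quadruple needs for contributing to the variance. -/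
def Linked (E : I → Finset ι) (f : Fin 4 → I) : Prop :=
  Covered E f ∧ ¬ Disjoint (E (f 0)) (E (f 1)) ∧ ¬ Disjoint (E (f 2)) (E (f 3)) ∧
    ¬ Disjoint (E (f 0) ∪ E (f 1)) (E (f 2) ∪ E (f 3))

open Classical in
/-- The number of covered quadruples of members that depend on both `e` and `e'`. -/
noncomputable def pairCount (E : I → Finset ι) (e e' : ι) : ℕ :=
  (Finset.univ.filter fun f : Fin 4 → I =>
    Covered E f ∧ ∀ j, e ∈ E (f j) ∧ e' ∈ E (f j)).card

open Classical in
/-- The number of linked quadruples. -/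
noncomputable def linkedCount (E : I → Finset ι) : ℕ :=
  (Finset.univ.filter fun f : Fin 4 → I => Linked E f).card

lemma avoid_abs_le {a : I → ℝ} (ha : ∀ i, |a i| ≤ 1) (e : ι) (i : I) : |avoid E e a i| ≤ 1 := by
  unfold avoid; split_ifs
  · simp
  · exact ha i

lemma lin_swapAt (a : I → ℝ) (e : ι) (x : ι → 𝒴 × 𝒴) :
    lin φ a e (swapAt e x) = -lin φ a e x := by
  simp [lin, diffAt_swapAt, Finset.sum_neg_distrib]

namespace IsDegenerateFamily

variable (h : IsDegenerateFamily ν φ E K)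
include h

lemma memLp_lin (a : I → ℝ) (e : ι) :
    MemLp (lin φ a e) 4 (Measure.pi fun _ : ι => ν.prod ν) := by
  unfold lin
  exact memLp_finsetSum _ fun i _ => (h.memLp_diffAt i e).const_mul _

lemma lin_avoid_swapAt (a : I → ℝ) (e e' : ι) (x : ι → 𝒴 × 𝒴) :
    lin φ (avoid E e' a) e (swapAt e' x) = lin φ (avoid E e' a) e x := by
  refine Finset.sum_congr rfl fun i _ => ?_
  unfold avoid
  split_ifs with he
  · simp
  · rw [h.diffAt_swapAt_of_notMem he]

open Classical in
lemma integral_lin_pow_four_le {a : I → ℝ} (ha : ∀ i, |a i| ≤ 1) (e : ι) (hK : 0 ≤ K) :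
    ∫ x, lin φ a e x ^ 4 ∂(Measure.pi fun _ : ι => ν.prod ν) ≤ 16 * K * pairCount E e e := by
  refine (h.integral_sum_pow_four_le ha e).trans ?_
  refine mul_le_mul_of_nonneg_left ?_ (by positivity)
  exact_mod_cast Finset.card_le_card fun f hf => by
    simp only [Finset.mem_filter, Finset.mem_univ, true_and] at hf ⊢
    exact ⟨hf.1, fun j => ⟨(hf.2 j).2, (hf.2 j).2⟩⟩

open Classical in
lemma integral_lin_sub_pow_four_le {a : I → ℝ} (ha : ∀ i, |a i| ≤ 1) (e e' : ι) (hK : 0 ≤ K) :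
    ∫ x, (lin φ a e x - lin φ (avoid E e' a) e x) ^ 4 ∂(Measure.pi fun _ : ι => ν.prod ν)
      ≤ 16 * K * pairCount E e e' := by
  have e1 : ∀ x, lin φ a e x - lin φ (avoid E e' a) e x
      = ∑ i, (a i - avoid E e' a i) * diffAt φ i e x := fun x => by
    simp only [lin, ← Finset.sum_sub_distrib, sub_mul]
  simp only [e1]
  refine (h.integral_sum_pow_four_le (a := fun i => a i - avoid E e' a i) (fun i => ?_) e).trans ?_
  · unfold avoid
    split_ifs
    · simpa using ha i
    · simp
  refine mul_le_mul_of_nonneg_left ?_ (by positivity)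
  exact_mod_cast Finset.card_le_card fun f hf => by
    simp only [Finset.mem_filter, Finset.mem_univ, true_and] at hf ⊢
    refine ⟨hf.1, fun j => ⟨(hf.2 j).2, ?_⟩⟩
    by_contra hno
    exact (hf.2 j).1 (by simp [avoid, hno])

omit h in
-- A product rule for differences, followed by the weighted inequality `2 u² v² ≤ t u⁴ + t⁻¹ v⁴`.
-- The weight `t` balances the small increments against the full terms and is chosen in
-- `abs_sub_ncdf_le_of_copies`.
lemma sq_sub_le {F F' D D' t : ℝ} (ht : 0 < t) :
    (|F| * D - |F'| * D') ^ 2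
      ≤ t * (F - F') ^ 4 + t⁻¹ * D ^ 4 + (t⁻¹ * F' ^ 4 + t * (D - D') ^ 4) := by
  have amgm : ∀ u v : ℝ, 2 * (u ^ 2 * v ^ 2) ≤ t * u ^ 4 + t⁻¹ * v ^ 4 := by
    intro u v
    have h1 := mul_nonneg (inv_nonneg.2 ht.le) (sq_nonneg (t * u ^ 2 - v ^ 2))
    have h2 : t⁻¹ * (t * u ^ 2 - v ^ 2) ^ 2
        = t * u ^ 4 + t⁻¹ * v ^ 4 - 2 * (u ^ 2 * v ^ 2) := by
      field_simp; ring
    linarith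
  have hF : (|F| - |F'|) ^ 2 ≤ (F - F') ^ 2 := by
    rw [← sq_abs (F - F')]
    exact sq_le_sq' (by linarith [abs_sub_abs_le_abs_sub F' F, abs_sub_comm F F'])
      (abs_sub_abs_le_abs_sub F F')
  have e1 : |F| * D - |F'| * D' = (|F| - |F'|) * D + |F'| * (D - D') := by ring
  have h3 := amgm (F - F') D
  have h4 := amgm (D - D') F'
  have h5 : ((|F| - |F'|) * D + |F'| * (D - D')) ^ 2
      ≤ 2 * ((|F| - |F'|) ^ 2 * D ^ 2) + 2 * (|F'| ^ 2 * (D - D') ^ 2) := by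
    nlinarith [sq_nonneg ((|F| - |F'|) * D - |F'| * (D - D'))]
  have h6 := mul_le_mul_of_nonneg_right hF (sq_nonneg D)
  rw [sq_abs] at h5
  rw [e1]
  linarith

/-- The second moment of the sum of the antisymmetric products. -/
theorem integral_sum_abs_mul_sq_le {a b : I → ℝ} (ha : ∀ i, |a i| ≤ 1) (hb : ∀ i, |b i| ≤ 1)
    (hK : 0 ≤ K) (t : ι → ι → ℝ) (ht : ∀ e e', 0 < t e e') :
    ∫ x, (∑ e, |lin φ a e x| * lin φ b e x) ^ 2 ∂(Measure.pi fun _ : ι => ν.prod ν)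
      ≤ ∑ e, ∑ e', 32 * K * (t e e' * pairCount E e e' + (t e e')⁻¹ * pairCount E e e) := by
  set M := Measure.pi fun _ : ι => ν.prod ν with hM
  let G : ι → (ι → 𝒴 × 𝒴) → ℝ := fun e x => |lin φ a e x| * lin φ b e x
  -- `G' e e'` omits the members that depend on `e'`: it is invariant under the swap at `e'` and
  -- still antisymmetric under the swap at `e`.
  let G' : ι → ι → (ι → 𝒴 × 𝒴) → ℝ := fun e e' x =>
    |lin φ (avoid E e' a) e x| * lin φ (avoid E e' b) e x
  have mG : ∀ e, MemLp (G e) 2 M := fun e => memLp_two_mul (h.memLp_lin a e).abs (h.memLp_lin b e)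
  have mG' : ∀ e e', MemLp (G' e e') 2 M := fun e e' =>
    memLp_two_mul (h.memLp_lin _ e).abs (h.memLp_lin _ e)
  have mD : ∀ e e', MemLp (fun x => G e x - G' e e' x) 2 M := fun e e' => (mG e).sub (mG' e e')
  have anti : ∀ e x, G e (swapAt e x) = -G e x := by
    intro e x; simp only [G, lin_swapAt, abs_neg]; ring
  have anti' : ∀ e e' x, G' e e' (swapAt e x) = -G' e e' x := by
    intro e x; simp only [G', lin_swapAt, abs_neg]; intros; ring
  have inv' : ∀ e e' x, G' e e' (swapAt e' x) = G' e e' x := by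
    intro e e' x; simp only [G', h.lin_avoid_swapAt]
  have zero : ∀ (e : ι) (u v : (ι → 𝒴 × 𝒴) → ℝ), MemLp u 2 M → MemLp v 2 M →
      (∀ x, u (swapAt e x) = u x) → (∀ x, v (swapAt e x) = -v x) → ∫ x, u x * v x ∂M = 0 := by
    intro e u v hu hv h1 h2
    have hi : Integrable (fun x => u x * v x) M := hu.integrable_mul hv
    have := integral_comp_of_measurePreserving (measurePreserving_swapAt (ν := ν) e)
      (φ := fun x => u x * v x) hi.aestronglyMeasurable
    simp only [h1, h2, mul_neg, integral_neg] at this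
    linarith
  -- Each product with a `G'` factor is odd under one of the two swaps and integrates to zero. So
  -- both factors may be replaced by what involves both `e` and `e'`.
  have cross : ∀ e e', ∫ x, G e x * G e' x ∂M
      = ∫ x, (G e x - G' e e' x) * (G e' x - G' e' e x) ∂M := by
    intro e e'
    have z1 : ∫ x, G' e e' x * G e' x ∂M = 0 :=
      zero e' _ _ (mG' e e') (mG e') (inv' e e') (anti e')
    have z2 : ∫ x, G' e' e x * G e x ∂M = 0 :=
      zero e _ _ (mG' e' e) (mG e) (inv' e' e) (anti e)
    have z3 : ∫ x, G' e e' x * G' e' e x ∂M = 0 :=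
      zero e' _ _ (mG' e e') (mG' e' e) (inv' e e') (anti' e' e)
    have i0 : Integrable (fun x => G e x * G e' x) M := (mG e).integrable_mul (mG e')
    have i1 : Integrable (fun x => G' e e' x * G e' x) M := (mG' e e').integrable_mul (mG e')
    have i2 : Integrable (fun x => G' e' e x * G e x) M := (mG' e' e).integrable_mul (mG e)
    have i3 : Integrable (fun x => G' e e' x * G' e' e x) M :=
      (mG' e e').integrable_mul (mG' e' e)
    have e1 : ∀ x, (G e x - G' e e' x) * (G e' x - G' e' e x)
        = (G e x * G e' x - G' e e' x * G e' x)
          - (G' e' e x * G e x - G' e e' x * G' e' e x) := fun x => by ring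
    have i01 : Integrable (fun x => G e x * G e' x - G' e e' x * G e' x) M := i0.sub i1
    have i23 : Integrable (fun x => G' e' e x * G e x - G' e e' x * G' e' e x) M := i2.sub i3
    simp only [e1]
    rw [integral_sub i01 i23, integral_sub i0 i1, integral_sub i2 i3, z1, z2, z3]
    ring
  have sqb : ∀ e e', ∫ x, (G e x - G' e e' x) ^ 2 ∂M
      ≤ 32 * K * (t e e' * pairCount E e e' + (t e e')⁻¹ * pairCount E e e) := by
    intro e e'
    have j1 : Integrable (fun x => t e e' * (lin φ a e x - lin φ (avoid E e' a) e x) ^ 4) M :=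
      (integrable_pow_four ((h.memLp_lin a e).sub (h.memLp_lin (avoid E e' a) e))).const_mul _
    have j2 : Integrable (fun x => (t e e')⁻¹ * lin φ b e x ^ 4) M :=
      (integrable_pow_four (h.memLp_lin b e)).const_mul _
    have j3 : Integrable (fun x => (t e e')⁻¹ * lin φ (avoid E e' a) e x ^ 4) M :=
      (integrable_pow_four (h.memLp_lin _ e)).const_mul _
    have j4 : Integrable (fun x => t e e' * (lin φ b e x - lin φ (avoid E e' b) e x) ^ 4) M :=
      (integrable_pow_four ((h.memLp_lin b e).sub (h.memLp_lin (avoid E e' b) e))).const_mul _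
    have j12 : Integrable (fun x => t e e' * (lin φ a e x - lin φ (avoid E e' a) e x) ^ 4
      + (t e e')⁻¹ * lin φ b e x ^ 4) M := j1.add j2
    have j34 : Integrable (fun x => (t e e')⁻¹ * lin φ (avoid E e' a) e x ^ 4
      + t e e' * (lin φ b e x - lin φ (avoid E e' b) e x) ^ 4) M := j3.add j4
    have h1 : ∫ x, (G e x - G' e e' x) ^ 2 ∂M
        ≤ ∫ x, (t e e' * (lin φ a e x - lin φ (avoid E e' a) e x) ^ 4
          + (t e e')⁻¹ * lin φ b e x ^ 4
          + ((t e e')⁻¹ * lin φ (avoid E e' a) e x ^ 4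
            + t e e' * (lin φ b e x - lin φ (avoid E e' b) e x) ^ 4)) ∂M :=
      integral_mono ((memLp_two_iff_integrable_sq (mD e e').1).1 (mD e e')) (j12.add j34)
        fun x => sq_sub_le (ht e e')
    rw [integral_add j12 j34, integral_add j1 j2, integral_add j3 j4, integral_const_mul,
      integral_const_mul, integral_const_mul, integral_const_mul] at h1
    have b1 := mul_le_mul_of_nonneg_left (h.integral_lin_sub_pow_four_le ha e e' hK) (ht e e').le
    have b2 := mul_le_mul_of_nonneg_left (h.integral_lin_pow_four_le hb e hK)
      (inv_nonneg.2 (ht e e').le)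
    have b3 := mul_le_mul_of_nonneg_left (h.integral_lin_pow_four_le
      (avoid_abs_le (E := E) ha e') e hK) (inv_nonneg.2 (ht e e').le)
    have b4 := mul_le_mul_of_nonneg_left (h.integral_lin_sub_pow_four_le hb e e' hK) (ht e e').le
    linarith
  have hsq : ∀ x, (∑ e, |lin φ a e x| * lin φ b e x) ^ 2 = ∑ e, ∑ e', G e x * G e' x := by
    intro x; rw [sq, Finset.sum_mul_sum]
  have iGG : ∀ e e', Integrable (fun x => G e x * G e' x) M := fun e e' =>
    (mG e).integrable_mul (mG e')
  simp only [hsq]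
  rw [integral_finsetSum _ fun e _ => integrable_finsetSum _ fun e' _ => iGG e e']
  have step : ∀ e e', ∫ x, G e x * G e' x ∂M
      ≤ (1 / 2) * ∫ x, (G e x - G' e e' x) ^ 2 ∂M
        + (1 / 2) * ∫ x, (G e' x - G' e' e x) ^ 2 ∂M := by
    intro e e'
    have q1 := (memLp_two_iff_integrable_sq (mD e e').1).1 (mD e e')
    have q2 := (memLp_two_iff_integrable_sq (mD e' e).1).1 (mD e' e)
    rw [cross, ← integral_const_mul, ← integral_const_mul,
      ← integral_add (q1.const_mul _) (q2.const_mul _)]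
    refine integral_mono ((mD e e').integrable_mul (mD e' e))
      ((q1.const_mul _).add (q2.const_mul _)) fun x => ?_
    simp only
    nlinarith [sq_nonneg ((G e x - G' e e' x) - (G e' x - G' e' e x))]
  calc ∑ e, ∫ x, ∑ e', G e x * G e' x ∂M = ∑ e, ∑ e', ∫ x, G e x * G e' x ∂M :=
        Finset.sum_congr rfl fun e _ => integral_finsetSum _ fun e' _ => iGG e e'
    _ ≤ ∑ e, ∑ e', ((1 / 2) * ∫ x, (G e x - G' e e' x) ^ 2 ∂M
        + (1 / 2) * ∫ x, (G e' x - G' e' e x) ^ 2 ∂M) :=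
        Finset.sum_le_sum fun e _ => Finset.sum_le_sum fun e' _ => step e e'
    _ = ∑ e, ∑ e', ∫ x, (G e x - G' e e' x) ^ 2 ∂M := by
        simp only [Finset.sum_add_distrib, ← Finset.mul_sum]
        rw [Finset.sum_comm (f := fun e e' => ∫ x, (G e' x - G' e' e x) ^ 2 ∂M)]
        ring
    _ ≤ _ := Finset.sum_le_sum fun e _ => Finset.sum_le_sum fun e' _ => sqb e e'

open Classical in
/-- The variance of the sum of the products of changes. -/
theorem integral_sum_mul_sub_sq_le {a : I → ℝ} (ha : ∀ i, |a i| ≤ 1) (hK : 0 ≤ K) {m : ℕ}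
    (hm : ∀ i, (E i).card ≤ m) :
    ∫ x, (∑ e, lin φ a e x * lin φ (fun _ => 1) e x
      - ∫ y, ∑ e, lin φ a e y * lin φ (fun _ => 1) e y ∂(Measure.pi fun _ : ι => ν.prod ν)) ^ 2
      ∂(Measure.pi fun _ : ι => ν.prod ν) ≤ 32 * K * (linkedCount E * m ^ 2) := by
  set M := Measure.pi fun _ : ι => ν.prod ν with hM
  let Z : ι × I × I → (ι → 𝒴 × 𝒴) → ℝ := fun q x =>
    a q.2.1 * (diffAt φ q.2.1 q.1 x * diffAt φ q.2.2 q.1 x)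
  have hsum : ∀ x, ∑ e, lin φ a e x * lin φ (fun _ => 1) e x = ∑ q, Z q x := by
    intro x
    rw [Fintype.sum_prod_type]
    refine Finset.sum_congr rfl fun e _ => ?_
    rw [Fintype.sum_prod_type, lin, lin, Finset.sum_mul_sum]
    refine Finset.sum_congr rfl fun i _ => Finset.sum_congr rfl fun j _ => ?_
    simp only [Z]; ring
  simp only [hsum]
  have hDD : ∀ i j e, MemLp (fun x => diffAt φ i e x * diffAt φ j e x) 2 M := fun i j e =>
    memLp_two_mul (h.memLp_diffAt i e) (h.memLp_diffAt j e)
  have hZ : ∀ q, MemLp (Z q) 2 M := fun q => (hDD _ _ _).const_mul _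
  rw [integral_sq_sum_sub hZ]
  -- Only these pairs of summands have a covariance that need not vanish.
  let good : (ι × I × I) × (ι × I × I) → Prop := fun p =>
    Linked E ![p.1.2.1, p.1.2.2, p.2.2.1, p.2.2.2] ∧ p.1.1 ∈ E p.1.2.1 ∧ p.2.1 ∈ E p.2.2.1
  have zeroL : ∀ (q : ι × I × I), ¬ (q.1 ∈ E q.2.1 ∧ q.1 ∈ E q.2.2) → ∀ x, Z q x = 0 := by
    intro q hq x
    simp only [Z]
    by_cases h1 : q.1 ∈ E q.2.1
    · rw [h.diffAt_eq_zero (fun h2 => hq ⟨h1, h2⟩)]; simp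
    · rw [h.diffAt_eq_zero h1]; simp
  -- The squared mean is at most the second moment. With the same bound for the mixed moment, a
  -- covariance is at most `32 * K`.
  have second : ∀ q, (∫ x, Z q x ∂M) ^ 2 ≤ 16 * K := by
    intro q
    have hv := variance_nonneg (Z q) M
    rw [variance_eq_sub (hZ q)] at hv
    have i1 := integrable_pow_four (h.memLp_diffAt q.2.1 q.1)
    have i2 := integrable_pow_four (h.memLp_diffAt q.2.2 q.1)
    have h2 : ∫ x, (Z q ^ 2) x ∂M ≤ ∫ x, ((1 / 2) * diffAt φ q.2.1 q.1 x ^ 4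
        + (1 / 2) * diffAt φ q.2.2 q.1 x ^ 4) ∂M := by
      refine integral_mono ((memLp_two_iff_integrable_sq (hZ q).1).1 (hZ q))
        ((i1.const_mul _).add (i2.const_mul _)) fun x => ?_
      simp only [Pi.pow_apply, Z]
      have h3 : a q.2.1 ^ 2 ≤ 1 := (sq_le_one_iff_abs_le_one _).2 (ha _)
      generalize diffAt φ q.2.1 q.1 x = u
      generalize diffAt φ q.2.2 q.1 x = v
      have h4 := mul_le_mul_of_nonneg_right h3 (sq_nonneg (u * v))
      nlinarith [sq_nonneg (u ^ 2 - v ^ 2)]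
    rw [integral_add (i1.const_mul _) (i2.const_mul _), integral_const_mul,
      integral_const_mul] at h2
    have h5 := h.integral_diffAt_le q.2.1 q.1
    have h6 := h.integral_diffAt_le q.2.2 q.1
    linarith
  have prodZ : ∀ q q' : ι × I × I, ∫ x, Z q x * Z q' x ∂M
      = a q.2.1 * a q'.2.1 * ∫ x, ∏ j, diffAt φ (![q.2.1, q.2.2, q'.2.1, q'.2.2] j)
        (![q.1, q.1, q'.1, q'.1] j) x ∂M := by
    intro q q'
    rw [← integral_const_mul]
    congr 1; funext x
    rw [Fin.prod_univ_four]
    simp only [Z, Matrix.cons_val]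
    ring
  have cov : ∀ q q' : ι × I × I,
      ∫ x, Z q x * Z q' x ∂M - (∫ x, Z q x ∂M) * ∫ x, Z q' x ∂M
        ≤ if good (q, q') then 32 * K else 0 := by
    intro q q'
    split_ifs with hg
    · have h1 : ∫ x, Z q x * Z q' x ∂M ≤ 16 * K := by
        rw [prodZ]
        have h2 := abs_integral_prod_four_le (P := M)
          (fun j => h.memLp_diffAt (![q.2.1, q.2.2, q'.2.1, q'.2.2] j) (![q.1, q.1, q'.1, q'.1] j))
          (fun j => h.integral_diffAt_le _ _)
        refine (le_abs_self _).trans ?_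
        rw [abs_mul, abs_mul]
        calc _ ≤ 1 * 1 * |∫ x, ∏ j, diffAt φ (![q.2.1, q.2.2, q'.2.1, q'.2.2] j)
              (![q.1, q.1, q'.1, q'.1] j) x ∂M| :=
              mul_le_mul_of_nonneg_right (mul_le_mul (ha _) (ha _) (abs_nonneg _) zero_le_one)
                (abs_nonneg _)
          _ ≤ _ := by rw [one_mul, one_mul]; exact h2
      have h3 := second q
      have h4 := second q'
      nlinarith [sq_nonneg ((∫ x, Z q x ∂M) + ∫ x, Z q' x ∂M)]
    · by_cases h1 : q.1 ∈ E q.2.1 ∧ q.1 ∈ E q.2.2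
      swap
      · simp [zeroL q h1]
      by_cases h2 : q'.1 ∈ E q'.2.1 ∧ q'.1 ∈ E q'.2.2
      swap
      · simp [zeroL q' h2]
      by_cases h3 : Disjoint (E q.2.1 ∪ E q.2.2) (E q'.2.1 ∪ E q'.2.2)
      · have dep : ∀ q : ι × I × I, DependsOn (Z q) ((E q.2.1 ∪ E q.2.2 : Finset ι) : Set ι) := by
          intro q x y hxy
          simp only [Z]
          rw [h.dependsOn_diffAt q.2.1 q.1 fun c hc => hxy c (by simp at hc ⊢; exact Or.inl hc),
            h.dependsOn_diffAt q.2.2 q.1 fun c hc => hxy c (by simp at hc ⊢; exact Or.inr hc)]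
        have mZ : ∀ q, Measurable (Z q) := fun q =>
          ((h.measurable_diffAt _ _).mul (h.measurable_diffAt _ _)).const_mul _
        rw [integral_mul_of_dependsOn (mZ q) (mZ q') (dep q) (dep q') h3, sub_self]
      · have hcov : ¬ Covered E ![q.2.1, q.2.2, q'.2.1, q'.2.2] := by
          intro hc
          refine hg ⟨⟨hc, ?_, ?_, h3⟩, h1.1, h2.1⟩
          · exact Finset.not_disjoint_iff.2 ⟨q.1, h1.1, h1.2⟩
          · exact Finset.not_disjoint_iff.2 ⟨q'.1, h2.1, h2.2⟩
        rw [prodZ, h.integral_prod_eq_zero _ hcov, mul_zero, zero_sub]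
        -- An element covered only once lies in one of the two members of `q` or of `q'` and not in
        -- the other; this makes the corresponding mean vanish.
        have hz : (∫ x, Z q x ∂M) = 0 ∨ (∫ x, Z q' x ∂M) = 0 := by
          simp only [Covered, not_forall, not_exists, not_and] at hcov
          obtain ⟨i, b, hb, hno⟩ := hcov
          have n0 := hno 0; have n1 := hno 1; have n2 := hno 2; have n3 := hno 3
          have zl : ∀ q : ι × I × I, (b ∈ E q.2.1 ∧ b ∉ E q.2.2) ∨ (b ∈ E q.2.2 ∧ b ∉ E q.2.1) →
              ∫ x, Z q x ∂M = 0 := by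
            rintro q (⟨h1, h2⟩ | ⟨h1, h2⟩)
            · simp only [Z]
              rw [integral_const_mul, h.integral_mul_eq_zero _ _ h1 h2, mul_zero]
            · simp only [Z, mul_comm (diffAt φ q.2.1 _ _)]
              rw [integral_const_mul, h.integral_mul_eq_zero _ _ h1 h2, mul_zero]
          fin_cases i
          · exact Or.inl (zl q (Or.inl ⟨hb, n1 (by decide)⟩))
          · exact Or.inl (zl q (Or.inr ⟨hb, n0 (by decide)⟩))
          · exact Or.inr (zl q' (Or.inl ⟨hb, n3 (by decide)⟩))
          · exact Or.inr (zl q' (Or.inr ⟨hb, n2 (by decide)⟩))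
        rcases hz with hz | hz <;> simp [hz]
  refine (Finset.sum_le_sum fun q _ => Finset.sum_le_sum fun q' _ => cov q q').trans ?_
  rw [← Fintype.sum_prod_type' (f := fun q q' => if good (q, q') then 32 * K else 0),
    ← Finset.sum_filter, Finset.sum_const, nsmul_eq_mul, mul_comm]
  refine mul_le_mul_of_nonneg_left ?_ (by positivity)
  have hcard : (Finset.univ.filter fun p : (ι × I × I) × (ι × I × I) => good p).card
      ≤ linkedCount E * m ^ 2 := by
    -- For a fixed linked quadruple, the two resampled coordinates lie in `E (f 0)` and `E (f 2)`,
    -- which gives the factor `m ^ 2`.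
    let T : Finset (Σ _ : Fin 4 → I, ι × ι) :=
      (Finset.univ.filter fun f : Fin 4 → I => Linked E f).sigma fun f => E (f 0) ×ˢ E (f 2)
    have h1 : (Finset.univ.filter fun p : (ι × I × I) × (ι × I × I) => good p).card ≤ T.card := by
      refine Finset.card_le_card_of_injOn
        (fun p => ⟨![p.1.2.1, p.1.2.2, p.2.2.1, p.2.2.2], (p.1.1, p.2.1)⟩) ?_ ?_
      · intro p hp
        have hp := (Finset.mem_filter.1 hp).2
        exact Finset.mem_coe.2 (Finset.mem_sigma.2 ⟨Finset.mem_filter.2 ⟨Finset.mem_univ _, hp.1⟩,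
          Finset.mem_product.2 hp.2⟩)
      · rintro ⟨⟨e, i, j⟩, e', k, l⟩ _ ⟨⟨e₁, i₁, j₁⟩, e₁', k₁, l₁⟩ _ hpq
        simp only [Sigma.mk.injEq, heq_eq_eq, Prod.mk.injEq] at hpq
        obtain ⟨hf, rfl, rfl⟩ := hpq
        have g0 := congrFun hf 0; have g1 := congrFun hf 1
        have g2 := congrFun hf 2; have g3 := congrFun hf 3
        simp only [Matrix.cons_val] at g0 g1 g2 g3
        rw [g0, g1, g2, g3]
    refine h1.trans ?_
    rw [Finset.card_sigma, linkedCount, ← smul_eq_mul, ← Finset.sum_const]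
    refine Finset.sum_le_sum fun f _ => ?_
    rw [Finset.card_product, sq]
    exact Nat.mul_le_mul (hm _) (hm _)
  exact_mod_cast hcard

end IsDegenerateFamily

end Family

/-! ### Normal approximation for degenerate families. -/

section Family

variable {ι I 𝒴 : Type*} [Fintype ι] [DecidableEq ι] [Fintype I] [MeasurableSpace 𝒴]
  {ν : Measure 𝒴} [IsProbabilityMeasure ν]
  {φ : I → (ι → 𝒴) → ℝ} {E : I → Finset ι} {K : ℝ}

namespace IsDegenerateFamily

variable (h : IsDegenerateFamily ν φ E K)
include h

/-- Resampling a coordinate of `E i` makes the second term of the difference orthogonal to `ψ`;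
resampling any other coordinate changes nothing. -/
lemma integral_mul_diffAt {ψ : (ι → 𝒴) → ℝ} (hψ : MemLp ψ 2 (Measure.pi fun _ => ν)) (i : I)
    (e : ι) :
    ∫ x, ψ (firsts x) * diffAt φ i e x ∂(Measure.pi fun _ : ι => ν.prod ν)
      = if e ∈ E i then
        ∫ x, ψ (firsts x) * φ i (firsts x) ∂(Measure.pi fun _ : ι => ν.prod ν) else 0 := by
  split_ifs with he
  · have hψ' : MemLp (fun x => ψ (firsts x)) 2 (Measure.pi fun _ : ι => ν.prod ν) :=
      hψ.comp_measurePreserving measurePreserving_firsts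
    have i1 : Integrable (fun x => ψ (firsts x) * φ i (firsts x))
        (Measure.pi fun _ : ι => ν.prod ν) :=
      hψ'.integrable_mul ((h.memLp_firsts i).mono_exponent (p := 2) (by norm_num))
    have i2 : Integrable (fun x => ψ (firsts x) * φ i (firsts (swapAt e x)))
        (Measure.pi fun _ : ι => ν.prod ν) :=
      hψ'.integrable_mul ((h.memLp_firsts_swapAt i e).mono_exponent (p := 2) (by norm_num))
    simp only [diffAt, mul_sub]
    rw [integral_sub i1 i2, integral_mul_swapAt_eq_zero (h.centered i e he) i2, sub_zero]
  · simp [h.diffAt_eq_zero he]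

/-- Normal approximation of a sum of degenerate functions. -/
theorem abs_sub_ncdf_le {s : ℝ} (hs : 0 < s)
    (hs2 : ∫ y, (∑ i, φ i y) ^ 2 ∂(Measure.pi fun _ => ν) = s ^ 2) (hK : 0 ≤ K) {m : ℕ}
    (hm : ∀ i, (E i).card ≤ m) (t : ι → ι → ℝ) (ht : ∀ e e', 0 < t e e') {δ₁ δ₂ : ℝ}
    (hδ₁ : 0 < δ₁) (hδ₂ : 0 < δ₂) (h₁ : 8 * K * (linkedCount E * m ^ 2) ≤ (δ₁ * s ^ 2) ^ 2)
    (h₂ : ∑ e, ∑ e', 32 * K * (t e e' * pairCount E e e' + (t e e')⁻¹ * pairCount E e e)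
      ≤ (δ₂ * s ^ 2) ^ 2) (z : ℝ) :
    |(Measure.pi fun _ : ι => ν).real {y | (∑ i, φ i y) / s ≤ z} - ncdf z|
      ≤ 2 * δ₁ + 2 * δ₂ := by
  set M := Measure.pi fun _ : ι => ν.prod ν with hM
  -- By `integral_mul_diffAt` each edge of `E i` reproduces the full term `φ i`. The inverse
  -- cardinality makes the sum over these edges count it once.
  let c : I → ℝ := fun i => ((E i).card : ℝ)⁻¹
  have hcard : ∀ i, (1 : ℝ) ≤ (E i).card := fun i => by
    exact_mod_cast Finset.card_pos.2 (h.nonempty i)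
  have hc : ∀ i, |c i| ≤ 1 := fun i => by
    rw [abs_of_nonneg (by positivity)]
    exact inv_le_one_of_one_le₀ (hcard i)
  let w : (ι → 𝒴) → ℝ := fun y => (∑ i, φ i y) / s
  let W : (ι → 𝒴 × 𝒴) → ℝ := fun x => w (firsts x)
  let F : ι → (ι → 𝒴 × 𝒴) → ℝ := fun e x => lin φ c e x / s
  have hwm : Measurable w := (Finset.measurable_sum _ fun i _ => h.measurable i).div_const s
  have hWm : Measurable W := hwm.comp (measurePreserving_firsts (ν := ν)).measurable
  have hw4 : MemLp w 4 (Measure.pi fun _ : ι => ν) := by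
    have := (memLp_finsetSum (p := 4) Finset.univ fun i _ => h.memLp i).const_mul s⁻¹
    refine this.congr_norm hwm.aestronglyMeasurable (Filter.Eventually.of_forall fun y => ?_)
    simp only [w, div_eq_inv_mul]
  have hW2 : MemLp W 2 M := (hw4.mono_exponent (p := 2) (by norm_num)).comp_measurePreserving
    measurePreserving_firsts
  have hF4 : ∀ e, MemLp (F e) 4 M := fun e => by
    have := (h.memLp_lin c e).const_mul s⁻¹
    refine this.congr_norm ?_ (Filter.Eventually.of_forall fun y => ?_)
    · simpa only [F, div_eq_inv_mul] using this.1
    · simp only [F, div_eq_inv_mul]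
  have hF2 : ∀ e, MemLp (F e) 2 M := fun e => (hF4 e).mono_exponent (by norm_num)
  have hinv : ∀ e x, W (swapAt e (swapAt e x)) = W x := fun e x => by rw [swapAt_swapAt]
  have hanti : ∀ e x, F e (swapAt e x) = -F e x := fun e x => by
    simp only [F, lin_swapAt, neg_div]
  have hlin : ∀ ψ : ℝ → ℝ, Measurable ψ → MemLp (fun x => ψ (W x)) 2 M →
      ∫ x, ψ (W x) * W x ∂M = ∑ e, ∫ x, ψ (W x) * F e x ∂M := by
    intro ψ hψm hψ
    have hψ' : MemLp (fun y => ψ (w y)) 2 (Measure.pi fun _ : ι => ν) := by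
      rw [← (measurePreserving_firsts (ι := ι) (ν := ν)).map_eq] at *
      exact (memLp_map_measure_iff (hψm.comp hwm).aestronglyMeasurable
        (measurePreserving_firsts (ν := ν)).measurable.aemeasurable).2 hψ
    have iD : ∀ i e, Integrable (fun x => ψ (W x) * diffAt φ i e x) M := fun i e =>
      hψ.integrable_mul ((h.memLp_diffAt i e).mono_exponent (p := 2) (by norm_num))
    have iT : ∀ i, Integrable (fun x => ψ (W x) * φ i (firsts x)) M := fun i =>
      hψ.integrable_mul ((h.memLp_firsts i).mono_exponent (p := 2) (by norm_num))
    have e1 : ∀ e, ∫ x, ψ (W x) * F e x ∂M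
        = ∑ i, (c i / s) * ∫ x, ψ (W x) * diffAt φ i e x ∂M := by
      intro e
      simp only [← integral_const_mul]
      rw [← integral_finsetSum _ fun i _ => (iD i e).const_mul _]
      congr 1; funext x
      simp only [F, lin, Finset.sum_div, Finset.mul_sum]
      refine Finset.sum_congr rfl fun i _ => ?_
      ring
    have e2 : ∫ x, ψ (W x) * W x ∂M = ∑ i, s⁻¹ * ∫ x, ψ (W x) * φ i (firsts x) ∂M := by
      simp only [← integral_const_mul]
      rw [← integral_finsetSum _ fun i _ => (iT i).const_mul _]
      congr 1; funext x
      simp only [W, w, Finset.sum_div, Finset.mul_sum]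
      refine Finset.sum_congr rfl fun i _ => ?_
      ring
    simp only [e1, e2]
    rw [Finset.sum_comm]
    refine Finset.sum_congr rfl fun i _ => ?_
    rw [← Finset.mul_sum]
    have e3 : ∀ e, ∫ x, ψ (W x) * diffAt φ i e x ∂M
        = if e ∈ E i then ∫ x, ψ (W x) * φ i (firsts x) ∂M else 0 :=
      fun e => h.integral_mul_diffAt (ψ := fun y => ψ (w y)) hψ' i e
    simp only [e3]
    rw [← Finset.sum_filter, Finset.sum_const, nsmul_eq_mul, Finset.filter_mem_eq_inter,
      Finset.univ_inter]
    have := (zero_lt_one.trans_le (hcard i)).ne'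
    simp only [c]
    field_simp
  have hBE := berry_esseen_of_exchangeable hWm hW2 hF2
    (fun e => measurePreserving_swapAt (ν := ν) e) hinv hanti hlin z
  have hreal : M.real {x | W x ≤ z}
      = (Measure.pi fun _ : ι => ν).real {y | (∑ i, φ i y) / s ≤ z} :=
    (measurePreserving_firsts (ι := ι) (ν := ν)).measureReal_preimage
      (measurableSet_le hwm measurable_const).nullMeasurableSet
  rw [hreal] at hBE
  have hΔ : ∀ e x, W x - W (swapAt e x) = lin φ (fun _ => 1) e x / s := by
    intro e x
    simp only [W, w, lin, one_mul, diffAt, ← sub_div, Finset.sum_sub_distrib]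
  -- the normalization
  have hWF : ∑ e, ∫ x, F e x * (W x - W (swapAt e x)) ∂M = 2 := by
    have hWW : ∫ x, W x * W x ∂M = 1 := by
      have h3 := integral_comp_of_measurePreserving (measurePreserving_firsts (ι := ι) (ν := ν))
        (φ := fun y => w y * w y) (hwm.mul hwm).aestronglyMeasurable
      refine h3.trans ?_
      have : ∀ y, w y * w y = (s ^ 2)⁻¹ * (∑ i, φ i y) ^ 2 := fun y => by
        simp only [w]; field_simp
      simp only [this]
      rw [integral_const_mul, hs2]
      field_simp
    have h4 := hlin id measurable_id hW2
    simp only [id] at h4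
    rw [hWW] at h4
    have h5 : ∀ e, ∫ x, F e x * (W x - W (swapAt e x)) ∂M = 2 * ∫ x, W x * F e x ∂M := by
      intro e
      have i1 : Integrable (fun x => F e x * W x) M := (hF2 e).integrable_mul hW2
      have hW' : MemLp (fun x => W (swapAt e x)) 2 M :=
        hW2.comp_measurePreserving (measurePreserving_swapAt e)
      have i2 : Integrable (fun x => F e x * W (swapAt e x)) M := (hF2 e).integrable_mul hW'
      have h6 := integral_comp_of_measurePreserving (measurePreserving_swapAt (ν := ν) e)
        (φ := fun x => F e x * W x) i1.aestronglyMeasurable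
      simp only [hanti, neg_mul, integral_neg] at h6
      simp only [mul_sub]
      rw [integral_sub i1 i2]
      simp only [mul_comm (W _) (F e _)]
      rw [← hM] at h6
      linarith
    simp only [h5, ← Finset.mul_sum, ← h4]
    norm_num
  have iFΔ : ∀ e, Integrable (fun x => F e x * (W x - W (swapAt e x))) M := fun e =>
    (hF2 e).integrable_mul (hW2.sub
      (hW2.comp_measurePreserving (measurePreserving_swapAt e)))
  have hsum : ∀ x, ∑ e, F e x * (W x - W (swapAt e x))
      = (s ^ 2)⁻¹ * ∑ e, lin φ c e x * lin φ (fun _ => 1) e x := by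
    intro x
    rw [Finset.mul_sum]
    refine Finset.sum_congr rfl fun e _ => ?_
    rw [hΔ]; simp only [F]; field_simp
  have hmean : ∫ x, ∑ e, lin φ c e x * lin φ (fun _ => 1) e x ∂M = 2 * s ^ 2 := by
    rw [← integral_finsetSum _ fun e _ => iFΔ e] at hWF
    simp only [hsum] at hWF
    rw [integral_const_mul] at hWF
    field_simp at hWF
    linarith
  have mLL : MemLp (fun x => ∑ e, lin φ c e x * lin φ (fun _ => 1) e x) 2 M :=
    memLp_finsetSum _ fun e _ => memLp_two_mul (h.memLp_lin c e) (h.memLp_lin _ e)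
  have mAL : MemLp (fun x => ∑ e, |lin φ c e x| * lin φ (fun _ => 1) e x) 2 M :=
    memLp_finsetSum _ fun e _ => memLp_two_mul (h.memLp_lin c e).abs (h.memLp_lin _ e)
  have b₁ : ∫ x, |1 - (1 / 2) * ∑ e, F e x * (W x - W (swapAt e x))| ∂M ≤ δ₁ := by
    have e1 : ∀ x, 1 - (1 / 2) * ∑ e, F e x * (W x - W (swapAt e x))
        = -(1 / (2 * s ^ 2)) * (∑ e, lin φ c e x * lin φ (fun _ => 1) e x - 2 * s ^ 2) := by
      intro x; rw [hsum]; field_simp; ring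
    simp only [e1]
    have m1 : MemLp (fun x => -(1 / (2 * s ^ 2))
        * (∑ e, lin φ c e x * lin φ (fun _ => 1) e x - 2 * s ^ 2)) 2 M :=
      (mLL.sub (memLp_const _)).const_mul _
    refine integral_abs_le_of_sq_le m1.1 ((memLp_two_iff_integrable_sq m1.1).1 m1) hδ₁ ?_
    have h5 := h.integral_sum_mul_sub_sq_le hc hK hm
    rw [← hM, hmean] at h5
    simp only [mul_pow]
    rw [integral_const_mul]
    -- The factor `1 / (2 * s ^ 2)` is squared, which turns `32` into `8`.
    have h6 : (-(1 / (2 * s ^ 2))) ^ 2 * (32 * K * (linkedCount E * m ^ 2))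
        = 8 * K * (linkedCount E * m ^ 2) / (s ^ 2) ^ 2 := by field_simp; ring
    refine (mul_le_mul_of_nonneg_left h5 (by positivity)).trans ?_
    rw [h6, div_le_iff₀ (by positivity), ← mul_pow]
    exact h₁
  have b₂ : ∫ x, |∑ e, |F e x| * (W x - W (swapAt e x))| ∂M ≤ δ₂ := by
    have e1 : ∀ x, ∑ e, |F e x| * (W x - W (swapAt e x))
        = (s ^ 2)⁻¹ * ∑ e, |lin φ c e x| * lin φ (fun _ => 1) e x := by
      intro x
      rw [Finset.mul_sum]
      refine Finset.sum_congr rfl fun e _ => ?_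
      rw [hΔ]; simp only [F, abs_div, abs_of_pos hs]; field_simp
    simp only [e1]
    have m1 := mAL.const_mul (s ^ 2)⁻¹
    refine integral_abs_le_of_sq_le m1.1 ((memLp_two_iff_integrable_sq m1.1).1 m1) hδ₂ ?_
    have h5 := h.integral_sum_abs_mul_sq_le hc (fun _ => by simp : ∀ i : I, |(1 : ℝ)| ≤ 1) hK t ht
    simp only [mul_pow]
    rw [integral_const_mul]
    refine (mul_le_mul_of_nonneg_left (h5.trans h₂) (by positivity)).trans (le_of_eq ?_)
    field_simp
  linarith

end IsDegenerateFamily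

end Family

/-! ### Functions of the edge variables only -/

section Transfer

variable {𝒳 𝒴 : Type*} [MeasurableSpace 𝒳] [MeasurableSpace 𝒴]
  {μ : Measure 𝒳} {ν : Measure 𝒴} [IsProbabilityMeasure μ] [IsProbabilityMeasure ν] {k : ℕ}
  {f : Vars 𝒳 𝒴 k → ℝ} {g : (Pairs k → 𝒴) → ℝ}

instance : IsProbabilityMeasure (law μ ν k) := by unfold law; infer_instance

lemma measurePreserving_snd_law :
    MeasurePreserving (Prod.snd : Vars 𝒳 𝒴 k → Pairs k → 𝒴) (law μ ν k)
      (Measure.pi fun _ => ν) := measurePreserving_snd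

lemma measurePreserving_piecewise_law (A : Finset (Fin k)) (B : Finset (Pairs k)) :
    MeasurePreserving (fun x : Vars 𝒳 𝒴 k × Vars 𝒳 𝒴 k =>
      ((A.piecewise x.1.1 x.2.1, B.piecewise x.1.2 x.2.2) : Vars 𝒳 𝒴 k))
      ((law μ ν k).prod (law μ ν k)) (law μ ν k) := by
  have hA := measurePreserving_piecewise (m := μ) A
  have hB := measurePreserving_piecewise (m := ν) B
  have hAB := hA.prod hB
  have hc : MeasurePreserving (fun x : Vars 𝒳 𝒴 k × Vars 𝒳 𝒴 k =>
      ((x.1.1, x.2.1), (x.1.2, x.2.2))) ((law μ ν k).prod (law μ ν k))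
      (((Measure.pi fun _ => μ).prod (Measure.pi fun _ => μ)).prod
        ((Measure.pi fun _ => ν).prod (Measure.pi fun _ => ν))) := by
    unfold law
    have h1 := (measurePreserving_prodAssoc (Measure.pi fun _ : Fin k => μ) (Measure.pi fun _ : Pairs k => ν)
      ((Measure.pi fun _ : Fin k => μ).prod (Measure.pi fun _ : Pairs k => ν)))
    have h2 := ((measurePreserving_prodAssoc (Measure.pi fun _ : Pairs k => ν)
      (Measure.pi fun _ : Fin k => μ) (Measure.pi fun _ : Pairs k => ν)).symm)
    have h3 := (Measure.measurePreserving_swap (μ := Measure.pi fun _ : Pairs k => ν)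
      (ν := Measure.pi fun _ : Fin k => μ)).prod
        (MeasurePreserving.id (Measure.pi fun _ : Pairs k => ν))
    have h4 := (measurePreserving_prodAssoc (Measure.pi fun _ : Fin k => μ)
      (Measure.pi fun _ : Pairs k => ν) (Measure.pi fun _ : Pairs k => ν))
    have h5 := (measurePreserving_prodAssoc (Measure.pi fun _ : Fin k => μ)
      (Measure.pi fun _ : Fin k => μ)
      ((Measure.pi fun _ : Pairs k => ν).prod (Measure.pi fun _ : Pairs k => ν))).symm
    exact h5.comp (((MeasurePreserving.id (Measure.pi fun _ : Fin k => μ)).prod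
      (h4.comp (h3.comp h2))).comp h1)
  exact hAB.comp hc

lemma condMean_ae_eq (hg : Measurable g) (hfg : ∀ᵐ p ∂(law μ ν k), f p = g p.2)
    (A : Finset (Fin k)) (B : Finset (Pairs k)) :
    ∀ᵐ p ∂(law μ ν k), condMean μ ν f A B p = condE ν g B p.2 := by
  have h1 := Measure.ae_ae_of_ae_prod
    ((measurePreserving_piecewise_law A B).quasiMeasurePreserving.ae hfg)
  filter_upwards [h1] with p hp
  rw [condMean, integral_congr_ae hp, condE]
  have hm : Measurable (fun q => g (B.piecewise p.2 q)) :=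
    hg.comp ((measurePreserving_piecewise (m := ν) B).measurable.comp measurable_prodMk_left)
  exact integral_comp_of_measurePreserving (measurePreserving_snd_law (μ := μ))
    hm.aestronglyMeasurable

lemma mobius_const_one {κ : Type*} [DecidableEq κ] {A : Finset κ} (hA : A.Nonempty) :
    mobius (fun _ => (1 : ℝ)) A = 0 := by
  obtain ⟨a, ha⟩ := hA
  rw [← Finset.insert_erase ha, mobius_insert _ (Finset.notMem_erase a A)]
  simp [mobius]

/-- Conditional means do not depend on `A'`, so the alternating sum over `A'` factors out and
vanishes unless `A` is empty. -/
lemma comp_ae_eq (hg : Measurable g) (hfg : ∀ᵐ p ∂(law μ ν k), f p = g p.2)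
    (A : Finset (Fin k)) (B : Finset (Pairs k)) :
    ∀ᵐ p ∂(law μ ν k), comp μ ν f A B p = if A = ∅ then hoef ν g B p.2 else 0 := by
  have h := ae_all_iff.2 fun A' => ae_all_iff.2 fun B' => condMean_ae_eq hg hfg A' B'
  filter_upwards [h] with p hp
  have e1 : comp μ ν f A B p = mobius (fun _ => (1 : ℝ)) A * hoef ν g B p.2 := by
    simp only [comp, hp, hoef, mobius, mul_one]
    rw [Finset.sum_mul_sum]
    refine Finset.sum_congr rfl fun A' _ => Finset.sum_congr rfl fun B' _ => ?_
    rw [pow_add]; ring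
  rw [e1]
  split_ifs with hA
  · subst hA; simp [mobius]
  · rw [mobius_const_one (Finset.nonempty_iff_ne_empty.2 hA), zero_mul]

lemma sigma_of_ne_empty (hg : Measurable g) (hfg : ∀ᵐ p ∂(law μ ν k), f p = g p.2)
    {A : Finset (Fin k)} (hA : A ≠ ∅) (B : Finset (Pairs k)) : sigma μ ν f A B = 0 := by
  have h := comp_ae_eq hg hfg A B
  simp only [hA, if_false] at h
  rw [sigma, eLpNorm_congr_ae h]
  simp

lemma sigma_empty_sq (hg : Measurable g) (hg4 : MemLp g 4 (Measure.pi fun _ => ν))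
    (hfg : ∀ᵐ p ∂(law μ ν k), f p = g p.2) (B : Finset (Pairs k)) :
    sigma μ ν f ∅ B ^ 2 = ∫ y, hoef ν g B y ^ 2 ∂(Measure.pi fun _ => ν) := by
  have h := comp_ae_eq hg hfg ∅ B
  simp only [if_true] at h
  have h2 : MemLp (hoef ν g B) 2 (Measure.pi fun _ => ν) :=
    (memLp_hoef hg hg4 B).mono_exponent (by norm_num)
  have h3 := eLpNorm_comp_measurePreserving (p := 2) h2.1
    (measurePreserving_snd_law (μ := μ) (ν := ν) (k := k))
  rw [sigma, eLpNorm_congr_ae h]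
  have h4 : eLpNorm (fun p : Vars 𝒳 𝒴 k => hoef ν g B p.2) 2 (law μ ν k)
      = eLpNorm (hoef ν g B) 2 (Measure.pi fun _ => ν) := h3
  rw [h4, h2.eLpNorm_eq_integral_rpow_norm (by norm_num) (by norm_num),
    ENNReal.toReal_ofReal (by positivity), ← Real.rpow_natCast, ← Real.rpow_mul (by positivity)]
  norm_num

open Classical in
-- The components are orthogonal, so testing a vanishing level part against one of its members
-- leaves the square of this member. Thus the principal degree controls every single component, not
-- only sums.
lemma integral_hoef_sq_eq_zero (hg : Measurable g) (hg4 : MemLp g 4 (Measure.pi fun _ => ν))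
    (hfg : ∀ᵐ p ∂(law μ ν k), f p = g p.2) {ℓ : ℕ} (hℓ : levelPart μ ν f ℓ =ᵐ[law μ ν k] 0)
    {B : Finset (Pairs k)} (hB : (nodes B).card = ℓ) :
    ∫ y, hoef ν g B y ^ 2 ∂(Measure.pi fun _ => ν) = 0 := by
  have hc := ae_all_iff.2 fun A => ae_all_iff.2 fun B => comp_ae_eq (μ := μ) hg hfg A B
  have h1 : ∀ᵐ p ∂(law μ ν k), ∑ B' with (nodes B').card = ℓ, hoef ν g B' p.2 = 0 := by
    filter_upwards [hc, hℓ] with p hp hl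
    have e1 : levelPart μ ν f ℓ p
        = ∑ B' with (nodes B').card = ℓ, hoef ν g B' p.2 := by
      rw [levelPart, Finset.sum_filter, Fintype.sum_prod_type, Fintype.sum_eq_single ∅]
      · rw [Finset.sum_filter]
        refine Finset.sum_congr rfl fun B' _ => ?_
        simp only [numNodes_empty, hp, if_true]
      · intro A hA
        refine Finset.sum_eq_zero fun B' _ => ?_
        simp [hp, hA]
    rw [← e1, hl, Pi.zero_apply]
  have hm : Measurable fun y => (∑ B' with (nodes B').card = ℓ, hoef ν g B' y) * hoef ν g B y :=
    (Finset.measurable_sum _ fun B' _ => measurable_hoef hg B').mul (measurable_hoef hg B)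
  have h2 : ∫ y, (∑ B' with (nodes B').card = ℓ, hoef ν g B' y) * hoef ν g B y
      ∂(Measure.pi fun _ => ν) = 0 := by
    rw [← integral_comp_of_measurePreserving
      (measurePreserving_snd_law (μ := μ) (ν := ν) (k := k)) hm.aestronglyMeasurable]
    have : ∀ᵐ p ∂(law μ ν k), (∑ B' with (nodes B').card = ℓ, hoef ν g B' p.2)
        * hoef ν g B p.2 = (fun _ => (0 : ℝ)) p := by
      filter_upwards [h1] with p hp
      rw [hp, zero_mul]
    rw [integral_congr_ae this]
    simp
  have m2 : ∀ B, MemLp (hoef ν g B) 2 (Measure.pi fun _ => ν) := fun B =>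
    (memLp_hoef hg hg4 B).mono_exponent (by norm_num)
  have hi : ∀ B', Integrable (fun y => hoef ν g B' y * hoef ν g B y) (Measure.pi fun _ => ν) :=
    fun B' => (m2 B').integrable_mul (m2 B)
  simp only [Finset.sum_mul] at h2
  rw [integral_finsetSum _ fun B' _ => hi B',
    Finset.sum_eq_single B] at h2
  · simpa only [sq] using h2
  · intro B' _ hne
    exact integral_hoef_mul_hoef hg hg4 hne
  · intro hno
    exact absurd (Finset.mem_filter.2 ⟨Finset.mem_univ B, hB⟩) hno

end Transfer

/-! ### Counts of placed edge sets, and the resulting rate. -/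

section Counts

variable {k n d : ℕ} {𝓑 : Finset (Finset (Pairs k))}

/-- The copies in `{1, …, n}` of the edge sets in `𝓑`. -/
abbrev Copies (n : ℕ) (𝓑 : Finset (Finset (Pairs k))) : Type :=
  {i : (Fin k ↪o Fin n) × Finset (Pairs k) // i.2 ∈ 𝓑}

/-- The power of `n` stands on the left to avoid truncated subtraction: a quadruple with the
property forces `q ≤ 4 * k`. -/
lemma card_filter_copies_le (p : (Fin 4 → Copies n 𝓑) → Prop) [DecidablePred p] (hn : 0 < n)
    (R : Finset (Fin n)) (hR : R.card ≤ 4) (q : ℕ)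
    (h : ∀ f, p f → ((Finset.univ.biUnion fun i => nodes (copyEdges (f i).1)) \ R).card + q
        ≤ ∑ i, (nodes (copyEdges (f i).1)).card) :
    (Finset.univ.filter p).card * n ^ q ≤ quadConst k * n ^ (4 * k) := by
  rcases (Finset.univ.filter p).eq_empty_or_nonempty with h0 | ⟨f, hf⟩
  · simp [h0]
  have hq : q ≤ 4 * k := by
    refine le_trans ((Nat.le_add_left _ _).trans (h f (Finset.mem_filter.1 hf).2)) ?_
    calc ∑ i, (nodes (copyEdges (f i).1)).card ≤ ∑ _i : Fin 4, k := by
          refine Finset.sum_le_sum fun i _ => ?_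
          rw [card_nodes_copyEdges]
          exact (Finset.card_le_univ _).trans (Fintype.card_fin k).le
      _ = 4 * k := by simp
  have h1 : (Finset.univ.filter p).card ≤ quadConst k * n ^ (4 * k - q) := by
    refine le_trans ?_ (card_quadruples_le hn R hR q)
    refine Finset.card_le_card_of_injOn (fun f i => (f i).1) ?_ ?_
    · intro f hf
      exact Finset.mem_coe.2 (Finset.mem_filter.2
        ⟨Finset.mem_univ _, h f (Finset.mem_filter.1 hf).2⟩)
    · intro f _ f' _ hff
      funext i
      exact Subtype.ext (congrFun hff i)
  calc _ ≤ quadConst k * n ^ (4 * k - q) * n ^ q := Nat.mul_le_mul_right _ h1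
    _ = quadConst k * n ^ (4 * k) := by rw [mul_assoc, ← pow_add, Nat.sub_add_cancel hq]

lemma copyEdges_nonempty {i : (Fin k ↪o Fin n) × Finset (Pairs k)} (h : i.2.Nonempty) :
    (copyEdges i).Nonempty := h.image _

/-- This saves the factor `n ^ 2` beyond the square of the variance order; biconnectedness enters
the count only here. -/
lemma linkedCount_copies_le (hn : 0 < n) (hne : ∀ B ∈ 𝓑, B.Nonempty)
    (hd : ∀ B ∈ 𝓑, d ≤ (nodes B).card) (hb : ∀ B ∈ 𝓑, (nodes B).card = d → Biconnected B) :
    linkedCount (fun i : Copies n 𝓑 => copyEdges i.1) * n ^ (2 * d + 2)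
      ≤ quadConst k * n ^ (4 * k) := by
  classical
  rw [linkedCount]
  refine (le_of_eq ?_).trans (card_filter_copies_le
    (Linked fun i : Copies n 𝓑 => copyEdges i.1) hn ∅ (by simp) (2 * d + 2) ?_)
  · congr
  intro f hf
  rw [Finset.sdiff_empty]
  refine card_nodes_le_of_linked (fun i => copyEdges_nonempty (hne _ (f i).2)) hf.1
    (fun i => ?_) (fun i hi => ?_) hf.2.1 hf.2.2.1 hf.2.2.2
  · rw [card_nodes_copyEdges]; exact hd _ (f i).2
  · rw [card_nodes_copyEdges] at hi
    exact (hb _ (f i).2 hi).image _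

/-- All four node sets contain the nodes of `e` and `e'`, and every other node is covered twice. So
`card_nodes_sdiff_le`, together with a total of at least `4 * d` nodes, gives the exponent. -/
lemma pairCount_copies_le (hn : 0 < n) (hd : ∀ B ∈ 𝓑, d ≤ (nodes B).card) (e e' : Pairs n) :
    pairCount (fun i : Copies n 𝓑 => copyEdges i.1) e e' * n ^ (2 * d + 2 * (pairNodes e e').card)
      ≤ quadConst k * n ^ (4 * k) := by
  classical
  rw [pairCount]
  refine (le_of_eq ?_).trans (card_filter_copies_le
    (fun f : Fin 4 → Copies n 𝓑 => Covered (fun i : Copies n 𝓑 => copyEdges i.1) f ∧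
      ∀ j, e ∈ copyEdges (f j).1 ∧ e' ∈ copyEdges (f j).1) hn (pairNodes e e')
      (card_pairNodes_le e e') (2 * d + 2 * (pairNodes e e').card) ?_)
  · congr
  intro f hf
  have h1 := card_nodes_sdiff_le (E := fun i => copyEdges (f i).1) hf.1 (R := pairNodes e e') ?_
  · have h2 : 4 * d ≤ ∑ i, (nodes (copyEdges (f i).1)).card := by
      calc 4 * d = ∑ _i : Fin 4, d := by simp
        _ ≤ _ := Finset.sum_le_sum fun i _ => by
            rw [card_nodes_copyEdges]; exact hd _ (f i).2
    omega
  · intro i v hv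
    rcases Finset.mem_union.1 hv with hv | hv
    · exact mem_nodes.2 ⟨e, (hf.2 i).1, Sym2.mem_toFinset.1 hv⟩
    · exact mem_nodes.2 ⟨e', (hf.2 i).2, Sym2.mem_toFinset.1 hv⟩

lemma card_pairNodes_self (e : Pairs n) : (pairNodes e e).card = 2 := by
  have h : (pairNodes e e).card ≤ 2 := by
    rw [pairNodes, Finset.union_self]
    obtain ⟨e, he⟩ := e
    induction e using Sym2.ind with
    | _ a b => exact (congrArg _ (Sym2.toFinset_mk_eq)).trans_le Finset.card_le_two
  exact le_antisymm h (two_le_card_pairNodes e e)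

/-- The constant in the normal approximation, when fourth moments are at most `K` and the squared
variance is at least `c n ^ (4 * k - 2 * d)`. -/
noncomputable def rateConst (k : ℕ) (K c : ℝ) : ℝ :=
  2 * √(8 * K * (quadConst k / c) * (Fintype.card (Pairs k) : ℝ) ^ 2 + 1)
    + 2 * √(81920 * K * (quadConst k / c) + 1)

theorem abs_sub_ncdf_le_of_copies {𝒴 : Type*} [MeasurableSpace 𝒴] {ν : Measure 𝒴}
    [IsProbabilityMeasure ν] {φ : Copies n 𝓑 → (Pairs n → 𝒴) → ℝ} {K c s : ℝ}
    (h : IsDegenerateFamily ν φ (fun i => copyEdges i.1) K) (hn : 0 < n)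
    (hne : ∀ B ∈ 𝓑, B.Nonempty)
    (hd : ∀ B ∈ 𝓑, d ≤ (nodes B).card) (hb : ∀ B ∈ 𝓑, (nodes B).card = d → Biconnected B)
    (hs : 0 < s) (hs2 : ∫ y, (∑ i, φ i y) ^ 2 ∂(Measure.pi fun _ => ν) = s ^ 2) (hK : 0 ≤ K)
    (hc : 0 < c) (hv : c * (n : ℝ) ^ (4 * k) ≤ s ^ 4 * (n : ℝ) ^ (2 * d)) (z : ℝ) :
    |(Measure.pi fun _ => ν).real {y | (∑ i, φ i y) / s ≤ z} - ncdf z|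
      ≤ rateConst k K c * (n : ℝ)⁻¹ := by
  have hn' : (0 : ℝ) < n := by exact_mod_cast hn
  set A : ℝ := quadConst k / c with hA
  have hA0 : 0 ≤ A := by positivity
  set m := Fintype.card (Pairs k) with hm
  have key : ∀ a q : ℕ, a * n ^ (2 * d + q) ≤ quadConst k * n ^ (4 * k) →
      (a : ℝ) * (n : ℝ) ^ q ≤ A * s ^ 4 := by
    intro a q haq
    have h1 : (a : ℝ) * (n : ℝ) ^ (2 * d + q) ≤ quadConst k * (n : ℝ) ^ (4 * k) := by
      exact_mod_cast haq
    have h2 : (quadConst k : ℝ) * (n : ℝ) ^ (4 * k) ≤ A * (s ^ 4 * (n : ℝ) ^ (2 * d)) := by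
      calc _ = A * (c * (n : ℝ) ^ (4 * k)) := by rw [hA]; field_simp
        _ ≤ _ := mul_le_mul_of_nonneg_left hv hA0
    have h3 : (a : ℝ) * (n : ℝ) ^ q * (n : ℝ) ^ (2 * d) ≤ A * s ^ 4 * (n : ℝ) ^ (2 * d) := by
      calc _ = (a : ℝ) * (n : ℝ) ^ (2 * d + q) := by rw [pow_add]; ring
        _ ≤ A * (s ^ 4 * (n : ℝ) ^ (2 * d)) := h1.trans h2
        _ = _ := by ring
    exact le_of_mul_le_mul_right h3 (by positivity)
  have hL := key _ 2 (linkedCount_copies_le hn hne hd hb)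
  have hP : ∀ e e', _ := fun e e' => key _ (2 * (pairNodes e e').card)
    (pairCount_copies_le (𝓑 := 𝓑) hn hd e e')
  have hP2 : ∀ e, _ := fun e => hP e e
  simp only [card_pairNodes_self] at hP2
  set E : Copies n 𝓑 → Finset (Pairs n) := fun i => copyEdges i.1 with hE
  have s1 : √(8 * K * A * (m : ℝ) ^ 2 + 1) ^ 2 = 8 * K * A * (m : ℝ) ^ 2 + 1 :=
    Real.sq_sqrt (by positivity)
  -- `81920 = 64 * (5 * 4 ^ 4)`: twice the factor 32 of the moment bound, times the bound of
  -- `sum_pairs_inv_pow_le`. The summand 1 keeps the error levels positive.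
  have s2 : √(81920 * K * A + 1) ^ 2 = 81920 * K * A + 1 := Real.sq_sqrt (by positivity)
  -- With `r` joint nodes, the two counts are of relative order `n ^ (-2r)` and `n ^ (-4)`. The
  -- weight `n ^ (r - 2)` makes both contributions `n ^ (-r - 2)`, which is summable over pairs of
  -- edges.
  have := h.abs_sub_ncdf_le hs hs2 hK (fun i => card_copyEdges_le i.1)
    (fun e e' => (n : ℝ) ^ (pairNodes e e').card / (n : ℝ) ^ 2) (fun e e' => by positivity)
    (δ₁ := √(8 * K * A * (m : ℝ) ^ 2 + 1) * (n : ℝ)⁻¹) (δ₂ := √(81920 * K * A + 1) * (n : ℝ)⁻¹)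
    (by positivity) (by positivity) ?_ ?_ z
  · refine this.trans (le_of_eq ?_)
    rw [rateConst]; ring
  · have e1 : (√(8 * K * A * (m : ℝ) ^ 2 + 1) * (n : ℝ)⁻¹ * s ^ 2) ^ 2
        = (8 * K * A * (m : ℝ) ^ 2 + 1) * s ^ 4 / (n : ℝ) ^ 2 := by
      rw [mul_pow, mul_pow, s1]; field_simp
    rw [e1, le_div_iff₀ (by positivity)]
    calc 8 * K * ((linkedCount E : ℝ) * (m : ℝ) ^ 2) * (n : ℝ) ^ 2
        = 8 * K * (m : ℝ) ^ 2 * (linkedCount E * (n : ℝ) ^ 2) := by ring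
      _ ≤ 8 * K * (m : ℝ) ^ 2 * (A * s ^ 4) := mul_le_mul_of_nonneg_left hL (by positivity)
      _ ≤ (8 * K * A * (m : ℝ) ^ 2 + 1) * s ^ 4 := by nlinarith [pow_pos hs 4]
  · have e1 : (√(81920 * K * A + 1) * (n : ℝ)⁻¹ * s ^ 2) ^ 2
        = (81920 * K * A + 1) * s ^ 4 / (n : ℝ) ^ 2 := by
      rw [mul_pow, mul_pow, s2]; field_simp
    rw [e1]
    have hterm : ∀ e e' : Pairs n, 32 * K * ((n : ℝ) ^ (pairNodes e e').card / (n : ℝ) ^ 2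
          * pairCount E e e' + ((n : ℝ) ^ (pairNodes e e').card / (n : ℝ) ^ 2)⁻¹ * pairCount E e e)
        ≤ 64 * K * A * s ^ 4 / (n : ℝ) ^ 2 * ((n : ℝ) ^ (pairNodes e e').card)⁻¹ := by
      intro e e'
      set r := (pairNodes e e').card with hr
      have p1 : (pairCount E e e' : ℝ) ≤ A * s ^ 4 / (n : ℝ) ^ (2 * r) := by
        rw [le_div_iff₀ (by positivity)]; exact hP e e'
      have p2 : (pairCount E e e : ℝ) ≤ A * s ^ 4 / (n : ℝ) ^ (2 * 2) := by
        rw [le_div_iff₀ (by positivity)]; exact hP2 e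
      calc _ ≤ 32 * K * ((n : ℝ) ^ r / (n : ℝ) ^ 2 * (A * s ^ 4 / (n : ℝ) ^ (2 * r))
            + ((n : ℝ) ^ r / (n : ℝ) ^ 2)⁻¹ * (A * s ^ 4 / (n : ℝ) ^ (2 * 2))) := by gcongr
        _ = _ := by
          rw [two_mul r, pow_add]
          field_simp
          ring
    calc _ ≤ ∑ e, ∑ e', 64 * K * A * s ^ 4 / (n : ℝ) ^ 2 * ((n : ℝ) ^ (pairNodes e e').card)⁻¹ :=
          Finset.sum_le_sum fun e _ => Finset.sum_le_sum fun e' _ => hterm e e'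
      _ = 64 * K * A * s ^ 4 / (n : ℝ) ^ 2
          * ∑ e : Pairs n, ∑ e' : Pairs n, ((n : ℝ) ^ (pairNodes e e').card)⁻¹ := by
          simp only [Finset.mul_sum]
      _ ≤ 64 * K * A * s ^ 4 / (n : ℝ) ^ 2 * (5 * 4 ^ 4) :=
          mul_le_mul_of_nonneg_left (sum_pairs_inv_pow_le hn) (by positivity)
      _ = 81920 * K * A * s ^ 4 / (n : ℝ) ^ 2 := by ring
      _ ≤ (81920 * K * A + 1) * s ^ 4 / (n : ℝ) ^ 2 := by
          gcongr; linarith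

end Counts

/-! ### Lower bounds for the number of embeddings and of their coincidences. -/

section Embeddings

/-- Every map from `Fin k` to `Fin n` factors through the increasing enumeration of some `k`-set
that contains its image. -/
lemma pow_le_card_orderEmbedding {k n : ℕ} (hkn : k ≤ n) :
    n ^ k ≤ Fintype.card (Fin k ↪o Fin n) * k ^ k := by
  have hs : Function.Surjective fun x : (Fin k ↪o Fin n) × (Fin k → Fin k) =>
      (fun i => x.1 (x.2 i) : Fin k → Fin n) := by
    intro h
    have hc : (Finset.univ.image h).card ≤ k := Finset.card_image_le.trans (by simp)
    obtain ⟨T, hT, hTc⟩ := Finset.exists_superset_card_eq hc (by simpa using hkn)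
    have : ∀ i, ∃ j, T.orderEmbOfFin hTc j = h i := fun i => by
      have : h i ∈ (T : Set (Fin n)) := hT (Finset.mem_image_of_mem h (Finset.mem_univ i))
      rwa [← Finset.range_orderEmbOfFin T hTc] at this
    choose b hb using this
    exact ⟨(T.orderEmbOfFin hTc, b), funext hb⟩
  have := Fintype.card_le_of_surjective _ hs
  simpa [Fintype.card_prod] using this

/-- Cauchy–Schwarz for the sizes of the fibres. -/
lemma sq_card_le_card_mul {A B : Type*} [Fintype A] [Fintype B] [DecidableEq B] (f : A → B) :
    (Fintype.card A) ^ 2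
      ≤ Fintype.card B * (Finset.univ.filter fun x : A × A => f x.1 = f x.2).card := by
  have h1 : Fintype.card A = ∑ b, (Finset.univ.filter fun a => f a = b).card :=
    Finset.card_eq_sum_card_fiberwise fun _ _ => Finset.mem_univ _
  have h2 : (Finset.univ.filter fun x : A × A => f x.1 = f x.2).card
      = ∑ b, (Finset.univ.filter fun a => f a = b).card ^ 2 := by
    rw [Finset.card_eq_sum_card_fiberwise (f := fun x : A × A => f x.1)
      (t := (Finset.univ : Finset B)) fun _ _ => Finset.mem_univ _]
    refine Finset.sum_congr rfl fun b _ => ?_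
    rw [sq, ← Finset.card_product]
    congr 1
    ext x
    simp only [Finset.mem_filter, Finset.mem_univ, true_and, Finset.mem_product]
    grind
  rw [h1, h2]
  exact sq_sum_le_card_mul_sum_sq

end Embeddings

/-! ### Hoeffding components placed on copies of edge sets. -/

section Placement

variable {𝒴 : Type*} [MeasurableSpace 𝒴] {ν : Measure 𝒴} [IsProbabilityMeasure ν] {k n d : ℕ}
  {g : (Pairs k → 𝒴) → ℝ}

lemma Pairs.map_map {k m n : ℕ} (π : Fin k ↪ Fin m) (α : Fin m ↪ Fin n) (e : Pairs k) :
    (e.map π).map α = e.map (π.trans α) :=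
  Subtype.ext (Sym2.map_map _)

lemma Pairs.map_congr {k n : ℕ} {α β : Fin k ↪ Fin n} {e : Pairs k} (h : ∀ v ∈ e.1, α v = β v) :
    e.map α = e.map β :=
  Subtype.ext (Sym2.map_congr h)

/-- A symmetric function has the same component on two copies of edge sets with the same image. -/
lemma hoef_comp_map_eq (hg : Measurable g) (hsym : ∀ π : Equiv.Perm (Fin k),
      ∀ᵐ y ∂(Measure.pi fun _ => ν), g (fun e => y (e.map π.toEmbedding)) = g y)
    {α α' : Fin k ↪ Fin n} {B B' : Finset (Pairs k)}
    (h : B.image (Pairs.map α) = B'.image (Pairs.map α')) :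
    ∀ᵐ y ∂(Measure.pi fun _ => ν), hoef ν g B (fun e => y (e.map α))
      = hoef ν g B' (fun e => y (e.map α')) := by
  have hN : (nodes B).image α = (nodes B').image α' := by
    rw [← nodes_image, ← nodes_image, h]
  -- Equal images match the nodes of `B'` with those of `B`. This bijection extends to a permutation
  -- `π` of all indices, under which `g` is symmetric.
  have hex : ∀ v : {v // v ∈ nodes B'}, ∃ u : {u // u ∈ nodes B}, α u = α' v := by
    intro v
    have : α' v ∈ (nodes B).image α := hN ▸ Finset.mem_image_of_mem α' v.2
    obtain ⟨u, hu, hu'⟩ := Finset.mem_image.1 this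
    exact ⟨⟨u, hu⟩, hu'⟩
  choose c hc using hex
  have hcb : Function.Bijective c := by
    rw [Fintype.bijective_iff_injective_and_card]
    refine ⟨fun v w hvw => ?_, ?_⟩
    · have := hc v
      rw [hvw, hc w] at this
      exact Subtype.ext (α'.injective this.symm)
    · have := congrArg Finset.card hN
      rw [Finset.card_image_of_injective _ α.injective,
        Finset.card_image_of_injective _ α'.injective] at this
      simp [this]
  let π : Equiv.Perm (Fin k) := (Equiv.ofBijective c hcb).extendSubtype
  have hπ : ∀ v ∈ nodes B', α (π v) = α' v := by
    intro v hv
    have : π v = c ⟨v, hv⟩ := Equiv.extendSubtype_apply_of_mem _ v hv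
    rw [this, hc]
  have hmap : ∀ e ∈ B', (e.map π.toEmbedding).map α = e.map α' := by
    intro e he
    rw [Pairs.map_map]
    exact Pairs.map_congr fun v hv => hπ v (mem_nodes.2 ⟨e, he, hv⟩)
  have hB : B'.image (Pairs.map π.toEmbedding) = B := by
    apply Finset.image_injective (Pairs.map_injective α)
    rw [h, Finset.image_image]
    exact Finset.image_congr hmap
  let r : Equiv.Perm (Pairs k) := Equiv.ofBijective (Pairs.map π.toEmbedding)
    (Finite.injective_iff_bijective.1 (Pairs.map_injective _))
  have h1 := hoef_comp_perm hg r (hsym π) B'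
  have h2 := (measurePreserving_comp_injective (m := ν)
    (Pairs.map_injective α)).quasiMeasurePreserving.ae h1
  filter_upwards [h2] with y hy
  have hr : B'.image r = B := hB
  rw [hr] at hy
  rw [← hy]
  refine dependsOn_hoef B' fun e he => ?_
  exact congrArg y (hmap e he)

/-- The component of `g` on the edge set `i.2`, evaluated at the copy that is placed by `i.1`. -/
noncomputable def copyHoef (ν : Measure 𝒴) (g : (Pairs k → 𝒴) → ℝ)
    (i : (Fin k ↪o Fin n) × Finset (Pairs k)) (y : Pairs n → 𝒴) : ℝ :=
  hoef ν g i.2 fun e => y (e.map i.1.toEmbedding)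

lemma measurePreserving_map (α : Fin k ↪ Fin n) :
    MeasurePreserving (fun (y : Pairs n → 𝒴) (e : Pairs k) => y (e.map α))
      (Measure.pi fun _ => ν) (Measure.pi fun _ => ν) :=
  measurePreserving_comp_injective (Pairs.map_injective α)

lemma isDegenerateFamily_copyHoef (hg : Measurable g) (hg4 : MemLp g 4 (Measure.pi fun _ => ν))
    {𝓑 : Finset (Finset (Pairs k))} (hne : ∀ B ∈ 𝓑, B.Nonempty) :
    IsDegenerateFamily ν (fun i : Copies n 𝓑 => copyHoef ν g i.1) (fun i => copyEdges i.1)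
      ((2 ^ Fintype.card (Pairs k) * (eLpNorm g 4 (Measure.pi fun _ => ν)).toReal) ^ 4) where
  measurable i := (measurable_hoef hg _).comp (measurePreserving_map (ν := ν) _).measurable
  memLp i := (memLp_hoef hg hg4 _).comp_measurePreserving (measurePreserving_map (ν := ν) _)
  integral_le i := by
    refine le_trans (le_of_eq ?_) (integral_hoef_pow_four_le hg hg4 i.1.2)
    exact integral_comp_of_measurePreserving (measurePreserving_map (ν := ν) i.1.1.toEmbedding)
      ((measurable_hoef hg _).pow_const 4).aestronglyMeasurable
  dependsOn i := dependsOn_comp_injective (dependsOn_hoef _)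
  centered i b hb := by
    obtain ⟨a, ha, rfl⟩ := Finset.mem_image.1 (show b ∈ i.1.2.image _ from hb)
    exact Centered.comp_injective (Pairs.map_injective _) (centered_hoef hg hg4 ha)
  nonempty i := copyEdges_nonempty (hne _ i.2)

end Placement

/-! ### The lower bound on the variance. -/

section Variance

variable {𝒴 : Type*} [MeasurableSpace 𝒴] {ν : Measure 𝒴} [IsProbabilityMeasure ν] {k n d : ℕ}
  {g : (Pairs k → 𝒴) → ℝ}

lemma memLp_copyHoef (hg : Measurable g) (hg4 : MemLp g 4 (Measure.pi fun _ => ν))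
    (i : (Fin k ↪o Fin n) × Finset (Pairs k)) :
    MemLp (copyHoef ν g i) 2 (Measure.pi fun _ => ν) :=
  ((memLp_hoef hg hg4 _).comp_measurePreserving
    (measurePreserving_map (ν := ν) _)).mono_exponent (by norm_num)

lemma integrable_copyHoef_mul (hg : Measurable g) (hg4 : MemLp g 4 (Measure.pi fun _ => ν))
    (i j : (Fin k ↪o Fin n) × Finset (Pairs k)) :
    Integrable (fun y => copyHoef ν g i y * copyHoef ν g j y) (Measure.pi fun _ => ν) :=
  (memLp_copyHoef hg hg4 i).integrable_mul (memLp_copyHoef hg hg4 j)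

/-- An edge in one copy and not in the other can be integrated out first. -/
lemma integral_copyHoef_mul_of_ne (hg : Measurable g) (hg4 : MemLp g 4 (Measure.pi fun _ => ν))
    {i j : (Fin k ↪o Fin n) × Finset (Pairs k)} (h : copyEdges i ≠ copyEdges j) :
    ∫ y, copyHoef ν g i y * copyHoef ν g j y ∂(Measure.pi fun _ => ν) = 0 := by
  have key : ∀ i j : (Fin k ↪o Fin n) × Finset (Pairs k), ¬ copyEdges i ⊆ copyEdges j →
      ∫ y, copyHoef ν g i y * copyHoef ν g j y ∂(Measure.pi fun _ => ν) = 0 := by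
    intro i j hij
    obtain ⟨b, hb, hb'⟩ := Finset.not_subset.1 hij
    obtain ⟨a, ha, rfl⟩ := Finset.mem_image.1 (show b ∈ i.2.image _ from hb)
    exact (Centered.comp_injective (Pairs.map_injective i.1.toEmbedding)
      (centered_hoef hg hg4 ha)).integral_mul_eq_zero
      (dependsOn_comp_injective (r := Pairs.map j.1.toEmbedding) (dependsOn_hoef (ν := ν) (g := g) j.2))
      (by simpa [copyEdges] using hb') (integrable_copyHoef_mul hg hg4 i j)
  by_cases h1 : copyEdges i ⊆ copyEdges j
  · simp only [mul_comm (copyHoef ν g i _)]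
    exact key j i fun h2 => h (h1.antisymm h2)
  · exact key i j h1

lemma integral_copyHoef_mul_of_eq (hg : Measurable g) (hsym : ∀ π : Equiv.Perm (Fin k),
      ∀ᵐ y ∂(Measure.pi fun _ => ν), g (fun e => y (e.map π.toEmbedding)) = g y)
    {i j : (Fin k ↪o Fin n) × Finset (Pairs k)} (h : copyEdges i = copyEdges j) :
    ∫ y, copyHoef ν g i y * copyHoef ν g j y ∂(Measure.pi fun _ => ν)
      = ∫ y, hoef ν g i.2 y ^ 2 ∂(Measure.pi fun _ => ν) := by
  have h1 : ∀ᵐ y ∂(Measure.pi fun _ => ν), copyHoef ν g i y * copyHoef ν g j y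
      = hoef ν g i.2 (fun e => y (e.map i.1.toEmbedding)) ^ 2 := by
    filter_upwards [hoef_comp_map_eq hg hsym h] with y hy
    have : copyHoef ν g i y = copyHoef ν g j y := hy
    rw [← this, ← sq]; rfl
  rw [integral_congr_ae h1]
  exact integral_comp_of_measurePreserving (measurePreserving_map (ν := ν) i.1.toEmbedding)
    ((measurable_hoef hg _).pow_const 2).aestronglyMeasurable

lemma integral_copyHoef_mul_nonneg (hg : Measurable g) (hg4 : MemLp g 4 (Measure.pi fun _ => ν))
    (hsym : ∀ π : Equiv.Perm (Fin k),
      ∀ᵐ y ∂(Measure.pi fun _ => ν), g (fun e => y (e.map π.toEmbedding)) = g y)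
    (i j : (Fin k ↪o Fin n) × Finset (Pairs k)) :
    0 ≤ ∫ y, copyHoef ν g i y * copyHoef ν g j y ∂(Measure.pi fun _ => ν) := by
  by_cases h : copyEdges i = copyEdges j
  · rw [integral_copyHoef_mul_of_eq hg hsym h]
    exact integral_nonneg fun y => sq_nonneg _
  · exact (integral_copyHoef_mul_of_ne hg hg4 h).ge

/-- All mixed second moments are nonnegative by symmetry of `g` and orthogonality, so it is enough
to keep pairs of embeddings of `B` that agree on its nodes. By `sq_card_le_card_mul`, at least a
fraction `n ^ (-(nodes B).card)` of all pairs does. -/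
lemma integral_sq_sum_copyHoef_ge (hg : Measurable g) (hg4 : MemLp g 4 (Measure.pi fun _ => ν))
    (hsym : ∀ π : Equiv.Perm (Fin k),
      ∀ᵐ y ∂(Measure.pi fun _ => ν), g (fun e => y (e.map π.toEmbedding)) = g y)
    {𝓑 : Finset (Finset (Pairs k))} {B : Finset (Pairs k)} (hB : B ∈ 𝓑) :
    (Fintype.card (Fin k ↪o Fin n) : ℝ) ^ 2 * ∫ y, hoef ν g B y ^ 2 ∂(Measure.pi fun _ => ν)
      ≤ (n : ℝ) ^ (nodes B).card
        * ∫ y, (∑ i : Copies n 𝓑, copyHoef ν g i.1 y) ^ 2 ∂(Measure.pi fun _ => ν) := by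
  classical
  set σ2 := ∫ y, hoef ν g B y ^ 2 ∂(Measure.pi fun _ => ν) with hσ2
  have hσ0 : 0 ≤ σ2 := integral_nonneg fun y => sq_nonneg _
  let D := Finset.univ.filter fun x : (Fin k ↪o Fin n) × (Fin k ↪o Fin n) =>
    (fun v : {v // v ∈ nodes B} => x.1 v.1) = fun v => x.2 v.1
  have h1 : (Fintype.card (Fin k ↪o Fin n)) ^ 2 ≤ n ^ (nodes B).card * D.card := by
    have := sq_card_le_card_mul fun (α : Fin k ↪o Fin n) (v : {v // v ∈ nodes B}) => α v.1
    simpa using this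
  have hexp : ∫ y, (∑ i : Copies n 𝓑, copyHoef ν g i.1 y) ^ 2 ∂(Measure.pi fun _ => ν)
      = ∑ x : Copies n 𝓑 × Copies n 𝓑,
        ∫ y, copyHoef ν g x.1.1 y * copyHoef ν g x.2.1 y ∂(Measure.pi fun _ => ν) := by
    rw [← integral_finsetSum _ fun x _ => integrable_copyHoef_mul hg hg4 x.1.1 x.2.1]
    congr 1; funext y
    rw [sq, Finset.sum_mul_sum, ← Fintype.sum_prod_type']
  have h2 : (D.card : ℝ) * σ2
      ≤ ∫ y, (∑ i : Copies n 𝓑, copyHoef ν g i.1 y) ^ 2 ∂(Measure.pi fun _ => ν) := by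
    let ι : (Fin k ↪o Fin n) × (Fin k ↪o Fin n) ↪ Copies n 𝓑 × Copies n 𝓑 :=
      ⟨fun x => (⟨(x.1, B), hB⟩, ⟨(x.2, B), hB⟩), fun x x' h => by
        simp only [Prod.mk.injEq, Subtype.mk.injEq, and_true] at h
        exact Prod.ext h.1 h.2⟩
    rw [hexp]
    calc (D.card : ℝ) * σ2 = ∑ x ∈ D.map ι,
          ∫ y, copyHoef ν g x.1.1 y * copyHoef ν g x.2.1 y ∂(Measure.pi fun _ => ν) := by
          rw [Finset.sum_map, ← nsmul_eq_mul, ← Finset.sum_const]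
          refine Finset.sum_congr rfl fun x hx => ?_
          refine (integral_copyHoef_mul_of_eq (i := (x.1, B)) (j := (x.2, B)) hg hsym ?_).symm
          refine Finset.image_congr fun e he => Pairs.map_congr fun v hv => ?_
          exact congrFun (Finset.mem_filter.1 hx).2 ⟨v, mem_nodes.2 ⟨e, he, hv⟩⟩
      _ ≤ _ := Finset.sum_le_univ_sum_of_nonneg fun x =>
          integral_copyHoef_mul_nonneg hg hg4 hsym x.1.1 x.2.1
  calc _ ≤ ((n : ℝ) ^ (nodes B).card * D.card) * σ2 := by
        gcongr
        exact_mod_cast h1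
    _ = (n : ℝ) ^ (nodes B).card * (D.card * σ2) := by ring
    _ ≤ _ := by gcongr

/-- The squared variance bound in the form required by `abs_sub_ncdf_le_of_copies`; the power of `k`
comes from `pow_le_card_orderEmbedding`. -/
lemma pow_le_sq_integral_sq_sum_copyHoef (hkn : k ≤ n) (hk : 0 < k) (hg : Measurable g)
    (hg4 : MemLp g 4 (Measure.pi fun _ => ν)) (hsym : ∀ π : Equiv.Perm (Fin k),
      ∀ᵐ y ∂(Measure.pi fun _ => ν), g (fun e => y (e.map π.toEmbedding)) = g y)
    {𝓑 : Finset (Finset (Pairs k))} {B : Finset (Pairs k)} (hB : B ∈ 𝓑) {σ : ℝ}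
    (hσ : σ ^ 2 ≤ ∫ y, hoef ν g B y ^ 2 ∂(Measure.pi fun _ => ν)) :
    σ ^ 4 / (k : ℝ) ^ (4 * k) * (n : ℝ) ^ (4 * k)
      ≤ (∫ y, (∑ i : Copies n 𝓑, copyHoef ν g i.1 y) ^ 2 ∂(Measure.pi fun _ => ν)) ^ 2
        * (n : ℝ) ^ (2 * (nodes B).card) := by
  have hk' : (0 : ℝ) < k := by exact_mod_cast hk
  have h1 := integral_sq_sum_copyHoef_ge (n := n) hg hg4 hsym hB
  set V := ∫ y, (∑ i : Copies n 𝓑, copyHoef ν g i.1 y) ^ 2 ∂(Measure.pi fun _ => ν)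
  set N : ℝ := (Fintype.card (Fin k ↪o Fin n) : ℝ) with hN
  have h2 : (n : ℝ) ^ k ≤ N * (k : ℝ) ^ k := by
    rw [hN]; exact_mod_cast pow_le_card_orderEmbedding hkn
  have h3 : N ^ 2 * σ ^ 2 ≤ (n : ℝ) ^ (nodes B).card * V :=
    (mul_le_mul_of_nonneg_left hσ (by positivity)).trans h1
  have h4 : (N ^ 2 * σ ^ 2) ^ 2 ≤ ((n : ℝ) ^ (nodes B).card * V) ^ 2 := by gcongr
  have h5 : ((n : ℝ) ^ k) ^ 4 ≤ (N * (k : ℝ) ^ k) ^ 4 := by gcongr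
  rw [div_mul_eq_mul_div, div_le_iff₀ (by positivity)]
  calc σ ^ 4 * (n : ℝ) ^ (4 * k) = σ ^ 4 * ((n : ℝ) ^ k) ^ 4 := by
        rw [← pow_mul, mul_comm k 4]
    _ ≤ σ ^ 4 * (N * (k : ℝ) ^ k) ^ 4 := by gcongr
    _ = (N ^ 2 * σ ^ 2) ^ 2 * (k : ℝ) ^ (4 * k) := by rw [mul_comm 4 k, pow_mul]; ring
    _ ≤ ((n : ℝ) ^ (nodes B).card * V) ^ 2 * (k : ℝ) ^ (4 * k) := by gcongr
    _ = _ := by rw [mul_comm 2 (nodes B).card, pow_mul]; ring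

end Variance

/-! ### The statistic as a sum of placed components. -/

section Decomposition

variable {𝒴 : Type*} [MeasurableSpace 𝒴] {ν : Measure 𝒴} [IsProbabilityMeasure ν] {k n d : ℕ}
  {g : (Pairs k → 𝒴) → ℝ}

lemma hoef_empty (y : Pairs k → 𝒴) : hoef ν g ∅ y = ∫ x, g x ∂(Measure.pi fun _ => ν) := by
  simp [hoef, mobius, condE]

/-- The sum of `g` over all copies. -/
noncomputable def copySum (g : (Pairs k → 𝒴) → ℝ) (n : ℕ) (y : Pairs n → 𝒴) : ℝ :=
  ∑ α : Fin k ↪o Fin n, g fun e => y (e.map α.toEmbedding)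

lemma measurable_copySum (hg : Measurable g) : Measurable (copySum g n) :=
  Finset.measurable_sum _ fun α _ => hg.comp (by fun_prop)

/-- The empty edge set contributes the mean of `g` for every embedding; components of zero norm
vanish almost surely on every copy. -/
lemma copySum_ae_eq (hg : Measurable g) (hg4 : MemLp g 4 (Measure.pi fun _ => ν))
    {𝓑 : Finset (Finset (Pairs k))} (hne : ∀ B ∈ 𝓑, B.Nonempty)
    (h0 : ∀ B ∉ 𝓑, B.Nonempty → ∫ y, hoef ν g B y ^ 2 ∂(Measure.pi fun _ => ν) = 0) :
    ∀ᵐ y ∂(Measure.pi fun _ => ν), copySum g n y = ∑ i : Copies n 𝓑, copyHoef ν g i.1 y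
      + Fintype.card (Fin k ↪o Fin n) * ∫ x, g x ∂(Measure.pi fun _ => ν) := by
  classical
  have hz : ∀ B : Finset (Pairs k), B ∉ 𝓑 → B.Nonempty →
      ∀ᵐ y ∂(Measure.pi fun _ => ν), hoef ν g B y = 0 := by
    intro B hB hB'
    have hi : Integrable (fun y => hoef ν g B y ^ 2) (Measure.pi fun _ => ν) :=
      ((memLp_hoef hg hg4 B).mono_exponent (p := 2) (by norm_num)).integrable_sq
    filter_upwards [(integral_eq_zero_iff_of_nonneg (fun y => sq_nonneg _) hi).1 (h0 B hB hB')]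
      with y hy
    exact pow_eq_zero_iff (two_ne_zero) |>.1 hy
  have hz' : ∀ (α : Fin k ↪o Fin n) (B : Finset (Pairs k)), ∀ᵐ y ∂(Measure.pi fun _ => ν),
      B ∉ 𝓑 → B.Nonempty → copyHoef ν g (α, B) y = 0 := by
    intro α B
    by_cases hB : B ∉ 𝓑 ∧ B.Nonempty
    · filter_upwards [(measurePreserving_map (ν := ν) α.toEmbedding).quasiMeasurePreserving.ae
        (hz B hB.1 hB.2)] with y hy _ _
      exact hy
    · exact Filter.Eventually.of_forall fun y h1 h2 => absurd ⟨h1, h2⟩ hB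
  filter_upwards [ae_all_iff.2 fun α => ae_all_iff.2 (hz' α)] with y hy
  have e1 : ∑ i : Copies n 𝓑, copyHoef ν g i.1 y
      = ∑ α : Fin k ↪o Fin n, ∑ B ∈ 𝓑, copyHoef ν g (α, B) y := by
    rw [← Finset.sum_product']
    exact (Finset.sum_subtype _ (fun x => by simp) fun x => copyHoef ν g x y).symm
  have e2 : ∀ α : Fin k ↪o Fin n, g (fun e => y (e.map α.toEmbedding))
      = ∑ B ∈ 𝓑, copyHoef ν g (α, B) y + ∫ x, g x ∂(Measure.pi fun _ => ν) := by
    intro α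
    have hemp : (∅ : Finset (Pairs k)) ∉ 𝓑 := fun h => Finset.not_nonempty_empty (hne _ h)
    rw [← sum_hoef (ν := ν) (g := g), ← Finset.sum_subset (Finset.subset_univ (insert ∅ 𝓑)),
      Finset.sum_insert hemp, hoef_empty, add_comm]
    · rfl
    · intro B _ hB
      rw [Finset.mem_insert, not_or] at hB
      exact hy α B hB.2 (Finset.nonempty_iff_ne_empty.2 hB.1)
  rw [copySum, e1, Finset.sum_congr rfl fun α _ => e2 α, Finset.sum_add_distrib, Finset.sum_const,
    nsmul_eq_mul, Finset.card_univ]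

lemma integral_copySum (hg : Measurable g) (hg4 : MemLp g 4 (Measure.pi fun _ => ν)) :
    ∫ y, copySum g n y ∂(Measure.pi fun _ => ν)
      = Fintype.card (Fin k ↪o Fin n) * ∫ x, g x ∂(Measure.pi fun _ => ν) := by
  have hi : ∀ α : Fin k ↪o Fin n, Integrable (fun y : Pairs n → 𝒴 =>
      g fun e => y (e.map α.toEmbedding)) (Measure.pi fun _ => ν) := fun α =>
    (measurePreserving_map (ν := ν) α.toEmbedding).integrable_comp_of_integrable
      (hg4.integrable (by norm_num))
  simp only [copySum]
  rw [integral_finsetSum _ fun α _ => hi α]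
  have : ∀ α : Fin k ↪o Fin n, ∫ y : Pairs n → 𝒴, g (fun e => y (e.map α.toEmbedding))
      ∂(Measure.pi fun _ => ν) = ∫ x, g x ∂(Measure.pi fun _ => ν) := fun α =>
    integral_comp_of_measurePreserving (measurePreserving_map (ν := ν) α.toEmbedding)
      hg.aestronglyMeasurable
  rw [Finset.sum_congr rfl fun α _ => this α, Finset.sum_const, nsmul_eq_mul, Finset.card_univ]

/-- Normal approximation of a sum over copies, for the product measure. -/
theorem copySum_abs_sub_ncdf_le (hkn : k ≤ n) (hd0 : 0 < d) (hk : 0 < k) (hg : Measurable g)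
    (hg4 : MemLp g 4 (Measure.pi fun _ => ν)) (hsym : ∀ π : Equiv.Perm (Fin k),
      ∀ᵐ y ∂(Measure.pi fun _ => ν), g (fun e => y (e.map π.toEmbedding)) = g y)
    (hd : ∀ B : Finset (Pairs k), B.Nonempty →
      ∫ y, hoef ν g B y ^ 2 ∂(Measure.pi fun _ => ν) ≠ 0 → d ≤ (nodes B).card)
    (hb : ∀ B : Finset (Pairs k), B.Nonempty →
      ∫ y, hoef ν g B y ^ 2 ∂(Measure.pi fun _ => ν) ≠ 0 → (nodes B).card = d → Biconnected B)
    {B : Finset (Pairs k)} (hB : (nodes B).card = d) {σ : ℝ} (hσ0 : 0 < σ)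
    (hσ : σ ^ 2 ≤ ∫ y, hoef ν g B y ^ 2 ∂(Measure.pi fun _ => ν)) (z : ℝ) :
    |(Measure.pi fun _ => ν).real {y | (copySum g n y - ∫ x, copySum g n x ∂(Measure.pi fun _ => ν))
        / √(variance (copySum g n) (Measure.pi fun _ => ν)) ≤ z} - ncdf z|
      ≤ rateConst k ((2 ^ Fintype.card (Pairs k)
        * (eLpNorm g 4 (Measure.pi fun _ => ν)).toReal) ^ 4) (σ ^ 4 / (k : ℝ) ^ (4 * k))
        * (n : ℝ)⁻¹ := by
  classical
  have hk' : (0 : ℝ) < k := by exact_mod_cast hk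
  have hn : 0 < n := hk.trans_le hkn
  have hn' : (0 : ℝ) < n := by exact_mod_cast hn
  -- Dropping null components is essential: only for the remaining ones do the hypotheses give at
  -- least `d` nodes, and biconnectedness at exactly `d` nodes.
  let 𝓑 := Finset.univ.filter fun B : Finset (Pairs k) =>
    B.Nonempty ∧ ∫ y, hoef ν g B y ^ 2 ∂(Measure.pi fun _ => ν) ≠ 0
  have h𝓑 : ∀ B, B ∈ 𝓑 ↔ B.Nonempty ∧ ∫ y, hoef ν g B y ^ 2 ∂(Measure.pi fun _ => ν) ≠ 0 :=
    fun B => by simp [𝓑]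
  have hne : ∀ B ∈ 𝓑, B.Nonempty := fun B h => ((h𝓑 B).1 h).1
  have hBB : B ∈ 𝓑 := by
    refine (h𝓑 B).2 ⟨?_, ((by positivity : 0 < σ ^ 2).trans_le hσ).ne'⟩
    rw [Finset.nonempty_iff_ne_empty]
    rintro rfl
    simp [nodes] at hB
    omega
  have hU := copySum_ae_eq (n := n) hg hg4 hne fun B h1 h2 => by
    by_contra h3
    exact h1 ((h𝓑 B).2 ⟨h2, h3⟩)
  rw [← integral_copySum hg hg4] at hU
  have hvar : variance (copySum g n) (Measure.pi fun _ => ν)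
      = ∫ y, (∑ i : Copies n 𝓑, copyHoef ν g i.1 y) ^ 2 ∂(Measure.pi fun _ => ν) := by
    rw [variance_eq_integral (measurable_copySum hg).aemeasurable]
    refine integral_congr_ae ?_
    filter_upwards [hU] with y hy
    rw [hy, add_sub_cancel_right]
  set V := variance (copySum g n) (Measure.pi fun _ => ν) with hV
  have hlow := pow_le_sq_integral_sq_sum_copyHoef hkn hk hg hg4 hsym hBB hσ
  rw [← hvar, hB] at hlow
  have hV0 : 0 ≤ V := variance_nonneg _ _
  have hVpos : 0 < V := by
    refine lt_of_le_of_ne hV0 fun h => ?_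
    rw [← h, zero_pow two_ne_zero, zero_mul] at hlow
    have : 0 < σ ^ 4 / (k : ℝ) ^ (4 * k) * (n : ℝ) ^ (4 * k) := by positivity
    linarith
  have hs2 : √V ^ 2 = V := Real.sq_sqrt hV0
  have hs4 : √V ^ 4 = V ^ 2 := by rw [show 4 = 2 * 2 from rfl, pow_mul, hs2]
  have hmain := abs_sub_ncdf_le_of_copies (isDegenerateFamily_copyHoef hg hg4 hne) hn hne
    (fun B h => hd B ((h𝓑 B).1 h).1 ((h𝓑 B).1 h).2)
    (fun B h => hb B ((h𝓑 B).1 h).1 ((h𝓑 B).1 h).2) (Real.sqrt_pos.2 hVpos)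
    (by rw [hs2, hvar]) (by positivity) (c := σ ^ 4 / (k : ℝ) ^ (4 * k)) (by positivity)
    (by rw [hs4]; exact hlow) z
  refine le_trans (le_of_eq ?_) hmain
  congr 2
  refine measureReal_congr ?_
  filter_upwards [hU] with y hy
  have : copySum g n y - ∫ x, copySum g n x ∂(Measure.pi fun _ => ν)
      = ∑ i : Copies n 𝓑, copyHoef ν g i.1 y := by rw [hy, add_sub_cancel_right]
  exact congrArg (fun t => t / √V ≤ z) this

end Decomposition

end GenUStat

/-! ### Transfer of the main theorem to the product measure. -/

theorem theorem2p3 (k d : ℕ) (hd : 2 ≤ d) (hdk : d ≤ k) (σmin τ : ℝ) :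
    ∃ C : ℝ, 0 < C ∧
      ∀ (n : ℕ) (_ : k ≤ n)
        (Ω : Type u) [MeasurableSpace Ω] (P : Measure Ω) [IsProbabilityMeasure P]
        (𝒳 : Type v) [MeasurableSpace 𝒳] (μ : Measure 𝒳) [IsProbabilityMeasure μ]
        (𝒴 : Type w) [MeasurableSpace 𝒴] (ν : Measure 𝒴) [IsProbabilityMeasure ν]
        -- the i.i.d. families `X` and `Y`, independent of each other
        (X : Fin n → Ω → 𝒳) (Y : GenUStat.Pairs n → Ω → 𝒴)
        (_ : ∀ i, Measurable (X i)) (_ : ∀ e, Measurable (Y e))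
        (_ : ∀ i, P.map (X i) = μ) (_ : ∀ e, P.map (Y e) = ν)
        (_ : iIndepFun X P) (_ : iIndepFun Y P)
        (_ : IndepFun (fun ω i => X i ω) (fun ω e => Y e ω) P)
        -- the symmetric functions `f` and `g`, with `f(X; Y) = g(Y)` almost surely
        (f : GenUStat.Vars 𝒳 𝒴 k → ℝ) (_ : Measurable f) (_ : GenUStat.IsSymm μ ν f)
        (g : (GenUStat.Pairs k → 𝒴) → ℝ) (_ : Measurable g)
        (_ : GenUStat.IsSymm μ ν (fun p : GenUStat.Vars 𝒳 𝒴 k => g p.2))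
        (_ : ∀ᵐ p ∂(GenUStat.law μ ν k), f p = g p.2)
        -- `τ` is the `L⁴`-norm of `f`, which is finite
        (_ : MemLp f 4 (GenUStat.law μ ν k))
        (_ : (eLpNorm f 4 (GenUStat.law μ ν k)).toReal = τ)
        -- the principal degree, the smallest `σ_{A,B}`, and the principal support graphs
        (_ : GenUStat.IsPrincipalDegree μ ν f d)
        (_ : IsLeast ((fun AB => GenUStat.sigma μ ν f AB.1 AB.2) ''
          GenUStat.supportPairs μ ν f d) σmin)
        (_ : ∀ AB ∈ GenUStat.supportPairs μ ν f d, (GenUStat.graph AB.1 AB.2).Connected)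
        (_ : ∀ AB ∈ GenUStat.supportPairs μ ν f d,
          GenUStat.StronglyConnected (GenUStat.graph AB.1 AB.2))
        (S : Ω → ℝ)
        (_ : S = fun ω => GenUStat.uStat (fun p : GenUStat.Vars 𝒳 𝒴 k => g p.2) n
          (fun i => X i ω, fun e => Y e ω)),
        ∀ z : ℝ,
          |P.real {ω | (S ω - ∫ ω', S ω' ∂P) / Real.sqrt (variance S P) ≤ z}
              - cdf (gaussianReal 0 1) z| ≤ C * (n : ℝ)⁻¹ := by
  obtain hk : 0 < k := by omega
  -- The constant is chosen before any distribution is given; the maximum with 1 makes its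
  -- positivity immediate.
  refine ⟨max 1 (GenUStat.rateConst k ((2 ^ Fintype.card (GenUStat.Pairs k) * τ) ^ 4)
    (σmin ^ 4 / (k : ℝ) ^ (4 * k))), lt_max_of_lt_left one_pos, ?_⟩
  intro n hkn Ω _ P _ 𝒳 _ μ _ 𝒴 _ ν _ X Y hX hY hXμ hYν hXi hYi hXY f hf hfs g hg hgs hfg hf4 hτ
    hdeg hσ hconn hstrong S hS z
  have hsnd := GenUStat.measurePreserving_snd_law (μ := μ) (ν := ν) (k := k)
  have hg4 : MemLp g 4 (Measure.pi fun _ => ν) := by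
    rw [← hsnd.map_eq, memLp_map_measure_iff hg.aestronglyMeasurable hsnd.aemeasurable]
    exact (memLp_congr_ae hfg).1 hf4
  have hτg : (eLpNorm g 4 (Measure.pi fun _ => ν)).toReal = τ := by
    rw [← hτ, eLpNorm_congr_ae hfg]
    exact congrArg _ (eLpNorm_comp_measurePreserving hg.aestronglyMeasurable hsnd).symm
  have hsym : ∀ π : Equiv.Perm (Fin k), ∀ᵐ y ∂(Measure.pi fun _ => ν),
      g (fun e => y (e.map π.toEmbedding)) = g y := by
    intro π
    have hπ : Measurable fun y : GenUStat.Pairs k → 𝒴 => g fun e => y (e.map π.toEmbedding) :=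
      hg.comp (by fun_prop)
    rw [← hsnd.map_eq, ae_map_iff hsnd.aemeasurable (measurableSet_eq_fun hπ hg)]
    exact hgs π
  have hinteg : ∀ B : Finset (GenUStat.Pairs k),
      ∫ y, GenUStat.hoef ν g B y ^ 2 ∂(Measure.pi fun _ => ν) ≠ 0 →
      GenUStat.sigma μ ν f ∅ B ≠ 0 := by
    intro B h hs
    rw [← GenUStat.sigma_empty_sq (μ := μ) hg hg4 hfg, hs] at h
    exact h (by norm_num)
  obtain ⟨⟨⟨A, B⟩, ⟨hAB, hABd⟩, hσB⟩, hσle⟩ := hσ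
  obtain rfl : A = ∅ := by
    by_contra hA
    exact hAB (GenUStat.sigma_of_ne_empty hg hfg hA B)
  simp only at hσB hAB hABd
  rw [GenUStat.numNodes_empty] at hABd
  -- The minimum is attained, and at a component of nonzero norm.
  have hσpos : 0 < σmin := by
    rw [← hσB]
    exact lt_of_le_of_ne ENNReal.toReal_nonneg (Ne.symm hAB)
  have hmain := GenUStat.copySum_abs_sub_ncdf_le (n := n) hkn (by omega) hk hg hg4 hsym
    (d := d) ?_ ?_ hABd hσpos ?_ z
  · have hYlaw : MeasurePreserving (fun ω e => Y e ω) P (Measure.pi fun _ => ν) := by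
      refine ⟨by fun_prop, ?_⟩
      rw [(iIndepFun_iff_map_fun_eq_pi_map fun e => (hY e).aemeasurable).1 hYi]
      simp only [hYν]
    have hT : Measurable (GenUStat.copySum g n) := GenUStat.measurable_copySum hg
    have hSU : S = GenUStat.copySum g n ∘ fun ω e => Y e ω := hS
    have e1 : ∫ ω, S ω ∂P = ∫ y, GenUStat.copySum g n y ∂(Measure.pi fun _ => ν) := by
      rw [hSU]
      exact GenUStat.integral_comp_of_measurePreserving hYlaw hT.aestronglyMeasurable
    have e2 : variance S P = variance (GenUStat.copySum g n) (Measure.pi fun _ => ν) := by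
      rw [hSU, ← hYlaw.map_eq, variance_map hT.aemeasurable hYlaw.aemeasurable]
    have e3 : P.real {ω | (S ω - ∫ ω', S ω' ∂P) / √(variance S P) ≤ z}
        = (Measure.pi fun _ => ν).real {y | (GenUStat.copySum g n y
            - ∫ x, GenUStat.copySum g n x ∂(Measure.pi fun _ => ν))
          / √(variance (GenUStat.copySum g n) (Measure.pi fun _ => ν)) ≤ z} := by
      rw [e1, e2, ← hYlaw.measureReal_preimage
        (measurableSet_le ((hT.sub_const _).div_const _) measurable_const).nullMeasurableSet, hSU]
      rfl
    rw [e3]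
    refine hmain.trans ?_
    rw [hτg]
    gcongr
    exact le_max_right _ _
  · intro B' hB' h
    by_contra hlt
    have hpos : 0 < (GenUStat.nodes B').card := by
      obtain ⟨e, he⟩ := hB'
      obtain ⟨u, hu, -⟩ := e.exists_ne ⟨0, hk⟩
      exact Finset.card_pos.2 ⟨u, GenUStat.mem_nodes.2 ⟨e, he, hu⟩⟩
    -- A nonzero component on fewer than `d` nodes would make its level part nonzero, against the
    -- minimality of `d`.
    by_cases hz : GenUStat.levelPart μ ν f (GenUStat.nodes B').card =ᵐ[GenUStat.law μ ν k] 0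
    · exact h (GenUStat.integral_hoef_sq_eq_zero hg hg4 hfg hz rfl)
    · exact hlt (hdeg.2 ⟨hpos, hz⟩)
  · intro B' _ h hB'd
    have hmem : ((∅, B') : Finset (Fin k) × Finset (GenUStat.Pairs k))
        ∈ GenUStat.supportPairs μ ν f d :=
      ⟨hinteg B' h, (GenUStat.numNodes_empty B').trans hB'd⟩
    exact GenUStat.biconnected_of_stronglyConnected (hconn _ hmem) (hstrong _ hmem)
  · rw [← hσB]
    exact (GenUStat.sigma_empty_sq hg hg4 hfg B).le
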